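/- Let $R$ be a commutative ring with $1$, let $m\ge 1$ and $r\ge 0$ be integers, let $q\in R$ be a unit and $u_1,\dots,u_m\in R$. The Ariki--Koike algebra $\mathbf H=\mathbf H_m^r$ over $R$ is the associative unital $R$-algebra with generators $T_0,T_1,\dots,T_{r-1}$ and relations $T_0T_1T_0T_1=T_1T_0T_1T_0$; $T_iT_{i+1}T_i=T_{i+1}T_iT_{i+1}$ for $1\le i\le r-2$; $T_iT_j=T_jT_i$ for $|i-j|\ge 2$; $(T_i-q)(T_i+1)=0$ for $i\ne 0$; $(T_0-u_1)\cdots(T_0-u_m)=0$ (each relation being imposed when the generators occurring in it exist; in particular $\mathbf H=R$ for $r=0$). The symmetric group $\mathfrak S_r$ acts on $\{1,\dots,r\}$ from the right and $s_i=(i,i+1)$; for $w\in\mathfrak S_r$ put $T_w=T_{i_1}\cdots T_{i_k}$, where $w=s_{i_1}\cdots s_{i_k}$ is a reduced expression (this does not depend on the choice of the reduced expression). Put $L_1=T_0$, $L_i=q^{-1}T_{i-1}L_{i-1}T_{i-1}$ for $2\le i\le r$, and $\pi_k(x)=\prod_{j=1}^{k}(L_j-x)$ for $0\le k\le r$, $x\in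 R$ (so $\pi_0(x)=1$). Let $\Lambda[m,r]$ be the set of integer sequences $a=[a_0,a_1,\dots,a_m]$ with $0=a_0\le a_1\le\dots\le a_m=r$. For $a\in\Lambda[m,r]$ put $a'=[0,r-a_{m-1},\dots,r-a_1,r]\in\Lambda[m,r]$, $$\pi_a=\pi_{a_1}(u_2)\pi_{a_2}(u_3)\cdots\pi_{a_{m-1}}(u_m),\qquad \tilde\pi_a=\pi_{a_1}(u_{m-1})\pi_{a_2}(u_{m-2})\cdots\pi_{a_{m-1}}(u_1),$$ and let $w_a\in\mathfrak S_r$ be the permutation with $(a_{i-1}+l)w_a=r-a_i+l$ for all $1\le i\le m$ and $1\le l\le a_i-a_{i-1}$. Put $v_a=\pi_a\,T_{w_a}\,\tilde\pi_{a'}$. **Theorem.** For every $a\in\Lambda[m,r]$, the right ideal $v_a\mathbf H$ is a free $R$-module with basis $\{v_aT_w : w\in\mathfrak S_r\}$ (that is, the family $(v_aT_w)_{w\in\mathfrak S_r}$ is an $R$-basis of $v_a\mathbf H$). -/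

import Mathlib

namespace ArikiKoike

/-! ### The set `Λ[m,r]` -/

/-- An element `a = [a_0, a_1, …, a_m]` of `Λ[m,r]`: a chain `0 = a_0 ≤ a_1 ≤ ⋯ ≤ a_m = r` of
integers, that is, the partial sums of a composition of `r` with `m` parts. -/
structure Chain (m r : ℕ) where
  /-- the entry `a_i`, for `0 ≤ i ≤ m` -/
  val : Fin (m + 1) → ℕ
  zero_eq : val 0 = 0
  mono : Monotone val
  last_eq : val (Fin.last m) = r

namespace Chain

variable {m r : ℕ}

theorem val_le (a : Chain m r) (i : Fin (m + 1)) : a.val i ≤ r :=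
  (a.mono (Fin.le_last i)).trans a.last_eq.le

/-- `a' = [0, r - a_{m-1}, …, r - a_1, r]`, i.e. `a'_i = r - a_{m-i}`. -/
def dual (a : Chain m r) : Chain m r where
  val i := r - a.val i.rev
  zero_eq := by simp [a.last_eq]
  mono i j h := Nat.sub_le_sub_left (a.mono (Fin.rev_le_rev.mpr h)) r
  last_eq := by simp [a.zero_eq]

/-- Every point of `{0, …, r-1}` lies in one of the blocks `[a_i, a_{i+1})`. -/
theorem exists_block (a : Chain m r) (x : Fin r) :
    ∃ i : Fin m, a.val i.castSucc ≤ x ∧ (x : ℕ) < a.val i.succ := by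
  by_contra! hc
  have key : ∀ i : Fin (m + 1), a.val i ≤ x := by
    intro i
    induction i using Fin.induction with
    | zero => simp [a.zero_eq]
    | succ i ih => exact hc i ih
  have h1 := key (Fin.last m)
  rw [a.last_eq] at h1
  exact absurd x.isLt (not_lt.mpr h1)

/-- The index `i` of the block `[a_i, a_{i+1})` that contains `x`. -/
noncomputable def block (a : Chain m r) (x : Fin r) : Fin m := (a.exists_block x).choose

theorem block_spec (a : Chain m r) (x : Fin r) :
    a.val (a.block x).castSucc ≤ x ∧ (x : ℕ) < a.val (a.block x).succ :=
  (a.exists_block x).choose_spec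

theorem val_succ_le (a : Chain m r) {i j : Fin m} (h : i < j) :
    a.val i.succ ≤ a.val j.castSucc :=
  a.mono (by rw [Fin.le_def]; simpa using h)

/-- The map underlying `w_a`. -/
noncomputable def wFun (a : Chain m r) (x : Fin r) : Fin r :=
  ⟨r - a.val (a.block x).succ + (x - a.val (a.block x).castSucc), by
    have h1 := a.block_spec x
    have h2 := a.val_le (a.block x).succ
    omega⟩

theorem wFun_injective (a : Chain m r) : Function.Injective a.wFun := by
  intro x y hxy
  have hv := congrArg Fin.val hxy
  simp only [wFun] at hv
  have hx := a.block_spec x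
  have hy := a.block_spec y
  have hx2 := a.val_le (a.block x).succ
  have hy2 := a.val_le (a.block y).succ
  rcases lt_trichotomy (a.block x) (a.block y) with h | h | h
  · have := a.val_succ_le h
    omega
  · rw [h] at hv hx
    ext
    omega
  · have := a.val_succ_le h
    omega

/-- The permutation `w_a`. Permutations act on the right in the formula
`(a_{i-1} + l) w_a = r - a_i + l` for `1 ≤ l ≤ a_i - a_{i-1}`; here the points `1, …, r` are
written as `0, …, r-1`, and `w_a` is the bijection sending the point `x` to `(x) w_a`. -/
noncomputable def w (a : Chain m r) : Equiv.Perm (Fin r) :=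
  Equiv.ofBijective a.wFun (Finite.injective_iff_bijective.mp a.wFun_injective)

/-- The defining formula of `w_a` (with points shifted to start at `0`). -/
theorem w_apply (a : Chain m r) (i : Fin m) (x : Fin r)
    (h1 : a.val i.castSucc ≤ x) (h2 : (x : ℕ) < a.val i.succ) :
    (a.w x : ℕ) = r - a.val i.succ + (x - a.val i.castSucc) := by
  have hx := a.block_spec x
  have hb : a.block x = i := by
    rcases lt_trichotomy (a.block x) i with h | h | h
    · have := a.val_succ_le h
      omega
    · exact h
    · have := a.val_succ_le h
      omega
  simp [w, wFun, hb]

end Chain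

/-! ### Reduced expressions in the symmetric group -/

/-- The basic transposition `s_{i+1} = (i+1, i+2)` of `{1, …, r}`, with points written as
`0, …, r-1`; the index `i` runs through `0, …, r-2`. -/
def s {r : ℕ} (i : Fin (r - 1)) : Equiv.Perm (Fin r) :=
  Equiv.swap ⟨i, by omega⟩ ⟨i + 1, by omega⟩

/-- The product `s_{i_1} s_{i_2} ⋯ s_{i_k}` for the right action of permutations: first `s_{i_1}`
is applied, then `s_{i_2}`, and so on. (In Mathlib's `f * g` the factor `g` is applied first.) -/
def wordPerm {r : ℕ} : List (Fin (r - 1)) → Equiv.Perm (Fin r)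
  | [] => 1
  | i :: l => wordPerm l * s i

/-- `l` is a reduced expression of `w`: a product expression of minimal length. -/
def IsReduced {r : ℕ} (w : Equiv.Perm (Fin r)) (l : List (Fin (r - 1))) : Prop :=
  wordPerm l = w ∧ ∀ l' : List (Fin (r - 1)), wordPerm l' = w → l.length ≤ l'.length

theorem wordPerm_append {r : ℕ} (l l' : List (Fin (r - 1))) :
    wordPerm (l ++ l') = wordPerm l' * wordPerm l := by
  induction l with
  | nil => simp [wordPerm]
  | cons i l ih => simp [wordPerm, ih, mul_assoc]

theorem exists_word {r : ℕ} (w : Equiv.Perm (Fin r)) :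
    ∃ l : List (Fin (r - 1)), wordPerm l = w := by
  cases r with
  | zero => exact ⟨[], Subsingleton.elim _ _⟩
  | succ n =>
    have hw : w ∈ Submonoid.closure
        (Set.range fun i : Fin n => Equiv.swap i.castSucc i.succ) := by
      rw [Equiv.Perm.mclosure_swap_castSucc_succ]
      trivial
    induction hw using Submonoid.closure_induction with
    | mem x hx =>
      obtain ⟨i, rfl⟩ := hx
      exact ⟨[i], by simp only [wordPerm, one_mul]; rfl⟩
    | one => exact ⟨[], rfl⟩
    | mul x y _ _ hx hy =>
      obtain ⟨l, rfl⟩ := hx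
      obtain ⟨l', rfl⟩ := hy
      exact ⟨l' ++ l, wordPerm_append l' l⟩

theorem exists_isReduced {r : ℕ} (w : Equiv.Perm (Fin r)) :
    ∃ l : List (Fin (r - 1)), IsReduced w l := by
  obtain ⟨l, hl, hmin⟩ :=
    exists_minimalFor_of_wellFoundedLT (fun l : List (Fin (r - 1)) => wordPerm l = w)
      List.length (exists_word w)
  refine ⟨l, hl, fun l' hl' => ?_⟩
  rcases le_total l.length l'.length with h | h
  · exact h
  · exact hmin hl' h

/-! ### The Ariki–Koike algebra -/

/-- The defining relations of the Ariki–Koike algebra on the generators `T_0, …, T_{r-1}`. The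
parameters `u_1, …, u_m` are the values `u 0, …, u (m-1)`. -/
inductive Rel {R : Type*} [CommRing R] {m : ℕ} (r : ℕ) (q : Rˣ) (u : Fin m → R) :
    FreeAlgebra R (Fin r) → FreeAlgebra R (Fin r) → Prop
  | braid_zero (h : 1 < r) :
      Rel r q u
        (FreeAlgebra.ι R ⟨0, by omega⟩ * FreeAlgebra.ι R ⟨1, h⟩ *
          FreeAlgebra.ι R ⟨0, by omega⟩ * FreeAlgebra.ι R ⟨1, h⟩)
        (FreeAlgebra.ι R ⟨1, h⟩ * FreeAlgebra.ι R ⟨0, by omega⟩ *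
          FreeAlgebra.ι R ⟨1, h⟩ * FreeAlgebra.ι R ⟨0, by omega⟩)
  | braid (i : ℕ) (hi : 1 ≤ i) (h : i + 1 < r) :
      Rel r q u
        (FreeAlgebra.ι R ⟨i, by omega⟩ * FreeAlgebra.ι R ⟨i + 1, h⟩ *
          FreeAlgebra.ι R ⟨i, by omega⟩)
        (FreeAlgebra.ι R ⟨i + 1, h⟩ * FreeAlgebra.ι R ⟨i, by omega⟩ *
          FreeAlgebra.ι R ⟨i + 1, h⟩)
  | comm (i j : Fin r) (h : (i : ℕ) + 2 ≤ j) :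
      Rel r q u (FreeAlgebra.ι R i * FreeAlgebra.ι R j) (FreeAlgebra.ι R j * FreeAlgebra.ι R i)
  | quadratic (i : Fin r) (hi : (i : ℕ) ≠ 0) :
      Rel r q u
        ((FreeAlgebra.ι R i - algebraMap R _ (q : R)) * (FreeAlgebra.ι R i + 1)) 0
  | cyclotomic (h : 0 < r) :
      Rel r q u
        (List.ofFn fun k : Fin m => FreeAlgebra.ι R ⟨0, h⟩ - algebraMap R _ (u k)).prod 0

end ArikiKoike

/-- The Ariki–Koike algebra `H = H_m^r` over `R` with parameters `q` (a unit) and `u_1, …, u_m`: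
the associative unital `R`-algebra presented by the generators `T_0, …, T_{r-1}` and the relations
`ArikiKoike.Rel`. -/
def ArikiKoike {R : Type*} [CommRing R] {m : ℕ} (r : ℕ) (q : Rˣ) (u : Fin m → R) : Type _ :=
  RingQuot (ArikiKoike.Rel r q u)

namespace ArikiKoike

noncomputable instance {R : Type*} [CommRing R] {m : ℕ} (r : ℕ) (q : Rˣ) (u : Fin m → R) :
    Ring (ArikiKoike r q u) :=
  inferInstanceAs (Ring (RingQuot (Rel r q u)))

noncomputable instance {R : Type*} [CommRing R] {m : ℕ} (r : ℕ) (q : Rˣ) (u : Fin m → R) :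
    Algebra R (ArikiKoike r q u) :=
  inferInstanceAs (Algebra R (RingQuot (Rel r q u)))

section

variable {R : Type*} [CommRing R] {m : ℕ} (r : ℕ) (q : Rˣ) (u : Fin m → R)

/-- The projection from the free algebra onto `H`. -/
noncomputable def mk : FreeAlgebra R (Fin r) →ₐ[R] ArikiKoike r q u :=
  RingQuot.mkAlgHom R (Rel r q u)

/-- The generator `T_i`, for `0 ≤ i ≤ r - 1` (and `0` for other `i`, which are never used). -/
noncomputable def T (i : ℕ) : ArikiKoike r q u :=
  if h : i < r then mk r q u (FreeAlgebra.ι R ⟨i, h⟩) else 0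

/-- The elements `L_1 = T_0` and `L_i = q⁻¹ T_{i-1} L_{i-1} T_{i-1}` for `2 ≤ i ≤ r` (the value at
`0` is never used). -/
noncomputable def L : ℕ → ArikiKoike r q u
  | 0 => 0
  | 1 => T r q u 0
  | i + 2 => ((q⁻¹ : Rˣ) : R) • (T r q u (i + 1) * L (i + 1) * T r q u (i + 1))

/-- `T_{i_1} ⋯ T_{i_k}` for a word; recall that the letter `i` stands for `s_{i+1}`. -/
noncomputable def Tword (l : List (Fin (r - 1))) : ArikiKoike r q u :=
  (l.map fun i => T r q u (i + 1)).prod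

/-- `T_w = T_{i_1} ⋯ T_{i_k}`, where `w = s_{i_1} ⋯ s_{i_k}` is a reduced expression. (By the braid
relations the product does not depend on the reduced expression.) -/
noncomputable def Tperm (w : Equiv.Perm (Fin r)) : ArikiKoike r q u :=
  Tword r q u (exists_isReduced w).choose

/-- `π_k(x) = (L_1 - x) ⋯ (L_k - x)`, with `π_0(x) = 1`. -/
noncomputable def piElem (k : ℕ) (x : R) : ArikiKoike r q u :=
  ((List.range k).map fun j => L r q u (j + 1) - algebraMap R _ x).prod

variable {r}

/-- `π(a; x_1, …, x_{m-1}) = π_{a_1}(x_1) ⋯ π_{a_{m-1}}(x_{m-1})`; here `x_{i+1}` is `x i`. -/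
noncomputable def piSeq (a : Chain m r) (x : Fin (m - 1) → R) : ArikiKoike r q u :=
  (List.ofFn fun i : Fin (m - 1) => piElem r q u (a.val ⟨i + 1, by omega⟩) (x i)).prod

/-- `π_a = π(a; u_2, …, u_m)`. -/
noncomputable def piChain (a : Chain m r) : ArikiKoike r q u :=
  piSeq q u a fun i => u ⟨i + 1, by omega⟩

/-- `π̃_a = π(a; u_{m-1}, …, u_1)`. -/
noncomputable def piTilde (a : Chain m r) : ArikiKoike r q u :=
  piSeq q u a fun i => u ⟨m - 2 - i, by omega⟩

/-- `v_a = π_a T_{w_a} π̃_{a'}`. -/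
noncomputable def v (a : Chain m r) : ArikiKoike r q u :=
  piChain q u a * Tperm r q u a.w * piTilde q u a.dual

/-- The right ideal `v H = {v h : h ∈ H}` generated by `v`, as an `R`-submodule of `H`. -/
noncomputable def rightIdeal (x : ArikiKoike r q u) : Submodule R (ArikiKoike r q u) :=
  LinearMap.range (LinearMap.mulLeft R x)

end

end ArikiKoike

/-!
The `L_j` commute, `T_i` commutes with `L_j` for `j ≠ i, i+1`, and
`T_i L_i = L_{i+1} (T_i - (q - 1))`. Write `L^c` for the monomial with exponent `c`. The proof rests
on three facts.

*The algebra `H` has the basis `L^c T_w`, `0 ≤ c_j < m`.* Moving a `T_i` past `L^c` only moves the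
exponents of `L_i` and `L_{i+1}` towards each other or exchanges them, so products `L^c h`, with `h`
in the subalgebra generated by `T_1, …, T_{r-1}`, span `H`. Conjugation by the `T_i` turns the
cyclotomic relation into a rewriting rule for `L_j^m`, which allows to lower all exponents below `m`
(`span_Lmon_mul_Tperm`). For independence it suffices, by base change, to treat the generic
parameters, over `ℤ[u_1, …, u_m][q, q⁻¹]`. There `H` acts on functions of words in a coloured
alphabet: `T_i` for `i > 0` acts by the usual Hecke operators, and `T_0` by multiplication with the
parameter belonging to the colour of the first letter, up to a correction that is trivial for
`q = 1` (`wordRep`). Modulo `q - 1` the element `L^c T_w` permutes the letters of a word by `w` and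
multiplies by a monomial in the parameters. As a polynomial of degree less than `m` in every
variable is determined by its values on a grid of side `m`, all coefficients of a linear relation
are divisible by `q - 1`, hence by all its powers, hence zero
(`linearIndependent_of_specialisation`, `linearIndependent_Lmon_mul_Tperm`).

*The `v_a T_w` span `v_a H`.* If `c + d > r` and the roots `u_1, …, u_m` are distributed to two sets
`S` and `S'`, then `∏_{l ∈ S} π_c(u_l) T_w ∏_{l ∈ S'} π_d(u_l) = 0` for all `w`
(`polyL_mul_Tperm_mul_polyL`). Hence `v_a L_j` is a multiple of `v_a` if `j` is the first point of a
block of `a'`. Inside the blocks `v_a` intertwines the generators `T_i`, so that for every `j` the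
product `v_a L_j` is `v_a h` with `h` in the subalgebra generated by `T_1, …, T_{r-1}`. This
subalgebra therefore already generates the right ideal `v_a H` (`rightIdeal_v_eq_span`).

*The `v_a T_w` are independent.* The leading monomial of `π_a` is `L^α`, that of `π̃_{a'}` is `L^β`,
where `α` and `β` are decreasing and `α + β ∘ w_a` is constant with value `m - 1`. Since `β` is
decreasing, `T_{w_a} L^β` is `L^{β ∘ w_a}` times a unit of the subalgebra generated by
`T_1, …, T_{r-1}`, up to terms for whose exponents `∑ (γ_j + 1)^2` is smaller. By the inequality
`2xy ≤ x^2 + y^2` these are the terms of smaller weight with respect to `ω = β ∘ w_a + 1`, and so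
`v_a` is `(L_1 ⋯ L_r)^{m-1}` times a unit, up to terms of smaller weight (`v_leading`). The weight
`ω` is increasing, so that the rewriting of `L_j^m` does not increase it. By the basis of `H` the
leading term of `v_a x` vanishes only if `x = 0`, for `x` in that subalgebra.
-/

namespace ArikiKoike

/-! ### Inversions and reduced expressions in the symmetric group -/

section SymmetricGroup

variable {r : ℕ}

/-- The left point `i` moved by `s i`. -/
abbrev lo (i : Fin (r - 1)) : Fin r := ⟨i, by omega⟩

/-- The right point `i + 1` moved by `s i`. -/
abbrev hi (i : Fin (r - 1)) : Fin r := ⟨i + 1, by omega⟩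

theorem lo_lt_hi (i : Fin (r - 1)) : lo i < hi i := by simp [Fin.lt_def]

@[simp] theorem s_lo (i : Fin (r - 1)) : s i (lo i) = hi i := Equiv.swap_apply_left _ _

@[simp] theorem s_hi (i : Fin (r - 1)) : s i (hi i) = lo i := Equiv.swap_apply_right _ _

theorem s_of_ne {i : Fin (r - 1)} {x : Fin r} (h1 : x ≠ lo i) (h2 : x ≠ hi i) : s i x = x :=
  Equiv.swap_apply_of_ne_of_ne h1 h2

@[simp] theorem s_mul_s (i : Fin (r - 1)) : s i * s i = 1 := Equiv.swap_mul_self _ _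

@[simp] theorem s_s (i : Fin (r - 1)) (x : Fin r) : s i (s i x) = x := Equiv.swap_apply_self _ _ _

@[simp] theorem mul_s_mul_s (w : Equiv.Perm (Fin r)) (i : Fin (r - 1)) : w * s i * s i = w := by
  rw [mul_assoc, s_mul_s, mul_one]

theorem s_inv (i : Fin (r - 1)) : (s i)⁻¹ = s i := Equiv.swap_inv _ _

theorem s_val (i : Fin (r - 1)) (x : Fin r) :
    (s i x : ℕ) = if (x : ℕ) = i then (i : ℕ) + 1 else if (x : ℕ) = i + 1 then (i : ℕ) else x := by
  unfold s
  rw [Equiv.swap_apply_def]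
  simp only [Fin.ext_iff]
  split_ifs <;> rfl

theorem s_lt_s {i : Fin (r - 1)} {x y : Fin r} (h : x < y) (hne : ¬ (x = lo i ∧ y = hi i)) :
    s i x < s i y := by
  simp only [Fin.ext_iff] at hne
  rw [Fin.lt_def] at h ⊢
  rw [s_val, s_val]
  split_ifs <;> omega

/-- The set of inversions of a permutation. -/
def invSet (w : Equiv.Perm (Fin r)) : Finset (Fin r × Fin r) :=
  {p | p.1 < p.2 ∧ w p.2 < w p.1}

/-- The number of inversions of a permutation, which is its Coxeter length. -/
def inv (w : Equiv.Perm (Fin r)) : ℕ := (invSet w).card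

theorem mem_invSet {w : Equiv.Perm (Fin r)} {p : Fin r × Fin r} :
    p ∈ invSet w ↔ p.1 < p.2 ∧ w p.2 < w p.1 := by simp [invSet]

theorem inv_mul_s_of_lt {w : Equiv.Perm (Fin r)} {i : Fin (r - 1)} (h : w (lo i) < w (hi i)) :
    inv (w * s i) = inv w + 1 := by
  have hnot : (lo i, hi i) ∉ (invSet w).image (Prod.map (s i) (s i)) := by
    simp only [Finset.mem_image, Prod.exists, Prod.map_apply, Prod.mk.injEq, not_exists, not_and]
    intro x y hxy hx hy
    have hx' : x = hi i := by rw [← s_s i x, hx, s_lo]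
    have hy' : y = lo i := by rw [← s_s i y, hy, s_hi]
    subst hx' hy'
    exact absurd (mem_invSet.mp hxy).1 (lo_lt_hi i).not_gt
  have key : invSet (w * s i) = insert (lo i, hi i) ((invSet w).image (Prod.map (s i) (s i))) := by
    ext ⟨x, y⟩
    simp only [Finset.mem_insert, Finset.mem_image, mem_invSet, Prod.exists, Prod.map_apply,
      Prod.mk.injEq, Equiv.Perm.mul_apply]
    constructor
    · rintro ⟨h1, h2⟩
      by_cases hc : x = lo i ∧ y = hi i
      · exact Or.inl hc
      · exact Or.inr ⟨s i x, s i y, ⟨s_lt_s h1 hc, h2⟩, by simp, by simp⟩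
    · rintro (⟨rfl, rfl⟩ | ⟨x, y, ⟨h1, h2⟩, rfl, rfl⟩)
      · exact ⟨lo_lt_hi i, by simpa using h⟩
      · refine ⟨s_lt_s h1 ?_, by simpa using h2⟩
        rintro ⟨rfl, rfl⟩
        exact absurd h2 h.not_gt
  rw [inv, key, Finset.card_insert_of_notMem hnot, Finset.card_image_of_injective _
    ((s i).injective.prodMap (s i).injective), inv]

theorem inv_mul_s_of_gt {w : Equiv.Perm (Fin r)} {i : Fin (r - 1)} (h : w (hi i) < w (lo i)) :
    inv w = inv (w * s i) + 1 := by
  rw [← inv_mul_s_of_lt (w := w * s i) (i := i) (by simpa using h), mul_s_mul_s]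

theorem lo_ne_hi_apply (w : Equiv.Perm (Fin r)) (i : Fin (r - 1)) : w (lo i) ≠ w (hi i) :=
  fun h => (lo_lt_hi i).ne (w.injective h)

theorem inv_mul_s_le (w : Equiv.Perm (Fin r)) (i : Fin (r - 1)) : inv (w * s i) ≤ inv w + 1 := by
  rcases lt_or_gt_of_ne (lo_ne_hi_apply w i) with h | h
  · exact (inv_mul_s_of_lt h).le
  · have := inv_mul_s_of_gt h
    omega

@[simp] theorem inv_one : inv (1 : Equiv.Perm (Fin r)) = 0 := by
  rw [inv, Finset.card_eq_zero, Finset.eq_empty_iff_forall_notMem]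
  intro p hp
  have := mem_invSet.mp hp
  exact absurd this.1 this.2.not_gt

theorem inv_inv (w : Equiv.Perm (Fin r)) : inv w⁻¹ = inv w := by
  have key : invSet w⁻¹ = (invSet w).image (fun p => (w p.2, w p.1)) := by
    ext ⟨x, y⟩
    simp only [Finset.mem_image, mem_invSet, Prod.exists, Prod.mk.injEq]
    constructor
    · rintro ⟨h1, h2⟩
      exact ⟨w⁻¹ y, w⁻¹ x, ⟨h2, by simpa using h1⟩, by simp, by simp⟩
    · rintro ⟨x, y, ⟨h1, h2⟩, rfl, rfl⟩
      exact ⟨h2, by simpa using h1⟩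
  rw [inv, key, Finset.card_image_of_injective, inv]
  rintro ⟨x, y⟩ ⟨x', y'⟩ h
  simp only [Prod.mk.injEq, EmbeddingLike.apply_eq_iff_eq] at h
  simp [h.1, h.2]

theorem inv_s_mul_of_lt {w : Equiv.Perm (Fin r)} {j : Fin (r - 1)}
    (h : w⁻¹ (lo j) < w⁻¹ (hi j)) : inv (s j * w) = inv w + 1 := by
  rw [← inv_inv, mul_inv_rev, s_inv, inv_mul_s_of_lt h, inv_inv]

/-- A permutation without descents is the identity. -/
theorem eq_one_of_no_descent {w : Equiv.Perm (Fin r)} (h : ∀ i, w (lo i) < w (hi i)) : w = 1 := by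
  cases r with
  | zero => exact Subsingleton.elim _ _
  | succ n =>
    have hm : StrictMono w := Fin.strictMono_iff_lt_succ.mpr fun i => h i
    ext x
    have := Subsingleton.elim (hm.orderIsoOfSurjective w w.surjective) (OrderIso.refl _)
    have h2 := congrArg (fun e : Fin (n + 1) ≃o Fin (n + 1) => (e x : ℕ)) this
    simpa using h2

theorem exists_descent {w : Equiv.Perm (Fin r)} (h : w ≠ 1) : ∃ i, w (hi i) < w (lo i) := by
  by_contra! hc
  exact h (eq_one_of_no_descent fun i => lt_of_le_of_ne (hc i) (lo_ne_hi_apply w i))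

/-- Induction along descents. -/
theorem descent_induction {P : Equiv.Perm (Fin r) → Prop} (one : P 1)
    (step : ∀ w i, w (hi i) < w (lo i) → P (w * s i) → P w) (w : Equiv.Perm (Fin r)) : P w := by
  induction hn : inv w using Nat.strong_induction_on generalizing w with
  | _ n ih =>
    by_cases h : w = 1
    · exact h ▸ one
    · obtain ⟨i, hi⟩ := exists_descent h
      have := inv_mul_s_of_gt hi
      exact step w i hi (ih _ (by omega) _ rfl)

theorem inv_wordPerm_le (l : List (Fin (r - 1))) : inv (wordPerm l) ≤ l.length := by
  induction l with
  | nil => simp [wordPerm]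
  | cons i l ih => exact (inv_mul_s_le _ _).trans (by simpa using ih)

theorem exists_word_length (w : Equiv.Perm (Fin r)) :
    ∃ l : List (Fin (r - 1)), wordPerm l = w ∧ l.length = inv w := by
  induction w using descent_induction with
  | one => exact ⟨[], rfl, by simp⟩
  | step w i h ih =>
    obtain ⟨l, hl, hlen⟩ := ih
    refine ⟨i :: l, by simp [wordPerm, hl], ?_⟩
    rw [List.length_cons, hlen, inv_mul_s_of_gt h]

theorem IsReduced.length_eq {w : Equiv.Perm (Fin r)} {l : List (Fin (r - 1))}
    (h : IsReduced w l) : l.length = inv w := by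
  obtain ⟨l', h1, h2⟩ := exists_word_length w
  refine le_antisymm ((h.2 l' h1).trans h2.le) ?_
  rw [← h.1]
  exact inv_wordPerm_le l

theorem s_comm {i j : Fin (r - 1)} (h : (i : ℕ) + 2 ≤ j) : s i * s j = s j * s i := by
  ext x
  simp only [Equiv.Perm.mul_apply, s_val]
  split_ifs <;> omega

theorem s_braid {i j : Fin (r - 1)} (h : (i : ℕ) + 1 = j) :
    s i * s j * s i = s j * s i * s j := by
  have c : hi i = lo j := by simp [Fin.ext_iff, h]
  have h1 : s i = Equiv.swap (lo i) (lo j) := by rw [← c]; rfl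
  have h2 : s j = Equiv.swap (lo j) (hi j) := rfl
  have n1 : lo i ≠ lo j := c ▸ (lo_lt_hi i).ne
  have n2 : lo i ≠ hi j := ((c ▸ lo_lt_hi i : lo i < lo j).trans (lo_lt_hi j)).ne
  rw [h1, h2, Equiv.swap_mul_swap_mul_swap n1 n2, Equiv.swap_comm (lo i) (lo j),
    Equiv.swap_comm (lo j) (hi j), Equiv.swap_mul_swap_mul_swap (lo_lt_hi j).ne' n2.symm,
    Equiv.swap_comm]

variable {M : Type*} [Monoid M]

open Classical in
/-- A product of the `t i` along one reduced expression of `w`, found by removing descents. -/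
noncomputable def descentProd (t : Fin (r - 1) → M) (w : Equiv.Perm (Fin r)) : M :=
  if h : ∃ i, w (hi i) < w (lo i) then t h.choose * descentProd t (w * s h.choose) else 1
termination_by inv w
decreasing_by
  have := inv_mul_s_of_gt h.choose_spec
  omega

theorem descentProd_one (t : Fin (r - 1) → M) : descentProd t 1 = 1 := by
  rw [descentProd, dif_neg]
  rintro ⟨i, h⟩
  exact absurd (lo_lt_hi i) (by simpa using h.le)

/-- Matsumoto's theorem for the symmetric group: if the `t i` satisfy the braid relations, every
descent of `w` may be split off the product `descentProd t w`. -/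
theorem descentProd_eq {t : Fin (r - 1) → M}
    (hcomm : ∀ i j : Fin (r - 1), (i : ℕ) + 2 ≤ j → t i * t j = t j * t i)
    (hbraid : ∀ i j : Fin (r - 1), (i : ℕ) + 1 = j → t i * t j * t i = t j * t i * t j)
    {w : Equiv.Perm (Fin r)} {i : Fin (r - 1)} (h : w (hi i) < w (lo i)) :
    descentProd t w = t i * descentProd t (w * s i) := by
  induction hn : inv w using Nat.strong_induction_on generalizing w i with
  | _ n ih =>
    have ih' : ∀ (w' : Equiv.Perm (Fin r)) (j), inv w' < n → w' (hi j) < w' (lo j) →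
        descentProd t w' = t j * descentProd t (w' * s j) := fun w' j h1 h2 => ih _ h1 h2 rfl
    -- any two descents of `w` may be split off with the same result
    have far : ∀ i j : Fin (r - 1), w (hi i) < w (lo i) → w (hi j) < w (lo j) → (i : ℕ) + 2 ≤ j →
        t i * descentProd t (w * s i) = t j * descentProd t (w * s j) := by
      intro i j h1 h2 hij
      have e1 := inv_mul_s_of_gt h1
      have e2 := inv_mul_s_of_gt h2
      have a1 : s i (hi j) = hi j :=
        s_of_ne (by simp [Fin.ext_iff]; omega) (by simp [Fin.ext_iff]; omega)
      have a2 : s i (lo j) = lo j :=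
        s_of_ne (by simp [Fin.ext_iff]; omega) (by simp [Fin.ext_iff]; omega)
      have a3 : s j (hi i) = hi i :=
        s_of_ne (by simp [Fin.ext_iff]; omega) (by simp [Fin.ext_iff]; omega)
      have a4 : s j (lo i) = lo i :=
        s_of_ne (by simp [Fin.ext_iff]; omega) (by simp [Fin.ext_iff]; omega)
      rw [ih' (w * s i) j (by omega) (by simpa [a1, a2] using h2),
        ih' (w * s j) i (by omega) (by simpa [a3, a4] using h1), ← mul_assoc, ← mul_assoc,
        hcomm i j hij, mul_assoc w, mul_assoc w, s_comm hij]
    have near : ∀ i j : Fin (r - 1), w (hi i) < w (lo i) → w (hi j) < w (lo j) → (i : ℕ) + 1 = j →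
        t i * descentProd t (w * s i) = t j * descentProd t (w * s j) := by
      intro i j h1 h2 hij
      have e1 := inv_mul_s_of_gt h1
      have e2 := inv_mul_s_of_gt h2
      have c : hi i = lo j := by simp [Fin.ext_iff, hij]
      have a1 : s i (hi j) = hi j :=
        s_of_ne (by simp [Fin.ext_iff]; omega) (by simp [Fin.ext_iff]; omega)
      have a2 : s i (lo j) = lo i := by rw [← c, s_hi]
      have a3 : s j (hi i) = hi j := by rw [c, s_lo]
      have a4 : s j (lo i) = lo i :=
        s_of_ne (by simp [Fin.ext_iff]; omega) (by simp [Fin.ext_iff]; omega)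
      have a5 : s j (lo j) = hi j := s_lo j
      rw [← c] at h2
      have d1 : (w * s i) (hi j) < (w * s i) (lo j) := by
        simpa only [Equiv.Perm.mul_apply, a1, a2] using h2.trans h1
      have d2 : (w * s j) (hi i) < (w * s j) (lo i) := by
        simpa only [Equiv.Perm.mul_apply, a3, a4] using h2.trans h1
      have f1 := inv_mul_s_of_gt d1
      have f2 := inv_mul_s_of_gt d2
      have d3 : (w * s i * s j) (hi i) < (w * s i * s j) (lo i) := by
        simpa only [Equiv.Perm.mul_apply, a3, a4, a1, s_lo] using h2
      have d4 : (w * s j * s i) (hi j) < (w * s j * s i) (lo j) := by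
        simp only [Equiv.Perm.mul_apply, a1, a2, a4, s_hi]
        rw [← c]
        exact h1
      rw [ih' (w * s i) j (by omega) d1, ih' (w * s j) i (by omega) d2,
        ih' (w * s i * s j) i (by omega) d3, ih' (w * s j * s i) j (by omega) d4]
      rw [show w * s i * s j * s i = w * s j * s i * s j by
        rw [mul_assoc, mul_assoc, ← mul_assoc (s i), s_braid hij]; simp only [mul_assoc]]
      simp only [← mul_assoc]
      rw [hbraid i j hij]
    have hex : ∃ i, w (hi i) < w (lo i) := ⟨i, h⟩
    rw [descentProd, dif_pos hex]
    obtain hlt | heq | hgt := lt_trichotomy (hex.choose : ℕ) i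
    · obtain h3 | h3 := (Nat.succ_le_of_lt hlt).lt_or_eq
      · exact far _ _ hex.choose_spec h h3
      · exact near _ _ hex.choose_spec h h3
    · rw [Fin.ext heq]
    · obtain h3 | h3 := (Nat.succ_le_of_lt hgt).lt_or_eq
      · exact (far _ _ h hex.choose_spec h3).symm
      · exact (near _ _ h hex.choose_spec h3).symm

/-- A product along a word of minimal length only depends on the permutation. -/
theorem prod_map_eq_descentProd {t : Fin (r - 1) → M}
    (hcomm : ∀ i j : Fin (r - 1), (i : ℕ) + 2 ≤ j → t i * t j = t j * t i)
    (hbraid : ∀ i j : Fin (r - 1), (i : ℕ) + 1 = j → t i * t j * t i = t j * t i * t j)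
    (l : List (Fin (r - 1))) (h : l.length = inv (wordPerm l)) :
    (l.map t).prod = descentProd t (wordPerm l) := by
  induction l with
  | nil => simp [wordPerm, descentProd_one]
  | cons i l ih =>
    have h0 := inv_wordPerm_le l
    simp only [List.length_cons, wordPerm] at h
    have hlt : wordPerm l (lo i) < wordPerm l (hi i) := by
      by_contra hc
      have := inv_mul_s_of_gt (lt_of_le_of_ne (not_lt.mp hc) (lo_ne_hi_apply _ i).symm)
      omega
    have h1 := inv_mul_s_of_lt hlt
    rw [List.map_cons, List.prod_cons, ih (by omega), wordPerm,
      descentProd_eq hcomm hbraid (w := wordPerm l * s i) (i := i) (by simpa using hlt),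
      mul_s_mul_s]

end SymmetricGroup

/-! ### Relations between the `T_i` and the `L_j` -/

section Relations

variable {R : Type*} [CommRing R] {m : ℕ} {r : ℕ} (q : Rˣ) (u : Fin m → R)

theorem T_of_lt {i : ℕ} (h : i < r) : T r q u i = mk r q u (FreeAlgebra.ι R ⟨i, h⟩) := dif_pos h

theorem T_of_le {i : ℕ} (h : r ≤ i) : T r q u i = 0 := dif_neg h.not_gt

theorem mk_eq {x y : FreeAlgebra R (Fin r)} (h : Rel r q u x y) : mk r q u x = mk r q u y :=
  RingQuot.mkAlgHom_rel R h

theorem T_zero_braid : T r q u 0 * T r q u 1 * T r q u 0 * T r q u 1 =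
    T r q u 1 * T r q u 0 * T r q u 1 * T r q u 0 := by
  by_cases h : 1 < r
  · have := mk_eq q u (Rel.braid_zero h)
    simpa only [map_mul, ← T_of_lt] using this
  · simp [T_of_le q u (not_lt.mp h)]

theorem T_braid {i : ℕ} (hi : 1 ≤ i) : T r q u i * T r q u (i + 1) * T r q u i =
    T r q u (i + 1) * T r q u i * T r q u (i + 1) := by
  by_cases h : i + 1 < r
  · have := mk_eq q u (Rel.braid i hi h)
    simpa only [map_mul, ← T_of_lt] using this
  · simp [T_of_le q u (not_lt.mp h)]

theorem T_comm {i j : ℕ} (h : i + 2 ≤ j) : Commute (T r q u i) (T r q u j) := by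
  by_cases hj : j < r
  · rw [commute_iff_eq]
    have := mk_eq q u (Rel.comm ⟨i, by omega⟩ ⟨j, hj⟩ h)
    simpa only [map_mul, ← T_of_lt] using this
  · simp [T_of_le q u (not_lt.mp hj)]

theorem T_sq {i : ℕ} (hi : 1 ≤ i) (h : i < r) :
    T r q u i * T r q u i = ((q : R) - 1) • T r q u i + (q : R) • 1 := by
  have := mk_eq q u (Rel.quadratic ⟨i, h⟩ (by simpa using Nat.one_le_iff_ne_zero.mp hi))
  simp only [map_mul, map_sub, map_add, map_one, map_zero, AlgHom.commutes, ← T_of_lt] at this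
  rw [sub_mul, mul_add, mul_add, mul_one, mul_one, ← Algebra.smul_def,
    Algebra.algebraMap_eq_smul_one, sub_eq_zero] at this
  rw [sub_smul, one_smul, sub_add_eq_add_sub, eq_sub_iff_add_eq, this]

theorem T_zero_cyclotomic (h : 0 < r) :
    (List.ofFn fun k : Fin m => T r q u 0 - algebraMap R _ (u k)).prod = 0 := by
  have := mk_eq q u (Rel.cyclotomic h)
  rw [map_list_prod, List.map_ofFn, map_zero] at this
  rw [← this]
  congr 2
  funext k
  simp [← T_of_lt]

/-- The inverse of `T_i` for `1 ≤ i < r`. -/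
noncomputable def Tinv (r : ℕ) (q : Rˣ) (u : Fin m → R) (i : ℕ) : ArikiKoike r q u :=
  ((q⁻¹ : Rˣ) : R) • (T r q u i - ((q : R) - 1) • 1)

theorem T_mul_sub {i : ℕ} (hi : 1 ≤ i) (h : i < r) :
    T r q u i * (T r q u i - ((q : R) - 1) • 1) = (q : R) • 1 := by
  rw [mul_sub, T_sq q u hi h, mul_smul_comm, mul_one, add_sub_cancel_left]

theorem sub_mul_T {i : ℕ} (hi : 1 ≤ i) (h : i < r) :
    (T r q u i - ((q : R) - 1) • 1) * T r q u i = (q : R) • 1 := by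
  rw [sub_mul, T_sq q u hi h, smul_mul_assoc, one_mul, add_sub_cancel_left]

theorem T_mul_Tinv {i : ℕ} (hi : 1 ≤ i) (h : i < r) : T r q u i * Tinv r q u i = 1 := by
  rw [Tinv, mul_smul_comm, T_mul_sub q u hi h, smul_smul, Units.inv_mul, one_smul]

theorem Tinv_mul_T {i : ℕ} (hi : 1 ≤ i) (h : i < r) : Tinv r q u i * T r q u i = 1 := by
  rw [Tinv, smul_mul_assoc, sub_mul_T q u hi h, smul_smul, Units.inv_mul, one_smul]

theorem L_one : L r q u 1 = T r q u 0 := rfl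

theorem L_succ {i : ℕ} (hi : 1 ≤ i) :
    L r q u (i + 1) = ((q⁻¹ : Rˣ) : R) • (T r q u i * L r q u i * T r q u i) := by
  obtain ⟨i, rfl⟩ : ∃ j, i = j + 1 := ⟨i - 1, by omega⟩
  rfl

theorem T_mul_L_self {i : ℕ} (hi : 1 ≤ i) (h : i < r) :
    T r q u i * L r q u i = L r q u (i + 1) * (T r q u i - ((q : R) - 1) • 1) := by
  rw [L_succ q u hi, smul_mul_assoc, mul_assoc _ (T r q u i), T_mul_sub q u hi h, mul_smul_comm,
    mul_one, smul_smul, Units.inv_mul, one_smul]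

theorem T_mul_L_succ {i : ℕ} (hi : 1 ≤ i) (h : i < r) :
    T r q u i * L r q u (i + 1) = L r q u i * T r q u i + ((q : R) - 1) • L r q u (i + 1) := by
  rw [L_succ q u hi, mul_smul_comm, ← mul_assoc, ← mul_assoc, T_sq q u hi h]
  simp only [add_mul, smul_mul_assoc, one_mul, smul_add, smul_smul, Units.inv_mul, one_smul]
  rw [add_comm, mul_comm]

theorem T_comm_L_of_lt {i j : ℕ} (h : j < i) : Commute (T r q u i) (L r q u j) := by
  induction j with
  | zero => exact Commute.zero_right _
  | succ j ih =>
    obtain rfl | hj := Nat.eq_zero_or_pos j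
    · exact (T_comm q u (by omega)).symm
    · rw [L_succ q u hj]
      have hT : Commute (T r q u i) (T r q u j) := (T_comm q u (by omega)).symm
      exact ((hT.mul_right (ih (by omega))).mul_right hT).smul_right _

theorem T_comm_L {i j : ℕ} (hi : 1 ≤ i) (h1 : j ≠ i) (h2 : j ≠ i + 1) :
    Commute (T r q u i) (L r q u j) := by
  rcases lt_or_gt_of_ne h1 with hj | hj
  · exact T_comm_L_of_lt q u hj
  · obtain ⟨k, rfl⟩ : ∃ k, j = i + 2 + k := ⟨j - (i + 2), by omega⟩
    clear h1 h2 hj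
    induction k with
    | zero =>
      rw [show i + 2 + 0 = i + 1 + 1 from rfl, L_succ q u (by omega), L_succ q u hi]
      refine Commute.smul_right ?_ _
      rw [mul_smul_comm, smul_mul_assoc]
      refine Commute.smul_right ?_ _
      have hb := T_braid q u (r := r) hi
      have hcl : Commute (T r q u (i + 1)) (L r q u i) := T_comm_L_of_lt q u (by omega)
      generalize T r q u i = a at *
      generalize T r q u (i + 1) = b at *
      generalize L r q u i = l at *
      rw [commute_iff_eq]
      calc a * (b * (a * l * a) * b) = (a * b * a) * l * a * b := by simp only [mul_assoc]
        _ = b * a * (b * l) * (a * b) := by rw [hb]; simp only [mul_assoc]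
        _ = b * a * l * (b * a * b) := by rw [hcl.eq]; simp only [mul_assoc]
        _ = b * (a * l * a) * b * a := by rw [← hb]; simp only [mul_assoc]
    | succ k ih =>
      rw [show i + 2 + (k + 1) = i + 2 + k + 1 from rfl, L_succ q u (by omega)]
      have hT : Commute (T r q u i) (T r q u (i + 2 + k)) := T_comm q u (by omega)
      exact ((hT.mul_right ih).mul_right hT).smul_right _

theorem L_comm (i j : ℕ) : Commute (L r q u i) (L r q u j) := by
  have one : ∀ k, Commute (L r q u 1) (L r q u (k + 2)) := by
    intro k
    induction k with
    | zero =>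
      rw [L_succ q u le_rfl, L_one]
      refine Commute.smul_right ?_ _
      have := T_zero_braid (r := r) q u
      rw [Commute, SemiconjBy, ← mul_assoc, ← mul_assoc, this]
    | succ k ih =>
      rw [show k + 1 + 2 = (k + 2) + 1 from rfl, L_succ q u (i := k + 2) (by omega)]
      have hT : Commute (L r q u 1) (T r q u (k + 2)) := T_comm q u (by omega)
      exact ((hT.mul_right ih).mul_right hT).smul_right _
  have lt : ∀ i j, i < j → Commute (L r q u i) (L r q u j) := by
    intro i
    induction i with
    | zero => exact fun _ _ => Commute.zero_left _
    | succ i ih =>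
      intro j hj
      obtain rfl | hi := Nat.eq_zero_or_pos i
      · obtain ⟨k, rfl⟩ : ∃ k, j = k + 2 := ⟨j - 2, by omega⟩
        exact one k
      · rw [L_succ q u hi]
        have hT : Commute (T r q u i) (L r q u j) := T_comm_L q u hi (by omega) (by omega)
        exact ((hT.mul_left (ih j (by omega))).mul_left hT).smul_left _
  rcases lt_trichotomy i j with h | rfl | h
  · exact lt i j h
  · exact Commute.refl _
  · exact (lt j i h).symm

/-! ### The subalgebra generated by `T_1, …, T_{r-1}` -/

/-- The image in `H` of the Hecke algebra of the symmetric group: the subalgebra generated by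
`T_1, …, T_{r-1}`. -/
noncomputable def finHecke (r : ℕ) (q : Rˣ) (u : Fin m → R) : Subalgebra R (ArikiKoike r q u) :=
  Algebra.adjoin R (Set.range fun i : Fin (r - 1) => T r q u (i + 1))

theorem T_mem_finHecke {i : ℕ} (hi : 1 ≤ i) : T r q u i ∈ finHecke r q u := by
  by_cases h : i < r
  · obtain ⟨i, rfl⟩ : ∃ j, i = j + 1 := ⟨i - 1, by omega⟩
    exact Algebra.subset_adjoin ⟨⟨i, by omega⟩, rfl⟩
  · rw [T_of_le q u (not_lt.mp h)]
    exact zero_mem _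

theorem Tinv_mem_finHecke {i : ℕ} (hi : 1 ≤ i) : Tinv r q u i ∈ finHecke r q u :=
  Subalgebra.smul_mem _ (sub_mem (T_mem_finHecke q u hi) (Subalgebra.smul_mem _ (one_mem _) _)) _

/-- In the definition of `Tword` the letters are numbers, obtained from those of `l` by a coercion
of lists; here the coercion is applied letter by letter. -/
theorem Tword_eq (l : List (Fin (r - 1))) :
    Tword r q u l = (l.map fun i : Fin (r - 1) => T r q u (i + 1)).prod := by
  rw [Tword]
  congr 1
  change List.map _ (List.flatMap _ _) = _
  induction l with
  | nil => rfl
  | cons i l ih => rw [List.flatMap_cons, List.map_append, ih]; rfl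

theorem Tword_eq_descentProd {l : List (Fin (r - 1))} (h : l.length = inv (wordPerm l)) :
    Tword r q u l = descentProd (fun i : Fin (r - 1) => T r q u (i + 1)) (wordPerm l) := by
  rw [Tword_eq]
  exact prod_map_eq_descentProd (fun _ _ hij => T_comm q u (by omega))
    (fun i j hij => by rw [← hij]; exact T_braid q u (by omega)) l h

theorem Tperm_eq_descentProd (w : Equiv.Perm (Fin r)) :
    Tperm r q u w = descentProd (fun i : Fin (r - 1) => T r q u (i + 1)) w := by
  have h := (exists_isReduced w).choose_spec
  rw [Tperm, Tword_eq_descentProd q u (by rw [h.1, h.length_eq]), h.1]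

@[simp] theorem Tperm_one : Tperm r q u 1 = 1 := by
  rw [Tperm_eq_descentProd, descentProd_one]

/-- A descent of `w` splits off a factor on the left of `T_w`. -/
theorem Tperm_of_descent {w : Equiv.Perm (Fin r)} {i : Fin (r - 1)} (h : w (hi i) < w (lo i)) :
    Tperm r q u w = T r q u (i + 1) * Tperm r q u (w * s i) := by
  rw [Tperm_eq_descentProd, Tperm_eq_descentProd]
  exact descentProd_eq (fun _ _ hij => T_comm q u (by omega))
    (fun i j hij => by rw [← hij]; exact T_braid q u (by omega)) h

theorem T_mul_Tperm {w : Equiv.Perm (Fin r)} {i : Fin (r - 1)} (h : w (lo i) < w (hi i)) :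
    T r q u (i + 1) * Tperm r q u w = Tperm r q u (w * s i) := by
  rw [Tperm_of_descent q u (w := w * s i) (i := i) (by simpa using h), mul_s_mul_s]

theorem Tperm_mul_T {w : Equiv.Perm (Fin r)} {j : Fin (r - 1)} (h : w⁻¹ (lo j) < w⁻¹ (hi j)) :
    Tperm r q u w * T r q u (j + 1) = Tperm r q u (s j * w) := by
  obtain ⟨l, hl, hlen⟩ := exists_word_length w
  have h1 : wordPerm (l ++ [j]) = s j * w := by simp [wordPerm_append, wordPerm, hl]
  rw [Tperm_eq_descentProd, Tperm_eq_descentProd, ← h1, ← hl, ← Tword_eq_descentProd,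
    ← Tword_eq_descentProd, Tword_eq, Tword_eq, List.map_append, List.prod_append]
  · simp
  · rw [h1, inv_s_mul_of_lt h, List.length_append, hlen, List.length_singleton]
  · rw [hl, hlen]

theorem Tperm_mem_finHecke (w : Equiv.Perm (Fin r)) : Tperm r q u w ∈ finHecke r q u := by
  induction w using descent_induction with
  | one => simp [one_mem]
  | step w i h ih =>
    rw [Tperm_of_descent q u h]
    exact mul_mem (T_mem_finHecke q u (by omega)) ih

theorem isUnit_T {i : ℕ} (hi : 1 ≤ i) (h : i < r) :
    IsUnit (⟨T r q u i, T_mem_finHecke q u hi⟩ : finHecke r q u) :=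
  ⟨⟨_, ⟨Tinv r q u i, Tinv_mem_finHecke q u hi⟩, Subtype.ext (T_mul_Tinv q u hi h),
    Subtype.ext (Tinv_mul_T q u hi h)⟩, rfl⟩

/-- The elements `T_w` span the subalgebra generated by `T_1, …, T_{r-1}`. -/
theorem finHecke_toSubmodule :
    (finHecke r q u).toSubmodule = Submodule.span R (Set.range (Tperm r q u)) := by
  apply le_antisymm
  · have hstep : ∀ i : Fin (r - 1), ∀ x ∈ Submodule.span R (Set.range (Tperm r q u)),
        T r q u (i + 1) * x ∈ Submodule.span R (Set.range (Tperm r q u)) := by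
      intro i x hx
      induction hx using Submodule.span_induction with
      | mem x hx =>
        obtain ⟨w, rfl⟩ := hx
        rcases lt_or_gt_of_ne (lo_ne_hi_apply w i) with h | h
        · rw [T_mul_Tperm q u h]
          exact Submodule.subset_span ⟨_, rfl⟩
        · rw [Tperm_of_descent q u h, ← mul_assoc, T_sq q u (by omega) (by omega), add_mul,
            smul_mul_assoc, smul_mul_assoc, one_mul, ← Tperm_of_descent q u h]
          exact add_mem (Submodule.smul_mem _ _ (Submodule.subset_span ⟨_, rfl⟩))
            (Submodule.smul_mem _ _ (Submodule.subset_span ⟨_, rfl⟩))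
      | zero => simp
      | add x y _ _ hx hy => rw [mul_add]; exact add_mem hx hy
      | smul a x _ hx => rw [mul_smul_comm]; exact Submodule.smul_mem _ _ hx
    have hmul : ∀ h ∈ finHecke r q u, ∀ x ∈ Submodule.span R (Set.range (Tperm r q u)),
        h * x ∈ Submodule.span R (Set.range (Tperm r q u)) := by
      intro h hh
      induction hh using Algebra.adjoin_induction with
      | mem y hy => obtain ⟨i, rfl⟩ := hy; exact hstep i
      | algebraMap a =>
        intro x hx
        rw [← Algebra.smul_def]
        exact Submodule.smul_mem _ _ hx
      | add a b _ _ ha hb => intro x hx; rw [add_mul]; exact add_mem (ha x hx) (hb x hx)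
      | mul a b _ _ ha hb => intro x hx; rw [mul_assoc]; exact ha _ (hb x hx)
    intro h hh
    simpa using hmul h hh 1 (Submodule.subset_span ⟨1, Tperm_one q u⟩)
  · rw [Submodule.span_le]
    rintro _ ⟨w, rfl⟩
    exact Tperm_mem_finHecke q u w

end Relations

/-! ### Monomials in the `L_j` -/

section Monomials

variable {R : Type*} [CommRing R] {m : ℕ} {r : ℕ} (q : Rˣ) (u : Fin m → R)

open MvPolynomial (X C)

open scoped IsMulCommutative in
/-- Evaluation of polynomials at the commuting elements `L_1, …, L_r`; the variable `X j` is sent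
to `L_{j+1}`. -/
noncomputable def polyL : MvPolynomial (Fin r) R →ₐ[R] ArikiKoike r q u :=
  letI : IsMulCommutative (Algebra.adjoin R (Set.range fun j : Fin r => L r q u (j + 1))) :=
    Algebra.isMulCommutative_adjoin R (by
      rintro _ ⟨i, rfl⟩ _ ⟨j, rfl⟩
      exact (L_comm q u _ _).eq)
  (Algebra.adjoin R (Set.range fun j : Fin r => L r q u (j + 1))).val.comp
    (MvPolynomial.aeval (S₁ := Algebra.adjoin R (Set.range fun j : Fin r => L r q u (j + 1)))
      fun j : Fin r => ⟨L r q u (j + 1), Algebra.subset_adjoin ⟨j, rfl⟩⟩)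

@[simp] theorem polyL_X (j : Fin r) : polyL q u (X j) = L r q u (j + 1) := by
  simp [polyL]

/-- The monomial `L_1^{c_0} ⋯ L_r^{c_{r-1}}`. -/
noncomputable def Lmon (c : Fin r → ℕ) : ArikiKoike r q u := polyL q u (∏ j, X j ^ c j)

theorem Lmon_add (c d : Fin r → ℕ) : Lmon q u (c + d) = Lmon q u c * Lmon q u d := by
  rw [Lmon, Lmon, Lmon, ← map_mul, ← Finset.prod_mul_distrib]
  simp only [Pi.add_apply, pow_add]

@[simp] theorem Lmon_zero : Lmon q u (0 : Fin r → ℕ) = 1 := by simp [Lmon]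

theorem Lmon_single (j : Fin r) (k : ℕ) : Lmon q u (Pi.single j k) = L r q u (j + 1) ^ k := by
  rw [Lmon, Finset.prod_eq_single j]
  · simp
  · intro b _ hb
    simp [hb]
  · simp

/-- `T_{i+1}` commutes with the monomials in the `L_j` other than the two it moves. -/
theorem T_comm_Lmon {i : Fin (r - 1)} {c : Fin r → ℕ} (h1 : c (lo i) = 0) (h2 : c (hi i) = 0) :
    Commute (T r q u (i + 1)) (Lmon q u c) := by
  have : (∏ j, X j ^ c j) ∈ (Subalgebra.centralizer R {T r q u (i + 1)}).comap (polyL q u) := by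
    refine Subalgebra.prod_mem _ fun j _ => ?_
    by_cases hj : j = lo i ∨ j = hi i
    · have : c j = 0 := by rcases hj with rfl | rfl <;> assumption
      rw [this, pow_zero]
      exact one_mem _
    · refine Subalgebra.pow_mem _ ?_ _
      rw [not_or, Fin.ext_iff, Fin.ext_iff] at hj
      simp only [Subalgebra.mem_comap, polyL_X, Subalgebra.mem_centralizer_iff,
        Set.mem_singleton_iff, forall_eq]
      exact (T_comm_L q u (by omega) (by simpa using hj.1) (by simpa using hj.2)).eq
  exact this _ rfl

theorem T_mul_L_pow {i : ℕ} (hi : 1 ≤ i) (h : i < r) (k : ℕ) :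
    T r q u i * L r q u i ^ k = L r q u (i + 1) ^ k * T r q u i -
      ((q : R) - 1) • ∑ s ∈ Finset.range k, L r q u i ^ s * L r q u (i + 1) ^ (k - s) := by
  induction k with
  | zero => simp
  | succ k ih =>
    have e : ∑ s ∈ Finset.range k, L r q u i ^ (s + 1) * L r q u (i + 1) ^ (k + 1 - (s + 1)) =
        (∑ s ∈ Finset.range k, L r q u i ^ s * L r q u (i + 1) ^ (k - s)) * L r q u i := by
      rw [Finset.sum_mul]
      refine Finset.sum_congr rfl fun s _ => ?_
      rw [Nat.add_sub_add_right, pow_succ, mul_assoc, mul_assoc,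
        ((L_comm q u i (i + 1)).pow_right _).eq]
    rw [Finset.sum_range_succ', e, pow_succ, ← mul_assoc, ih, sub_mul, mul_assoc,
      T_mul_L_self q u hi h, smul_mul_assoc, smul_add, mul_sub, mul_sub, ← mul_assoc, ← pow_succ,
      mul_smul_comm, mul_smul_comm, mul_one, ← pow_succ]
    simp only [pow_zero, one_mul, Nat.sub_zero]
    abel

theorem T_mul_L_succ_pow {i : ℕ} (hi : 1 ≤ i) (h : i < r) (k : ℕ) :
    T r q u i * L r q u (i + 1) ^ k = L r q u i ^ k * T r q u i +
      ((q : R) - 1) • ∑ s ∈ Finset.range k, L r q u i ^ s * L r q u (i + 1) ^ (k - s) := by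
  induction k with
  | zero => simp
  | succ k ih =>
    have e : ∑ s ∈ Finset.range k, L r q u i ^ s * L r q u (i + 1) ^ (k + 1 - s) =
        (∑ s ∈ Finset.range k, L r q u i ^ s * L r q u (i + 1) ^ (k - s)) * L r q u (i + 1) := by
      rw [Finset.sum_mul]
      refine Finset.sum_congr rfl fun s hs => ?_
      rw [Nat.sub_add_comm (Finset.mem_range.mp hs).le, pow_succ, mul_assoc]
    rw [Finset.sum_range_succ, e, pow_succ, ← mul_assoc, ih, add_mul, mul_assoc,
      T_mul_L_succ q u hi h, smul_mul_assoc, smul_add, mul_add, ← mul_assoc, ← pow_succ,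
      mul_smul_comm, Nat.add_sub_cancel_left, pow_one]
    abel

theorem T_comm_L_mul_L {i : ℕ} (hi : 1 ≤ i) (h : i < r) :
    Commute (T r q u i) (L r q u i * L r q u (i + 1)) := by
  rw [commute_iff_eq, ← mul_assoc, T_mul_L_self q u hi h, mul_assoc, sub_mul,
    T_mul_L_succ q u hi h, smul_mul_assoc, one_mul, add_sub_cancel_right, ← mul_assoc,
    (L_comm q u i (i + 1)).eq]

/-! ### Spans of monomials with coefficients in the finite Hecke algebra -/

/-- The span of the elements `L^c h`, with `c ∈ S` and `h` in the subalgebra generated by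
`T_1, …, T_{r-1}`. -/
noncomputable def spanL (S : Set (Fin r → ℕ)) : Submodule R (ArikiKoike r q u) :=
  Submodule.span R {x | ∃ c ∈ S, ∃ h ∈ finHecke r q u, x = Lmon q u c * h}

variable {q u}

theorem Lmon_mul_mem {S : Set (Fin r → ℕ)} {c : Fin r → ℕ} (hc : c ∈ S) {h : ArikiKoike r q u}
    (hh : h ∈ finHecke r q u) : Lmon q u c * h ∈ spanL q u S :=
  Submodule.subset_span ⟨c, hc, h, hh, rfl⟩

theorem Lmon_mem {S : Set (Fin r → ℕ)} {c : Fin r → ℕ} (hc : c ∈ S) :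
    Lmon q u c ∈ spanL q u S := by
  simpa using Lmon_mul_mem hc (one_mem (finHecke r q u))

theorem spanL_mono {S S' : Set (Fin r → ℕ)} (h : S ⊆ S') : spanL q u S ≤ spanL q u S' :=
  Submodule.span_mono fun _ ⟨c, hc, h', hh, e⟩ => ⟨c, h hc, h', hh, e⟩

theorem spanL_le {S : Set (Fin r → ℕ)} {N : Submodule R (ArikiKoike r q u)}
    (h : ∀ c ∈ S, ∀ h ∈ finHecke r q u, Lmon q u c * h ∈ N) : spanL q u S ≤ N := by
  rw [spanL, Submodule.span_le]
  rintro _ ⟨c, hc, h', hh, rfl⟩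
  exact h c hc h' hh

theorem mul_finHecke_mem {S : Set (Fin r → ℕ)} {x h : ArikiKoike r q u} (hx : x ∈ spanL q u S)
    (hh : h ∈ finHecke r q u) : x * h ∈ spanL q u S := by
  have : spanL q u S ≤ (spanL q u S).comap (LinearMap.mulRight R h) := by
    refine spanL_le fun c hc h' hh' => ?_
    simp only [Submodule.mem_comap, LinearMap.mulRight_apply, mul_assoc]
    exact Lmon_mul_mem hc (mul_mem hh' hh)
  exact this hx

theorem mul_mem_spanL {S S' : Set (Fin r → ℕ)} {a : ArikiKoike r q u}
    (h : ∀ c ∈ S, a * Lmon q u c ∈ spanL q u S') {x : ArikiKoike r q u} (hx : x ∈ spanL q u S) :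
    a * x ∈ spanL q u S' := by
  have : spanL q u S ≤ (spanL q u S').comap (LinearMap.mulLeft R a) := by
    refine spanL_le fun c hc h' hh' => ?_
    simp only [Submodule.mem_comap, LinearMap.mulLeft_apply, ← mul_assoc]
    exact mul_finHecke_mem (h c hc) hh'
  exact this hx

/-- The exponents obtained from `c` by moving the entries at `i` and `i + 1` towards each other, or
exchanging them. -/
def hull (i : Fin (r - 1)) (c : Fin r → ℕ) : Set (Fin r → ℕ) :=
  {d | (∀ j, j ≠ lo i → j ≠ hi i → d j = c j) ∧ d (lo i) + d (hi i) = c (lo i) + c (hi i) ∧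
    d (lo i) ≤ max (c (lo i)) (c (hi i)) ∧ d (hi i) ≤ max (c (lo i)) (c (hi i))}

/-- The exponents obtained from `c` by moving the entries at `i` and `i + 1` strictly towards each
other. -/
def strictHull (i : Fin (r - 1)) (c : Fin r → ℕ) : Set (Fin r → ℕ) :=
  {d | (∀ j, j ≠ lo i → j ≠ hi i → d j = c j) ∧ d (lo i) + d (hi i) = c (lo i) + c (hi i) ∧
    d (lo i) < max (c (lo i)) (c (hi i)) ∧ d (hi i) < max (c (lo i)) (c (hi i))}

/-- The exponent that is `a` at `i`, `b` at `i + 1`, and agrees with `c` elsewhere. -/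
def put (i : Fin (r - 1)) (c : Fin r → ℕ) (a b : ℕ) : Fin r → ℕ :=
  Function.update (Function.update c (lo i) a) (hi i) b

@[simp] theorem put_lo (i : Fin (r - 1)) (c : Fin r → ℕ) (a b : ℕ) : put i c a b (lo i) = a := by
  rw [put, Function.update_of_ne (lo_lt_hi i).ne, Function.update_self]

@[simp] theorem put_hi (i : Fin (r - 1)) (c : Fin r → ℕ) (a b : ℕ) : put i c a b (hi i) = b := by
  rw [put, Function.update_self]

theorem put_of_ne {i : Fin (r - 1)} {c : Fin r → ℕ} {a b : ℕ} {j : Fin r} (h1 : j ≠ lo i)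
    (h2 : j ≠ hi i) : put i c a b j = c j := by
  rw [put, Function.update_of_ne h2, Function.update_of_ne h1]

theorem eq_put {i : Fin (r - 1)} {c d : Fin r → ℕ} (h : ∀ j, j ≠ lo i → j ≠ hi i → d j = c j) :
    d = put i c (d (lo i)) (d (hi i)) := by
  funext j
  by_cases h1 : j = lo i
  · rw [h1, put_lo]
  · by_cases h2 : j = hi i
    · rw [h2, put_hi]
    · rw [put_of_ne h1 h2, h j h1 h2]

theorem put_self (i : Fin (r - 1)) (c : Fin r → ℕ) : put i c (c (lo i)) (c (hi i)) = c :=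
  (eq_put fun _ _ _ => rfl).symm

theorem put_swap (i : Fin (r - 1)) (c : Fin r → ℕ) : put i c (c (hi i)) (c (lo i)) = c ∘ s i := by
  rw [eq_put (d := c ∘ s i) (c := c) (i := i) fun j h1 h2 => by simp [s_of_ne h1 h2]]
  simp

theorem Lmon_put (i : Fin (r - 1)) (c : Fin r → ℕ) (a b : ℕ) :
    Lmon q u (put i c a b) =
      Lmon q u (put i c 0 0) * (L r q u (i + 1) ^ a * L r q u (i + 1 + 1) ^ b) := by
  have h := (lo_lt_hi i).ne
  have : put i c a b = put i c 0 0 + (Pi.single (lo i) a + Pi.single (hi i) b) := by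
    refine Eq.trans ?_ (eq_put (c := c) (i := i) fun j h1 h2 => ?_).symm
    · simp [h, h.symm]
    · simp [h1, h2, put_of_ne]
  rw [this, Lmon_add, Lmon_add, Lmon_single, Lmon_single]

theorem T_comm_Lmon_put (i : Fin (r - 1)) (c : Fin r → ℕ) (k : ℕ) :
    Commute (T r q u (i + 1)) (Lmon q u (put i c k k)) := by
  rw [Lmon_put, ← (L_comm q u _ _).mul_pow]
  exact (T_comm_Lmon q u (put_lo i c 0 0) (put_hi i c 0 0)).mul_right
    ((T_comm_L_mul_L q u (by omega) (by omega)).pow_right k)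

theorem Lmon_put_mul (i : Fin (r - 1)) (c : Fin r → ℕ) (k a b : ℕ) :
    Lmon q u (put i c k k) * (L r q u (i + 1) ^ a * L r q u (i + 1 + 1) ^ b) =
      Lmon q u (put i c (k + a) (k + b)) := by
  rw [Lmon_put, Lmon_put i c (k + a), mul_assoc]
  congr 1
  rw [mul_assoc, ← mul_assoc (L r q u (i + 1 + 1) ^ k), ((L_comm q u _ _).pow_pow k a).eq,
    pow_add, pow_add]
  simp only [mul_assoc]

/-- If `c_i ≥ c_{i+1}`, then up to terms with exponents strictly inside the segment between `c` and
`c ∘ s_i` the product `T_{i+1} L^c` is `L^{c ∘ s_i}` times a unit. -/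
theorem T_mul_Lmon_of_le (i : Fin (r - 1)) {c : Fin r → ℕ} (hc : c (hi i) ≤ c (lo i)) :
    ∃ h : finHecke r q u, IsUnit h ∧
      T r q u (i + 1) * Lmon q u c - Lmon q u (c ∘ s i) * h ∈ spanL q u (strictHull i c) := by
  have hi1 : (i : ℕ) + 1 < r := by omega
  obtain ⟨k, hk⟩ := Nat.exists_eq_add_of_le hc
  set b := c (hi i) with hb
  have hcc : c = put i c (b + k) (b + 0) := by
    rw [← hk, add_zero, hb, put_self]
  have hcs : c ∘ s i = put i c (b + 0) (b + k) := by
    rw [← put_swap, ← hk, add_zero]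
  obtain rfl | hk0 := Nat.eq_zero_or_pos k
  · refine ⟨_, isUnit_T q u (i := i + 1) (by omega) hi1, ?_⟩
    have : T r q u (i + 1) * Lmon q u c = Lmon q u (c ∘ s i) * T r q u (i + 1) := by
      rw [hcs]
      nth_rw 1 [hcc]
      exact (T_comm_Lmon_put i c _).eq
    rw [this, sub_self]
    exact zero_mem _
  · refine ⟨⟨T r q u (i + 1) - ((q : R) - 1) • 1, sub_mem (T_mem_finHecke q u (by omega))
      (Subalgebra.smul_mem _ (one_mem _) _)⟩, ?_, ?_⟩
    · refine ⟨⟨_, ((q⁻¹ : Rˣ) : R) • ⟨T r q u (i + 1), T_mem_finHecke q u (by omega)⟩,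
        Subtype.ext ?_, Subtype.ext ?_⟩, rfl⟩
      · simp only [MulMemClass.coe_mul, SetLike.val_smul, OneMemClass.coe_one]
        rw [mul_smul_comm, sub_mul_T q u (by omega) hi1, smul_smul, Units.inv_mul, one_smul]
      · simp only [MulMemClass.coe_mul, SetLike.val_smul, OneMemClass.coe_one]
        rw [smul_mul_assoc, T_mul_sub q u (by omega) hi1, smul_smul, Units.inv_mul, one_smul]
    · obtain ⟨k, rfl⟩ : ∃ l, k = l + 1 := ⟨k - 1, by omega⟩
      have key : T r q u (i + 1) * Lmon q u c -
          Lmon q u (c ∘ s i) * (T r q u (i + 1) - ((q : R) - 1) • 1) =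
          -(((q : R) - 1) • ∑ t ∈ Finset.range k,
            Lmon q u (put i c (b + (t + 1)) (b + (k + 1 - (t + 1))))) := by
        rw [hcs]
        nth_rw 1 [hcc]
        rw [← Lmon_put_mul, ← Lmon_put_mul, ← mul_assoc, (T_comm_Lmon_put i c b).eq, mul_assoc,
          pow_zero, pow_zero, mul_one, one_mul, T_mul_L_pow q u (by omega) hi1,
          Finset.sum_range_succ']
        simp only [← Lmon_put_mul, pow_zero, one_mul, Nat.sub_zero]
        rw [← Finset.mul_sum, ← mul_smul_comm, mul_assoc, ← mul_sub, ← mul_neg]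
        congr 1
        rw [mul_sub, mul_smul_comm, mul_one, smul_add]
        abel
      rw [key]
      refine neg_mem (Submodule.smul_mem _ _ (Submodule.sum_mem _ fun t ht => Lmon_mem ?_))
      rw [Finset.mem_range] at ht
      refine ⟨fun j h1 h2 => put_of_ne h1 h2, ?_, ?_, ?_⟩ <;>
        simp only [put_lo, put_hi, ← hb, hk] <;> omega

/-- Left multiplication by `T_{i+1}` spreads the exponent `c` inside the segment between `c` and
`c ∘ s_i`. -/
theorem T_mul_Lmon_mem (i : Fin (r - 1)) (c : Fin r → ℕ) :
    T r q u (i + 1) * Lmon q u c ∈ spanL q u (hull i c) := by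
  have hi1 : (i : ℕ) + 1 < r := by omega
  rcases le_total (c (hi i)) (c (lo i)) with hc | hc
  · obtain ⟨h, -, hh⟩ := T_mul_Lmon_of_le (q := q) (u := u) i hc
    rw [← sub_add_cancel (T r q u (i + 1) * Lmon q u c) (Lmon q u (c ∘ s i) * h)]
    refine add_mem (spanL_mono ?_ hh) (Lmon_mul_mem ?_ h.2)
    · exact fun d ⟨h1, h2, h3, h4⟩ => ⟨h1, h2, h3.le, h4.le⟩
    · rw [← put_swap]
      refine ⟨fun j h1 h2 => put_of_ne h1 h2, ?_, ?_, ?_⟩ <;> simp [add_comm]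
  · obtain ⟨k, hk⟩ := Nat.exists_eq_add_of_le hc
    set b := c (lo i) with hb
    have hcc : c = put i c (b + 0) (b + k) := by
      rw [← hk, add_zero, hb, put_self]
    have key : T r q u (i + 1) * Lmon q u c = Lmon q u (put i c (b + k) (b + 0)) * T r q u (i + 1) +
        ((q : R) - 1) • ∑ t ∈ Finset.range k, Lmon q u (put i c (b + t) (b + (k - t))) := by
      nth_rw 1 [hcc]
      rw [← Lmon_put_mul, ← Lmon_put_mul, ← mul_assoc, (T_comm_Lmon_put i c b).eq, mul_assoc,
        pow_zero, pow_zero, mul_one, one_mul, T_mul_L_succ_pow q u (by omega) hi1]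
      simp only [← Lmon_put_mul]
      rw [← Finset.mul_sum, ← mul_smul_comm, mul_assoc, ← mul_add]
    rw [key]
    refine add_mem (Lmon_mul_mem ?_ (T_mem_finHecke q u (by omega)))
      (Submodule.smul_mem _ _ (Submodule.sum_mem _ fun t ht => Lmon_mem ?_))
    · refine ⟨fun j h1 h2 => put_of_ne h1 h2, ?_, ?_, ?_⟩ <;>
        simp only [put_lo, put_hi, ← hb, hk] <;> omega
    · rw [Finset.mem_range] at ht
      refine ⟨fun j h1 h2 => put_of_ne h1 h2, ?_, ?_, ?_⟩ <;>
        simp only [put_lo, put_hi, ← hb, hk] <;> omega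

theorem sum_eq_lo_hi (i : Fin (r - 1)) (f : Fin r → ℕ) :
    ∑ j, f j = f (lo i) + f (hi i) + ∑ j ∈ {j | j ≠ lo i ∧ j ≠ hi i}, f j := by
  rw [← Finset.sum_filter_add_sum_filter_not Finset.univ (fun j => j ≠ lo i ∧ j ≠ hi i), add_comm]
  congr 1
  have : (Finset.univ.filter fun j : Fin r => ¬ (j ≠ lo i ∧ j ≠ hi i)) = {lo i, hi i} := by
    ext j
    simp only [Finset.mem_filter, Finset.mem_univ, true_and, Finset.mem_insert,
      Finset.mem_singleton]
    tauto
  rw [this, Finset.sum_pair (lo_lt_hi i).ne]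

theorem sum_eq_of_mem_hull {i : Fin (r - 1)} {c d : Fin r → ℕ} (h : d ∈ hull i c) :
    ∑ j, d j = ∑ j, c j := by
  rw [sum_eq_lo_hi i d, sum_eq_lo_hi i c, h.2.1]
  congr 1
  refine Finset.sum_congr rfl fun j hj => ?_
  simp only [Finset.mem_filter, Finset.mem_univ, true_and] at hj
  exact h.1 j hj.1 hj.2

/-! ### Reduction to exponents less than `m` -/

/-- The exponents into which `L_{j+1}^m` is rewritten. -/
def reductSet (m : ℕ) (j : Fin r) : Set (Fin r → ℕ) :=
  {d | (∀ k, j < k → d k = 0) ∧ d j < m ∧ ∑ k, d k ≤ m}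

theorem L_one_pow_mem (h : 0 < r) : L r q u 1 ^ m ∈ spanL q u (reductSet m ⟨0, h⟩) := by
  rcases subsingleton_or_nontrivial R with hR | hR
  · have := Module.subsingleton R (ArikiKoike r q u)
    rw [Subsingleton.elim (L r q u 1 ^ m) 0]
    exact zero_mem _
  set p : Polynomial R := ∏ k : Fin m, (Polynomial.X - Polynomial.C (u k)) with hp
  have hmonic : p.Monic := Polynomial.monic_prod_of_monic _ _ fun k _ => Polynomial.monic_X_sub_C _
  have hdeg : p.natDegree = m := by
    rw [hp, Polynomial.natDegree_prod_of_monic _ _ fun k _ => Polynomial.monic_X_sub_C _]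
    simp
  have h0 : Polynomial.aeval (L r q u 1) p = 0 := by
    rw [← T_zero_cyclotomic q u h, hp, ← List.prod_ofFn, map_list_prod, List.map_ofFn]
    congr 2
    funext k
    simp [L_one]
  rw [hmonic.as_sum, hdeg, map_add, map_sum, map_pow, Polynomial.aeval_X] at h0
  rw [eq_neg_of_add_eq_zero_left h0]
  refine neg_mem (Submodule.sum_mem _ fun k hk => ?_)
  rw [Finset.mem_range] at hk
  rw [map_mul, map_pow, Polynomial.aeval_C, Polynomial.aeval_X, ← Algebra.smul_def]
  refine Submodule.smul_mem _ _ ?_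
  rw [show L r q u 1 ^ k = Lmon q u (Pi.single ⟨0, h⟩ k) by rw [Lmon_single]]
  refine Lmon_mem ⟨fun j hj => ?_, ?_, ?_⟩
  · rw [Pi.single_eq_of_ne hj.ne']
  · simpa using hk
  · rw [Finset.sum_pi_single']
    simpa using hk.le

/-- The cyclotomic relation, transported from `L_1` to every `L_{j+1}`. -/
theorem L_pow_mem (hm : 0 < m) (j : Fin r) : L r q u (j + 1) ^ m ∈ spanL q u (reductSet m j) := by
  obtain ⟨j, hj⟩ := j
  induction j with
  | zero => exact L_one_pow_mem hj
  | succ j ih =>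
    set i : Fin (r - 1) := ⟨j, by omega⟩ with hi
    have ih : T r q u (j + 1) * L r q u (j + 1) ^ m ∈ spanL q u (reductSet m ⟨j + 1, hj⟩) := by
      refine mul_mem_spanL (fun c hc => ?_) (ih (by omega))
      refine spanL_mono ?_ (T_mul_Lmon_mem i c)
      intro d hd
      obtain ⟨h1, h2, h3⟩ := hc
      have hz : c (_root_.ArikiKoike.hi i) = 0 := h1 _ (lo_lt_hi i)
      refine ⟨fun k hk => ?_, ?_, ?_⟩
      · rw [Fin.lt_def] at hk
        simp only at hk
        rw [hd.1 k (by simp [Fin.ext_iff, i]; omega) (by simp [Fin.ext_iff, i]; omega)]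
        exact h1 k (by rw [Fin.lt_def]; simp only; omega)
      · have := hd.2.2.2
        rw [hz, max_eq_left (Nat.zero_le _)] at this
        exact this.trans_lt h2
      · rw [sum_eq_of_mem_hull hd]
        exact h3
    obtain ⟨n, rfl⟩ : ∃ n, m = n + 1 := ⟨m - 1, by omega⟩
    have key : L r q u (j + 1 + 1) ^ (n + 1) = ((q⁻¹ : Rˣ) : R) •
        ((T r q u (j + 1) * L r q u (j + 1) ^ (n + 1) + ((q : R) - 1) • ∑ t ∈ Finset.range n,
          L r q u (j + 1) ^ (t + 1) * L r q u (j + 1 + 1) ^ (n + 1 - (t + 1))) *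
            T r q u (j + 1)) := by
      have e : T r q u (j + 1) * L r q u (j + 1) ^ (n + 1) + ((q : R) - 1) • ∑ t ∈ Finset.range n,
          L r q u (j + 1) ^ (t + 1) * L r q u (j + 1 + 1) ^ (n + 1 - (t + 1)) =
          L r q u (j + 1 + 1) ^ (n + 1) * (T r q u (j + 1) - ((q : R) - 1) • 1) := by
        rw [T_mul_L_pow q u (by omega) hj, Finset.sum_range_succ', mul_sub, mul_smul_comm, mul_one,
          smul_add]
        simp only [pow_zero, one_mul, Nat.sub_zero]
        abel
      rw [e, mul_assoc, sub_mul_T q u (by omega) hj, mul_smul_comm, mul_one, smul_smul,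
        Units.inv_mul, one_smul]
    rw [key]
    refine Submodule.smul_mem _ _ (mul_finHecke_mem (add_mem ih (Submodule.smul_mem _ _
      (Submodule.sum_mem _ fun t ht => ?_))) (T_mem_finHecke q u (by omega)))
    rw [Finset.mem_range] at ht
    have hne := (lo_lt_hi i).ne
    rw [show L r q u (j + 1) ^ (t + 1) * L r q u (j + 1 + 1) ^ (n + 1 - (t + 1)) =
      Lmon q u (Pi.single (lo i) (t + 1) + Pi.single (_root_.ArikiKoike.hi i) (n + 1 - (t + 1))) by
        rw [Lmon_add, Lmon_single, Lmon_single]]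
    refine Lmon_mem ⟨fun k hk => ?_, ?_, ?_⟩
    · rw [Fin.lt_def] at hk
      simp only at hk
      rw [Pi.add_apply, Pi.single_eq_of_ne (by simp [Fin.ext_iff, i]; omega),
        Pi.single_eq_of_ne (by simp [Fin.ext_iff, i]; omega), add_zero]
    · change (Pi.single (lo i) (t + 1) + Pi.single (_root_.ArikiKoike.hi i) (n + 1 - (t + 1)) :
        Fin r → ℕ) (_root_.ArikiKoike.hi i) < n + 1
      rw [Pi.add_apply, Pi.single_eq_of_ne hne.symm, Pi.single_eq_same]
      omega
    · simp only [Pi.add_apply, Finset.sum_add_distrib, Finset.sum_pi_single', Finset.mem_univ,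
        if_true]
      omega

theorem weight_lt_of_mem_reductSet {j : Fin r} {d : Fin r → ℕ} (hd : d ∈ reductSet m j) :
    ∑ k : Fin r, ((k : ℕ) + 1) * d k < (j + 1) * m := by
  obtain ⟨h1, h2, h3⟩ := hd
  have : ∑ k : Fin r, ((k : ℕ) + 1) * d k ≤ ∑ k : Fin r, (j * d k + if k = j then d j else 0) := by
    refine Finset.sum_le_sum fun k _ => ?_
    rcases lt_trichotomy k j with h | rfl | h
    · rw [if_neg h.ne, add_zero]
      exact Nat.mul_le_mul_right _ h
    · rw [if_pos rfl, add_mul, one_mul]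
    · simp [h1 k h]
  rw [Finset.sum_add_distrib, ← Finset.mul_sum, Finset.sum_ite_eq' , if_pos (Finset.mem_univ _)]
    at this
  have := Nat.mul_le_mul_left (j : ℕ) h3
  rw [add_mul, one_mul]
  omega

/-- If a set of exponents is stable under the rewriting of the powers `L_{j+1}^m`, then exponents
less than `m` suffice to span. -/
theorem spanL_le_reduced (hm : 0 < m) {S : Set (Fin r → ℕ)}
    (hS : ∀ c j, c + Pi.single j m ∈ S → ∀ d ∈ reductSet m j, c + d ∈ S) :
    spanL q u S ≤ spanL q u {c | c ∈ S ∧ ∀ j, c j < m} := by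
  -- the rewriting terminates because it lowers `∑ (k + 1) c_k`
  have key : ∀ (n : ℕ) (c : Fin r → ℕ), ∑ k : Fin r, ((k : ℕ) + 1) * c k = n → c ∈ S →
      Lmon q u c ∈ spanL q u {c | c ∈ S ∧ ∀ j, c j < m} := by
    intro n
    induction n using Nat.strong_induction_on with
    | _ n ih =>
      intro c hn hc
      by_cases h : ∀ j, c j < m
      · exact Lmon_mem ⟨hc, h⟩
      · push Not at h
        obtain ⟨j, hj⟩ := h
        obtain ⟨e, rfl⟩ : ∃ e : Fin r → ℕ, c = e + Pi.single j m := by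
          refine ⟨c - Pi.single j m, funext fun k => ?_⟩
          by_cases hk : k = j
          · subst hk
            simp only [Pi.add_apply, Pi.sub_apply, Pi.single_eq_same]
            omega
          · simp [hk]
        rw [Lmon_add, Lmon_single]
        refine mul_mem_spanL (fun d hd => ?_) (L_pow_mem hm j)
        rw [← Lmon_add]
        refine ih _ ?_ _ rfl (hS _ _ hc d hd)
        have hlt := weight_lt_of_mem_reductSet hd
        simp only [Pi.add_apply, mul_add, Finset.sum_add_distrib] at hn ⊢
        have : ∑ k : Fin r, ((k : ℕ) + 1) * (Pi.single j m : Fin r → ℕ) k = (j + 1) * m := by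
          rw [Finset.sum_eq_single j]
          · simp
          · intro b _ hb; simp [hb]
          · simp
        omega
  exact spanL_le fun c hc h hh => mul_finHecke_mem (key _ c rfl hc) hh

/-- The span of all `L^c h` is a left ideal that contains `1`. -/
theorem spanL_univ : spanL q u (Set.univ : Set (Fin r → ℕ)) = ⊤ := by
  have hT : ∀ i : Fin r, ∀ x ∈ spanL q u (Set.univ : Set (Fin r → ℕ)),
      T r q u i * x ∈ spanL q u (Set.univ : Set (Fin r → ℕ)) := by
    rintro ⟨i, hi⟩ x hx
    refine mul_mem_spanL (fun c _ => ?_) hx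
    obtain rfl | h0 := Nat.eq_zero_or_pos i
    · have : T r q u ((⟨0, hi⟩ : Fin r) : ℕ) = Lmon q u (Pi.single ⟨0, hi⟩ 1) := by
        rw [Lmon_single, pow_one]; rfl
      rw [this, ← Lmon_add]
      exact Lmon_mem trivial
    · obtain ⟨i, rfl⟩ : ∃ l, i = l + 1 := ⟨i - 1, by omega⟩
      exact spanL_mono (Set.subset_univ _) (T_mul_Lmon_mem ⟨i, by omega⟩ c)
  have hall : ∀ a : FreeAlgebra R (Fin r), ∀ x ∈ spanL q u (Set.univ : Set (Fin r → ℕ)),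
      mk r q u a * x ∈ spanL q u (Set.univ : Set (Fin r → ℕ)) := by
    intro a
    induction a using FreeAlgebra.induction with
    | grade0 a =>
      intro x hx
      rw [AlgHom.commutes, ← Algebra.smul_def]
      exact Submodule.smul_mem _ _ hx
    | grade1 i =>
      intro x hx
      rw [← T_of_lt q u i.2]
      exact hT i x hx
    | add a b ha hb => intro x hx; rw [map_add, add_mul]; exact add_mem (ha x hx) (hb x hx)
    | mul a b ha hb => intro x hx; rw [map_mul, mul_assoc]; exact ha _ (hb x hx)
  rw [eq_top_iff]
  rintro x -
  obtain ⟨a, rfl⟩ := RingQuot.mkAlgHom_surjective R (Rel r q u) x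
  have := hall a 1 (by rw [← Lmon_zero]; exact Lmon_mem trivial)
  rwa [mul_one] at this

/-- The elements `L^c T_w` with `c_j < m` span `H`. -/
theorem span_Lmon_mul_Tperm (hm : 0 < m) :
    Submodule.span R (Set.range fun p : (Fin r → Fin m) × Equiv.Perm (Fin r) =>
      Lmon q u (fun j => (p.1 j : ℕ)) * Tperm r q u p.2) = ⊤ := by
  rw [eq_top_iff, ← spanL_univ]
  refine (spanL_le_reduced hm fun _ _ _ _ _ => Set.mem_univ _).trans (spanL_le ?_)
  rintro c ⟨-, hc⟩ h hh
  rw [← Subalgebra.mem_toSubmodule, finHecke_toSubmodule] at hh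
  induction hh using Submodule.span_induction with
  | mem h hh =>
    obtain ⟨w, rfl⟩ := hh
    exact Submodule.subset_span ⟨(fun j => ⟨c j, hc j⟩, w), rfl⟩
  | zero => simp
  | add x y _ _ hx hy => rw [mul_add]; exact add_mem hx hy
  | smul a x _ hx => rw [mul_smul_comm]; exact Submodule.smul_mem _ _ hx

end Monomials

/-! ### A representation on functions of words in coloured letters -/

section Representation

variable {A : Type*} [CommRing A] {I : Type*}

/-- The word `f` with the letters at `i`, `i + 1`, `i + 2` replaced by `x`, `y`, `z`. -/
def put3 (f : ℕ → I) (i : ℕ) (x y z : I) : ℕ → I := fun n =>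
  if n = i then x else if n = i + 1 then y else if n = i + 2 then z else f n

theorem put3_self (f : ℕ → I) (i : ℕ) : put3 f i (f i) (f (i + 1)) (f (i + 2)) = f := by
  funext n
  unfold put3
  split_ifs <;> simp_all

@[simp] theorem put3_zero (f : ℕ → I) (i : ℕ) (x y z : I) : put3 f i x y z i = x := by simp [put3]

@[simp] theorem put3_one (f : ℕ → I) (i : ℕ) (x y z : I) : put3 f i x y z (i + 1) = y := by
  simp [put3]

@[simp] theorem put3_two (f : ℕ → I) (i : ℕ) (x y z : I) : put3 f i x y z (i + 2) = z := by
  simp [put3]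

@[simp] theorem put3_swap (f : ℕ → I) (i : ℕ) (x y z : I) :
    put3 f i x y z ∘ Equiv.swap i (i + 1) = put3 f i y x z := by
  funext n
  simp only [Function.comp_apply, Equiv.swap_apply_def, put3]
  split_ifs <;> first | rfl | omega

@[simp] theorem put3_swap' (f : ℕ → I) (i : ℕ) (x y z : I) :
    put3 f i x y z ∘ Equiv.swap (i + 1) (i + 2) = put3 f i x z y := by
  funext n
  simp only [Function.comp_apply, Equiv.swap_apply_def, put3]
  split_ifs <;> first | rfl | omega

theorem swap_swap_comp (f : ℕ → I) (i : ℕ) :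
    (f ∘ Equiv.swap i (i + 1)) ∘ Equiv.swap i (i + 1) = f := by
  funext n
  simp

/-- Multiplication by a scalar that depends on the colour of the first letter. -/
def colourOp (col : I → ℕ) (v : ℕ → A) : Module.End A ((ℕ → I) → A) where
  toFun φ f := v (col (f 0)) * φ f
  map_add' φ ψ := by funext f; simp only [Pi.add_apply]; ring
  map_smul' a φ := by funext f; simp only [Pi.smul_apply, smul_eq_mul, RingHom.id_apply]; ring

theorem colourOp_apply (col : I → ℕ) (v : ℕ → A) (φ : (ℕ → I) → A) (f : ℕ → I) :
    colourOp col v φ f = v (col (f 0)) * φ f := rfl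

variable (q : Aˣ) [LinearOrder I]

/-- The coefficient of `φ f` in `swapOp`. -/
def diagCoeff (col : I → ℕ) (x y : I) : A :=
  if x = y then (q : A) else if x < y then 0 else if col x = col y then (q : A) - 1 else 0

/-- The coefficient of `φ (f ∘ s_i)` in `swapOp`. -/
def swapCoeff (x y : I) : A := if x = y then 0 else if x < y then 1 else (q : A)

/-- For a colouring `col` of the alphabet `I`, the operator on functions of words `f : ℕ → I` which
at the places `i`, `i + 1` is the Hecke operator if both letters have the same colour, and a
rescaled flip of the two letters otherwise. For constant `col` it is the Hecke operator itself. -/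
def swapOp (col : I → ℕ) (i : ℕ) : Module.End A ((ℕ → I) → A) where
  toFun φ f := diagCoeff q col (f i) (f (i + 1)) * φ f +
    swapCoeff q (f i) (f (i + 1)) * φ (f ∘ Equiv.swap i (i + 1))
  map_add' φ ψ := by funext f; simp only [Pi.add_apply]; ring
  map_smul' a φ := by funext f; simp only [Pi.smul_apply, smul_eq_mul, RingHom.id_apply]; ring

theorem swapOp_apply (col : I → ℕ) (i : ℕ) (φ : (ℕ → I) → A) (f : ℕ → I) :
    swapOp q col i φ f = diagCoeff q col (f i) (f (i + 1)) * φ f +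
      swapCoeff q (f i) (f (i + 1)) * φ (f ∘ Equiv.swap i (i + 1)) := rfl

/-- The Hecke operator at the places `i`, `i + 1`. -/
def hecke (i : ℕ) : Module.End A ((ℕ → I) → A) := swapOp q (fun _ => 0) i

/-- The braid relation. On the words with the letters `x`, `y`, `z` at the places `i`, `i + 1`,
`i + 2`, in any order, it is a polynomial identity in `q` for each way in which the letters and
their colours may be ordered. The colours have to increase with the letters. -/
theorem swapOp_braid (col : I → ℕ) (hcol : Monotone col) (i : ℕ) :
    swapOp q col i * swapOp q col (i + 1) * swapOp q col i =
      swapOp q col (i + 1) * swapOp q col i * swapOp q col (i + 1) := by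
  ext φ f
  rw [← put3_self f i]
  have h1 := @hcol (f i) (f (i + 1))
  have h2 := @hcol (f (i + 1)) (f (i + 2))
  have h3 := @hcol (f i) (f (i + 2))
  have h4 := @hcol (f (i + 1)) (f i)
  have h5 := @hcol (f (i + 2)) (f (i + 1))
  have h6 := @hcol (f (i + 2)) (f i)
  simp only [Module.End.mul_apply, swapOp_apply, put3_zero, put3_one, put3_two, put3_swap,
    put3_swap', add_assoc, Nat.reduceAdd, diagCoeff, swapCoeff]
  generalize φ (put3 f i (f i) (f (i + 1)) (f (i + 2))) = p1
  generalize φ (put3 f i (f i) (f (i + 2)) (f (i + 1))) = p2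
  generalize φ (put3 f i (f (i + 1)) (f i) (f (i + 2))) = p3
  generalize φ (put3 f i (f (i + 1)) (f (i + 2)) (f i)) = p4
  generalize φ (put3 f i (f (i + 2)) (f i) (f (i + 1))) = p5
  generalize φ (put3 f i (f (i + 2)) (f (i + 1)) (f i)) = p6
  grind

theorem hecke_braid (i : ℕ) : hecke q i * hecke q (i + 1) * hecke q i =
    (hecke q (i + 1) * hecke q i * hecke q (i + 1) : Module.End A ((ℕ → I) → A)) :=
  swapOp_braid q _ monotone_const i

/-- The mixed braid relation `t_{i+1} S_i S_{i+1} = S_i S_{i+1} t_i` between Hecke operators `t` and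
colour-sensitive flips `S`. -/
theorem hecke_mul_swapOp_mul_swapOp (col : I → ℕ) (hcol : Monotone col) (i : ℕ) :
    hecke q (i + 1) * (swapOp q col i * swapOp q col (i + 1)) =
      swapOp q col i * swapOp q col (i + 1) * hecke q i := by
  ext φ f
  rw [← put3_self f i]
  have h1 := @hcol (f i) (f (i + 1))
  have h2 := @hcol (f (i + 1)) (f (i + 2))
  have h3 := @hcol (f i) (f (i + 2))
  have h4 := @hcol (f (i + 1)) (f i)
  have h5 := @hcol (f (i + 2)) (f (i + 1))
  have h6 := @hcol (f (i + 2)) (f i)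
  simp only [hecke, Module.End.mul_apply, swapOp_apply, put3_zero, put3_one, put3_two, put3_swap,
    put3_swap', add_assoc, Nat.reduceAdd, diagCoeff, swapCoeff]
  generalize φ (put3 f i (f i) (f (i + 1)) (f (i + 2))) = p1
  generalize φ (put3 f i (f i) (f (i + 2)) (f (i + 1))) = p2
  generalize φ (put3 f i (f (i + 1)) (f i) (f (i + 2))) = p3
  generalize φ (put3 f i (f (i + 1)) (f (i + 2)) (f i)) = p4
  generalize φ (put3 f i (f (i + 2)) (f i) (f (i + 1))) = p5
  generalize φ (put3 f i (f (i + 2)) (f (i + 1)) (f i)) = p6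
  grind

/-- The mixed braid relation `t_i S_{i+1} S_i = S_{i+1} S_i t_{i+1}`. -/
theorem hecke_mul_swapOp_mul_swapOp' (col : I → ℕ) (hcol : Monotone col) (i : ℕ) :
    hecke q i * (swapOp q col (i + 1) * swapOp q col i) =
      swapOp q col (i + 1) * swapOp q col i * hecke q (i + 1) := by
  ext φ f
  rw [← put3_self f i]
  have h1 := @hcol (f i) (f (i + 1))
  have h2 := @hcol (f (i + 1)) (f (i + 2))
  have h3 := @hcol (f i) (f (i + 2))
  have h4 := @hcol (f (i + 1)) (f i)
  have h5 := @hcol (f (i + 2)) (f (i + 1))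
  have h6 := @hcol (f (i + 2)) (f i)
  simp only [hecke, Module.End.mul_apply, swapOp_apply, put3_zero, put3_one, put3_two, put3_swap,
    put3_swap', add_assoc, Nat.reduceAdd, diagCoeff, swapCoeff]
  generalize φ (put3 f i (f i) (f (i + 1)) (f (i + 2))) = p1
  generalize φ (put3 f i (f i) (f (i + 2)) (f (i + 1))) = p2
  generalize φ (put3 f i (f (i + 1)) (f i) (f (i + 2))) = p3
  generalize φ (put3 f i (f (i + 1)) (f (i + 2)) (f i)) = p4
  generalize φ (put3 f i (f (i + 2)) (f i) (f (i + 1))) = p5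
  generalize φ (put3 f i (f (i + 2)) (f (i + 1)) (f i)) = p6
  grind

theorem swapOp_comm (col col' : I → ℕ) {i j : ℕ} (h : i + 2 ≤ j) :
    Commute (swapOp q col i) (swapOp q col' j : Module.End A ((ℕ → I) → A)) := by
  have h1 : Equiv.swap i (i + 1) j = j := Equiv.swap_apply_of_ne_of_ne (by omega) (by omega)
  have h2 : Equiv.swap i (i + 1) (j + 1) = j + 1 :=
    Equiv.swap_apply_of_ne_of_ne (by omega) (by omega)
  have h3 : Equiv.swap j (j + 1) i = i := Equiv.swap_apply_of_ne_of_ne (by omega) (by omega)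
  have h4 : Equiv.swap j (j + 1) (i + 1) = i + 1 :=
    Equiv.swap_apply_of_ne_of_ne (by omega) (by omega)
  rw [commute_iff_eq]
  ext φ f
  have h5 : (f ∘ Equiv.swap i (i + 1)) ∘ Equiv.swap j (j + 1) =
      (f ∘ Equiv.swap j (j + 1)) ∘ Equiv.swap i (i + 1) := by
    have : Equiv.swap i (i + 1) * Equiv.swap j (j + 1) =
        Equiv.swap j (j + 1) * Equiv.swap i (i + 1) := by
      rw [Equiv.swap_mul_eq_mul_swap, Equiv.swap_inv, h3, h4]
    funext n
    exact congrArg f (Equiv.congr_fun this n)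
  simp only [Module.End.mul_apply, swapOp_apply, Function.comp_apply, h1, h2, h3, h4, h5]
  ring

theorem hecke_sq (i : ℕ) : (hecke q i * hecke q i : Module.End A ((ℕ → I) → A)) =
    ((q : A) - 1) • hecke q i + (q : A) • 1 := by
  ext φ f
  simp only [hecke, Module.End.mul_apply, swapOp_apply, Function.comp_apply, LinearMap.add_apply,
    LinearMap.smul_apply, Module.End.one_apply, Pi.add_apply, Pi.smul_apply, smul_eq_mul,
    Equiv.swap_apply_left, Equiv.swap_apply_right, swap_swap_comp, diagCoeff, swapCoeff]
  grind

/-- The inverse of the Hecke operator. -/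
def heckeInv (i : ℕ) : Module.End A ((ℕ → I) → A) :=
  ((q⁻¹ : Aˣ) : A) • (hecke q i - ((q : A) - 1) • 1)

theorem hecke_mul_heckeInv (i : ℕ) :
    (hecke q i * heckeInv q i : Module.End A ((ℕ → I) → A)) = 1 := by
  rw [heckeInv, mul_smul_comm, mul_sub, hecke_sq, mul_smul_comm, mul_one, add_sub_cancel_left,
    smul_smul, Units.inv_mul, one_smul]

theorem heckeInv_mul_hecke (i : ℕ) :
    (heckeInv q i * hecke q i : Module.End A ((ℕ → I) → A)) = 1 := by
  rw [heckeInv, smul_mul_assoc, sub_mul, hecke_sq, smul_mul_assoc, one_mul, add_sub_cancel_left,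
    smul_smul, Units.inv_mul, one_smul]

theorem heckeInv_apply_of_lt {i : ℕ} {f : ℕ → I} (h : f i < f (i + 1)) (φ : (ℕ → I) → A) :
    heckeInv q i φ f =
      ((q⁻¹ : Aˣ) : A) * (φ (f ∘ Equiv.swap i (i + 1)) - ((q : A) - 1) * φ f) := by
  simp [heckeInv, hecke, swapOp_apply, diagCoeff, swapCoeff, h, h.ne]

theorem heckeInv_apply_of_gt {i : ℕ} {f : ℕ → I} (h : f (i + 1) < f i) (φ : (ℕ → I) → A) :
    heckeInv q i φ f = φ (f ∘ Equiv.swap i (i + 1)) := by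
  simp [heckeInv, hecke, swapOp_apply, diagCoeff, swapCoeff, h.ne', h.not_gt]

theorem heckeInv_apply_of_eq {i : ℕ} {f : ℕ → I} (h : f i = f (i + 1)) (φ : (ℕ → I) → A) :
    heckeInv q i φ f = ((q⁻¹ : Aˣ) : A) * φ f := by
  simp [heckeInv, hecke, swapOp_apply, diagCoeff, swapCoeff, h]
  ring

theorem colourOp_comm (col col' : I → ℕ) (v : ℕ → A) {i : ℕ} (hi : 1 ≤ i) :
    Commute (colourOp col v) (swapOp q col' i) := by
  have h1 : Equiv.swap i (i + 1) 0 = 0 := Equiv.swap_apply_of_ne_of_ne (by omega) (by omega)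
  rw [commute_iff_eq]
  ext φ f
  simp only [Module.End.mul_apply, swapOp_apply, colourOp_apply, Function.comp_apply, h1]
  ring

/-- The Hecke operator `t_0` commutes with the square of `ϖ S_0`, where `ϖ` is `colourOp`. -/
theorem hecke_comm_colourOp_swapOp (col : I → ℕ) (v : ℕ → A) :
    Commute (hecke q 0) (colourOp col v * swapOp q col 0 * (colourOp col v * swapOp q col 0)) := by
  rw [commute_iff_eq]
  ext φ f
  simp only [hecke, Module.End.mul_apply, swapOp_apply, colourOp_apply, Function.comp_apply,
    Equiv.swap_apply_left, Equiv.swap_apply_right, swap_swap_comp, diagCoeff, swapCoeff]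
  grind

/-- The product `S_k S_{k+1} ⋯ S_{k+n-1}` of colour-sensitive flips. -/
def flipProd (col : I → ℕ) (k : ℕ) : ℕ → Module.End A ((ℕ → I) → A)
  | 0 => 1
  | n + 1 => flipProd col k n * swapOp q col (k + n)

/-- The product `T_{k+n-1}⁻¹ ⋯ T_{k+1}⁻¹ T_k⁻¹` of inverse Hecke operators. -/
def invProd (k : ℕ) : ℕ → Module.End A ((ℕ → I) → A)
  | 0 => 1
  | n + 1 => heckeInv q (k + n) * invProd k n

theorem flipProd_succ' (col : I → ℕ) (k n : ℕ) :
    (flipProd q col k (n + 1) : Module.End A ((ℕ → I) → A)) =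
      swapOp q col k * flipProd q col (k + 1) n := by
  induction n with
  | zero => simp [flipProd]
  | succ n ih =>
    rw [flipProd, ih, mul_assoc, flipProd, show k + (n + 1) = k + 1 + n by omega]

theorem invProd_succ' (k n : ℕ) : (invProd q k (n + 1) : Module.End A ((ℕ → I) → A)) =
    invProd q (k + 1) n * heckeInv q k := by
  induction n with
  | zero => simp [invProd]
  | succ n ih =>
    rw [invProd, ih, ← mul_assoc, invProd, show k + (n + 1) = k + 1 + n by omega]

/-- The operator by which `T_0` acts on functions of words with `n + 1` relevant letters: with `ϖ`
for `colourOp`, `S_i` for `swapOp` and `t_i` for `hecke` it is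
`ϖ S_0 S_1 ⋯ S_{n-1} t_{n-1}⁻¹ ⋯ t_1⁻¹ t_0⁻¹`. -/
def zeroOp (col : I → ℕ) (v : ℕ → A) (n : ℕ) : Module.End A ((ℕ → I) → A) :=
  colourOp col v * flipProd q col 0 n * invProd q 0 n

/-- Commuting with the Hecke operators carries over to their inverses. -/
theorem heckeInv_semiconj {i j : ℕ} {x : Module.End A ((ℕ → I) → A)}
    (h : SemiconjBy x (hecke q i) (hecke q j)) : SemiconjBy x (heckeInv q i) (heckeInv q j) := by
  have := congrArg (fun y => heckeInv q j * y * heckeInv q i) h.eq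
  simp only [mul_assoc, hecke_mul_heckeInv, mul_one] at this
  rw [← mul_assoc (heckeInv q j) (hecke q j), heckeInv_mul_hecke, one_mul] at this
  exact this.symm

variable (col : I → ℕ) (v : ℕ → A)

theorem hecke_comm {i j : ℕ} (h : i + 2 ≤ j) :
    Commute (hecke q i) (hecke q j : Module.End A ((ℕ → I) → A)) := swapOp_comm q _ _ h

theorem hecke_comm_invProd {k i n : ℕ} (h : k + n < i) :
    Commute (hecke q i : Module.End A ((ℕ → I) → A)) (invProd q k n) := by
  induction n with
  | zero => exact Commute.one_right _
  | succ n ih =>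
    exact Commute.mul_right (heckeInv_semiconj q (hecke_comm q (by omega)).symm) (ih (by omega))

theorem swapOp_comm_flipProd {k i n : ℕ} (h : k + n < i) (col' : I → ℕ) :
    Commute (swapOp q col' i : Module.End A ((ℕ → I) → A)) (flipProd q col k n) := by
  induction n with
  | zero => exact Commute.one_right _
  | succ n ih => exact Commute.mul_right (ih (by omega)) (swapOp_comm q _ _ (by omega)).symm

/-- `Z t_i = t_{i+1} Z` for the product `Z` of flips. -/
theorem flipProd_semiconj (hcol : Monotone col) {i n : ℕ} (h : i + 1 < n) :
    SemiconjBy (flipProd q col 0 n : Module.End A ((ℕ → I) → A)) (hecke q i)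
      (hecke q (i + 1)) := by
  induction n with
  | zero => omega
  | succ n ih =>
    obtain rfl | hn := eq_or_ne n (i + 1)
    · have h1 : SemiconjBy (swapOp q col i * swapOp q col (i + 1)) (hecke q i)
          (hecke q (i + 1) : Module.End A ((ℕ → I) → A)) :=
        (hecke_mul_swapOp_mul_swapOp q col hcol i).symm
      have h2 : SemiconjBy (flipProd q col 0 i) (hecke q (i + 1))
          (hecke q (i + 1) : Module.End A ((ℕ → I) → A)) :=
        (swapOp_comm_flipProd q col (by omega) _).symm
      simpa [flipProd, mul_assoc] using h2.mul_left h1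
    · have h1 : SemiconjBy (swapOp q col n) (hecke q i)
          (hecke q i : Module.End A ((ℕ → I) → A)) := (swapOp_comm q _ _ (by omega)).symm
      simpa [flipProd] using (ih (by omega)).mul_left h1

/-- `D t_{i+1} = t_i D` for the product `D` of inverses. -/
theorem invProd_semiconj {i n : ℕ} (h : i + 1 < n) :
    SemiconjBy (invProd q 0 n : Module.End A ((ℕ → I) → A)) (hecke q (i + 1)) (hecke q i) := by
  induction n with
  | zero => omega
  | succ n ih =>
    obtain rfl | hn := eq_or_ne n (i + 1)
    · have h1 : SemiconjBy (heckeInv q (i + 1) * heckeInv q i) (hecke q (i + 1))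
          (hecke q i : Module.End A ((ℕ → I) → A)) := by
        have hb := congrArg (fun y => heckeInv q (i + 1) * heckeInv q i * y *
          (heckeInv q (i + 1) * heckeInv q i)) (hecke_braid (A := A) (I := I) q i)
        have e1 := heckeInv_mul_hecke (A := A) (I := I) q i
        have e2 := heckeInv_mul_hecke (A := A) (I := I) q (i + 1)
        have e3 := hecke_mul_heckeInv (A := A) (I := I) q i
        have e4 := hecke_mul_heckeInv (A := A) (I := I) q (i + 1)
        generalize (hecke q i : Module.End A ((ℕ → I) → A)) = a at *
        generalize (hecke q (i + 1) : Module.End A ((ℕ → I) → A)) = b at *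
        generalize (heckeInv q i : Module.End A ((ℕ → I) → A)) = a' at *
        generalize (heckeInv q (i + 1) : Module.End A ((ℕ → I) → A)) = b' at *
        have l1 : b' * a' * (a * b * a) * (b' * a') = a * (b' * a') := by
          calc _ = b' * (a' * a) * b * a * b' * a' := by simp only [mul_assoc]
            _ = (b' * b) * a * b' * a' := by rw [e1]; simp only [mul_assoc, one_mul]
            _ = _ := by rw [e2]; simp only [mul_assoc, one_mul]
        have l2 : b' * a' * (b * a * b) * (b' * a') = b' * a' * b := by
          calc _ = b' * a' * b * a * (b * b') * a' := by simp only [mul_assoc]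
            _ = b' * a' * b * (a * a') := by rw [e4]; simp only [mul_assoc, one_mul]
            _ = _ := by rw [e3, mul_one]
        exact l2.symm.trans (hb.symm.trans l1)
      have h2 : SemiconjBy (invProd q 0 i) (hecke q (i + 1))
          (hecke q (i + 1) : Module.End A ((ℕ → I) → A)) :=
        (hecke_comm_invProd q (by omega)).symm
      simpa [invProd, mul_assoc] using h1.mul_left h2
    · have h1 : SemiconjBy (heckeInv q n) (hecke q i)
          (hecke q i : Module.End A ((ℕ → I) → A)) :=
        (heckeInv_semiconj q (hecke_comm q (i := i) (j := n) (by omega))).symm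
      simpa [invProd] using h1.mul_left (ih (by omega))

theorem rotation_semiconj (hcol : Monotone col) {i n : ℕ} (h : i + 1 < n) :
    SemiconjBy (colourOp col v * flipProd q col 0 n) (hecke q i) (hecke q (i + 1)) :=
  SemiconjBy.mul_left (colourOp_comm q col _ v (by omega)) (flipProd_semiconj q col hcol h)

/-- The square of the rotation `R = ϖ S_0 ⋯ S_n` moves the last Hecke operator to the first. -/
theorem rotation_sq (hcol : Monotone col) (n : ℕ) :
    SemiconjBy ((colourOp col v * flipProd q col 0 (n + 1)) *
      (colourOp col v * flipProd q col 0 (n + 1))) (hecke q n) (hecke q 0) := by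
  induction n with
  | zero =>
    simp only [flipProd, one_mul, zero_add]
    exact (hecke_comm_colourOp_swapOp q col v).symm
  | succ n ih =>
    set R := colourOp col v * flipProd q col 0 n with hR
    have e1 : colourOp col v * flipProd q col 0 (n + 1) = R * swapOp q col n := by
      rw [hR, flipProd, zero_add, mul_assoc]
    have e2 : colourOp col v * flipProd q col 0 (n + 1 + 1) =
        R * swapOp q col n * swapOp q col (n + 1) := by
      rw [← e1, flipProd, zero_add, mul_assoc]
    have hc : Commute (swapOp q col (n + 1)) R :=
      Commute.mul_right (colourOp_comm q col _ v (by omega)).symm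
        (swapOp_comm_flipProd q col (by omega) _)
    have hb := swapOp_braid (A := A) q col hcol n
    have key : R * swapOp q col n * swapOp q col (n + 1) *
        (R * swapOp q col n * swapOp q col (n + 1)) =
        R * swapOp q col n * (R * swapOp q col n) * (swapOp q col (n + 1) * swapOp q col n) := by
      calc _ = R * swapOp q col n * (swapOp q col (n + 1) * R) *
            (swapOp q col n * swapOp q col (n + 1)) := by simp only [mul_assoc]
        _ = R * swapOp q col n * R * (swapOp q col (n + 1) * swapOp q col n *
            swapOp q col (n + 1)) := by rw [hc.eq]; simp only [mul_assoc]
        _ = _ := by rw [← hb]; simp only [mul_assoc]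
    rw [e2, key]
    rw [e1] at ih
    exact ih.mul_left (hecke_mul_swapOp_mul_swapOp' q col hcol n).symm

theorem zeroOp_comm_hecke (hcol : Monotone col) {i n : ℕ} (h : i + 1 < n) :
    Commute (zeroOp q col v n) (hecke q (i + 1)) :=
  (rotation_semiconj q col v hcol h).mul_left (invProd_semiconj q h)

/-- The braid relation of `T_0` and `T_1`. With `R` for the rotation `ϖ S_0 ⋯ S_n` and `D` for the
product of inverses, so that `T_0 = R D`, the left side is turned into the right one by
shifting inverse Hecke operators along `R` and `D` and by `R² t_n = t_0 R²`. -/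
theorem zeroOp_braid (hcol : Monotone col) (n : ℕ) :
    zeroOp q col v (n + 1) * hecke q 0 * zeroOp q col v (n + 1) * hecke q 0 =
      hecke q 0 * zeroOp q col v (n + 1) * hecke q 0 * zeroOp q col v (n + 1) := by
  set R := colourOp col v * flipProd q col 0 (n + 1) with hR
  set D : Module.End A ((ℕ → I) → A) := invProd q 0 (n + 1) with hD
  have eT : zeroOp q col v (n + 1) = R * D := rfl
  have aux : ∀ {x : Module.End A ((ℕ → I) → A)} {k l : ℕ},
      (∀ i, i < n → SemiconjBy x (hecke q (k + i)) (hecke q (l + i))) → ∀ j ≤ n,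
        SemiconjBy x (invProd q k j) (invProd q l j) := by
    intro x k l hx j
    induction j with
    | zero => exact fun _ => SemiconjBy.one_right _
    | succ j ih =>
      exact fun hj => (heckeInv_semiconj q (hx j (by omega))).mul_right (ih (by omega))
  have hER : R * invProd q 0 n = invProd q 1 n * R :=
    aux (fun i hi => by
      rw [zero_add, add_comm 1]; exact rotation_semiconj q col v hcol (by omega)) n le_rfl
  have hDE : D * invProd q 1 n = invProd q 0 n * D :=
    aux (fun i hi => by rw [zero_add, add_comm 1]; exact invProd_semiconj q (by omega)) n le_rfl
  have hD0 : D * hecke q 0 = invProd q 1 n := by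
    rw [hD, invProd_succ', mul_assoc, heckeInv_mul_hecke, mul_one]
  have hDn : hecke q n * D = invProd q 0 n := by
    rw [hD, invProd, zero_add, ← mul_assoc, hecke_mul_heckeInv, one_mul]
  have hRR : R * R * hecke q n = hecke q 0 * (R * R) := rotation_sq q col v hcol n
  rw [eT]
  calc R * D * hecke q 0 * (R * D) * hecke q 0 = R * (D * hecke q 0) * R * (D * hecke q 0) := by
        simp only [mul_assoc]
    _ = R * (invProd q 1 n * R) * invProd q 1 n := by rw [hD0]; simp only [mul_assoc]
    _ = R * R * (hecke q n * D) * (D * hecke q 0) := by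
        rw [← hER, hDn, hD0]; simp only [mul_assoc]
    _ = R * R * hecke q n * (D * (D * hecke q 0)) := by simp only [mul_assoc]
    _ = hecke q 0 * (R * R) * (invProd q 0 n * D) := by rw [hRR, hD0, hDE]
    _ = hecke q 0 * R * (R * invProd q 0 n) * D := by simp only [mul_assoc]
    _ = hecke q 0 * R * (D * hecke q 0) * R * D := by rw [hER, ← hD0]; simp only [mul_assoc]
    _ = hecke q 0 * (R * D) * hecke q 0 * (R * D) := by simp only [mul_assoc]

/-- The product of all flips and inverses is unitriangular with respect to the colour of the first
relevant letter. -/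
theorem flipProd_mul_invProd_apply (hcol : Monotone col) (n : ℕ) (k : ℕ) (φ : (ℕ → I) → A)
    (f : ℕ → I) (h : ∀ g : ℕ → I, col (g k) < col (f k) → φ g = 0) :
    (flipProd q col k n * invProd q k n : Module.End A ((ℕ → I) → A)) φ f = φ f := by
  induction n generalizing k φ f with
  | zero => simp [flipProd, invProd]
  | succ n ih =>
    set Q : Module.End A ((ℕ → I) → A) := flipProd q col (k + 1) n * invProd q (k + 1) n
    have e : (flipProd q col k (n + 1) * invProd q k (n + 1) : Module.End A ((ℕ → I) → A)) φ =
        swapOp q col k (Q (heckeInv q k φ)) := by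
      rw [flipProd_succ', invProd_succ']
      simp only [Module.End.mul_apply, Q]
    have hψ : ∀ g : ℕ → I, col (g (k + 1)) < col (f k) → heckeInv q k φ g = 0 := by
      intro g hg
      have h1 : φ (g ∘ Equiv.swap k (k + 1)) = 0 := h _ (by simpa using hg)
      rcases lt_trichotomy (g k) (g (k + 1)) with hlt | heq | hgt
      · rw [heckeInv_apply_of_lt q hlt, h1, h g ((hcol hlt.le).trans_lt hg)]
        simp
      · rw [heckeInv_apply_of_eq q heq, h g (by rwa [heq]), mul_zero]
      · rw [heckeInv_apply_of_gt q hgt, h1]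
    have hs : Q (heckeInv q k φ) (f ∘ Equiv.swap k (k + 1)) =
        heckeInv q k φ (f ∘ Equiv.swap k (k + 1)) :=
      ih _ _ _ (by simpa using hψ)
    rw [e, swapOp_apply, hs]
    by_cases hc : col (f k) = col (f (k + 1))
    · rw [ih (k + 1) _ f (by rwa [← hc])]
      have : hecke q k (heckeInv q k φ) f = φ f := by
        rw [← Module.End.mul_apply, hecke_mul_heckeInv, Module.End.one_apply]
      rw [hecke, swapOp_apply] at this
      rw [← this]
      simp [diagCoeff, hc]
    · rcases lt_trichotomy (f k) (f (k + 1)) with hlt | heq | hgt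
      · rw [heckeInv_apply_of_gt q (by simpa using hlt), swap_swap_comp]
        simp [diagCoeff, swapCoeff, hlt, hlt.ne]
      · exact absurd (congrArg col heq) hc
      · rw [heckeInv_apply_of_lt q (by simpa using hgt), swap_swap_comp,
          h (f ∘ Equiv.swap k (k + 1)) (by simpa using lt_of_le_of_ne (hcol hgt.le) (Ne.symm hc))]
        simp [diagCoeff, swapCoeff, hgt.ne', hgt.not_gt, hc]

theorem zeroOp_apply (hcol : Monotone col) (n : ℕ) (φ : (ℕ → I) → A) (f : ℕ → I)
    (h : ∀ g : ℕ → I, col (g 0) < col (f 0) → φ g = 0) :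
    zeroOp q col v n φ f = v (col (f 0)) * φ f := by
  rw [zeroOp, mul_assoc, Module.End.mul_apply, colourOp_apply,
    flipProd_mul_invProd_apply q col hcol n 0 φ f h]

open Polynomial in
/-- The product of the first `k` factors kills every value at a word whose first letter has a colour
less than `k`, by triangularity. -/
theorem zeroOp_cyclotomic (hcol : Monotone col) {m : ℕ} (hm : ∀ x, col x < m) (n : ℕ) :
    Polynomial.aeval (zeroOp q col v n) (∏ k ∈ Finset.range m, (X - C (v k))) = 0 := by
  have key : ∀ k (φ : (ℕ → I) → A) (f : ℕ → I), col (f 0) < k →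
      Polynomial.aeval (zeroOp q col v n) (∏ k ∈ Finset.range k, (X - C (v k))) φ f = 0 := by
    intro k
    induction k with
    | zero => intro φ f h; omega
    | succ k ih =>
      intro φ f h
      rw [Finset.prod_range_succ, mul_comm, map_mul, Module.End.mul_apply]
      set ψ := Polynomial.aeval (zeroOp q col v n) (∏ k ∈ Finset.range k, (X - C (v k))) φ
      have h0 : ∀ g : ℕ → I, col (g 0) < col (f 0) → ψ g = 0 := fun g hg => ih φ g (by omega)
      rw [map_sub, aeval_X, aeval_C, LinearMap.sub_apply, Pi.sub_apply,
        zeroOp_apply q col v hcol n ψ f h0, Module.algebraMap_end_apply, Pi.smul_apply, smul_eq_mul]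
      obtain h1 | h1 := (Nat.lt_succ_iff.mp h).lt_or_eq
      · rw [show ψ f = 0 from ih φ f h1]
        simp
      · rw [h1, sub_self]
  ext φ f
  exact key m φ f (hm _)

/-- The generators of the Ariki–Koike algebra act by `zeroOp` and the Hecke operators. -/
noncomputable def genOp (r : ℕ) (i : Fin r) : Module.End A ((ℕ → I) → A) :=
  if (i : ℕ) = 0 then zeroOp q col v (r - 1) else hecke q (i - 1)

theorem genOp_rel (hcol : Monotone col) {m : ℕ} (hm : ∀ x, col x < m) (r : ℕ)
    {x y : FreeAlgebra A (Fin r)} (h : Rel r q (fun k : Fin m => v k) x y) :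
    FreeAlgebra.lift A (genOp q col v r) x = FreeAlgebra.lift A (genOp q col v r) y := by
  cases h with
  | braid_zero h =>
    obtain ⟨n, rfl⟩ : ∃ n, r = n + 2 := ⟨r - 2, by omega⟩
    simpa [genOp] using zeroOp_braid q col v hcol n
  | braid i hi h =>
    obtain ⟨i, rfl⟩ : ∃ j, i = j + 1 := ⟨i - 1, by omega⟩
    simpa [genOp] using hecke_braid q i
  | comm i j h =>
    have hj : (j : ℕ) ≠ 0 := by omega
    simp only [map_mul, FreeAlgebra.lift_ι_apply, genOp, if_neg hj]
    split_ifs with hi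
    · obtain ⟨k, hk⟩ : ∃ k, (j : ℕ) - 1 = k + 1 := ⟨j - 2, by omega⟩
      rw [hk]
      exact (zeroOp_comm_hecke q col v hcol (by omega)).eq
    · exact (hecke_comm q (by omega)).eq
  | quadratic i hi =>
    simp only [map_mul, map_sub, map_add, FreeAlgebra.lift_ι_apply, genOp, if_neg hi,
      AlgHom.commutes, map_one, map_zero]
    rw [sub_mul, mul_add, hecke_sq, ← Algebra.smul_def, mul_one]
    module
  | cyclotomic h =>
    rw [map_zero, ← zeroOp_cyclotomic q col v hcol hm (r - 1), ← Fin.prod_univ_eq_prod_range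
      (fun k => Polynomial.X - Polynomial.C (v k)), ← List.prod_ofFn, map_list_prod, map_list_prod,
      List.map_ofFn, List.map_ofFn]
    congr 2
    funext k
    simp [genOp]

/-- The Ariki–Koike algebra acts on functions of words. -/
noncomputable def wordRep (hcol : Monotone col) {m : ℕ} (hm : ∀ x, col x < m) (r : ℕ) :
    ArikiKoike r q (fun k : Fin m => v k) →ₐ[A] Module.End A ((ℕ → I) → A) :=
  RingQuot.liftAlgHom A ⟨FreeAlgebra.lift A (genOp q col v r),
    fun _ _ h => genOp_rel q col v hcol hm r h⟩

theorem wordRep_T (hcol : Monotone col) {m : ℕ} (hm : ∀ x, col x < m) {r i : ℕ} (hi : i < r) :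
    wordRep q col v hcol hm r (T r q (fun k : Fin m => v k) i) = genOp q col v r ⟨i, hi⟩ := by
  rw [T_of_lt _ _ hi, wordRep, mk]
  erw [RingQuot.liftAlgHom_mkAlgHom_apply]
  rw [FreeAlgebra.lift_ι_apply]

end Representation

/-! ### Specialisation at `q = 1` -/

section Specialisation

variable {A B : Type*} [CommRing A] [CommRing B] (η : A →+* B) {I : Type*}

/-- The operator `a` specialises along `η` to the operator that substitutes `σ` into a word and
multiplies by the scalar `c`. -/
def SpecialisesTo (a : Module.End A ((ℕ → I) → A)) (c : (ℕ → I) → B) (σ : ℕ → ℕ) : Prop :=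
  ∀ φ f, η (a φ f) = c f * η (φ (f ∘ σ))

variable {η}

theorem SpecialisesTo.mul {a a' : Module.End A ((ℕ → I) → A)} {c c' : (ℕ → I) → B}
    {σ σ' : ℕ → ℕ} (h : SpecialisesTo η a c σ) (h' : SpecialisesTo η a' c' σ') :
    SpecialisesTo η (a * a') (fun f => c f * c' (f ∘ σ)) (σ ∘ σ') := by
  intro φ f
  rw [Module.End.mul_apply, h, h', mul_assoc]
  rfl

theorem SpecialisesTo.one : SpecialisesTo η (1 : Module.End A ((ℕ → I) → A)) (fun _ => 1) id := by
  intro φ f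
  simp

theorem SpecialisesTo.pow {a : Module.End A ((ℕ → I) → A)} {c : (ℕ → I) → B}
    (h : SpecialisesTo η a c id) (n : ℕ) : SpecialisesTo η (a ^ n) (fun f => c f ^ n) id := by
  induction n with
  | zero => simpa using SpecialisesTo.one
  | succ n ih =>
    simp only [pow_succ]
    exact ih.mul h

theorem swapOp_specialisesTo [LinearOrder I] {q : Aˣ} (hq : η q = 1) (col : I → ℕ) (i : ℕ) :
    SpecialisesTo η (swapOp q col i) (fun _ => 1) (Equiv.swap i (i + 1)) := by
  intro φ f
  rw [swapOp_apply, one_mul]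
  by_cases h : f i = f (i + 1)
  · have : f ∘ Equiv.swap i (i + 1) = f := by
      funext n
      simp only [Function.comp_apply, Equiv.swap_apply_def]
      split_ifs <;> simp_all
    simp [diagCoeff, swapCoeff, h, this, hq]
  · by_cases h' : f i < f (i + 1) <;> simp [diagCoeff, swapCoeff, h, h', hq, apply_ite η]

theorem heckeInv_specialisesTo [LinearOrder I] {q : Aˣ} (hq : η q = 1) (i : ℕ) :
    SpecialisesTo (I := I) η (heckeInv q i) (fun _ => 1) (Equiv.swap i (i + 1)) := by
  intro φ f
  have h1 : η ((q⁻¹ : Aˣ) : A) = 1 := by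
    have := congrArg η (Units.inv_mul q)
    rwa [map_mul, hq, mul_one, map_one] at this
  have h2 := swapOp_specialisesTo hq (fun _ : I => 0) i φ f
  rw [heckeInv, LinearMap.smul_apply, LinearMap.sub_apply, Pi.smul_apply, Pi.sub_apply, smul_eq_mul,
    map_mul, map_sub, h1, hecke, h2]
  simp [hq]

theorem colourOp_specialisesTo (col : I → ℕ) (v : ℕ → A) :
    SpecialisesTo η (colourOp col v) (fun f => η (v (col (f 0)))) id := by
  intro φ f
  simp [colourOp_apply]

/-- For `q = 1` the flips and the inverse Hecke operators in `zeroOp` cancel. -/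
theorem zeroOp_specialisesTo [LinearOrder I] {q : Aˣ} (hq : η q = 1) (col : I → ℕ) (v : ℕ → A)
    (n : ℕ) : SpecialisesTo η (zeroOp q col v n) (fun f => η (v (col (f 0)))) id := by
  have key : ∀ k,
      SpecialisesTo (I := I) η (flipProd q col k n * invProd q k n) (fun _ => 1) id := by
    induction n with
    | zero => intro k; simpa [flipProd, invProd] using SpecialisesTo.one
    | succ n ih =>
      intro k
      have := ((swapOp_specialisesTo hq col k).mul (ih (k + 1))).mul
        (heckeInv_specialisesTo (I := I) hq k)
      rw [flipProd_succ', invProd_succ', ← mul_assoc, mul_assoc (swapOp q col k)]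
      have hs : (⇑(Equiv.swap k (k + 1)) ∘ id) ∘ ⇑(Equiv.swap k (k + 1)) = id := by
        funext n
        simp
      simpa only [mul_one, hs] using this
  have := (colourOp_specialisesTo (η := η) col v).mul (key 0)
  rw [zeroOp, mul_assoc]
  simpa only [mul_one, Function.id_comp] using this

/-- A permutation of the first `r` places, extended to all places. -/
def extendPlaces {r : ℕ} (w : Equiv.Perm (Fin r)) (n : ℕ) : ℕ := if h : n < r then w ⟨n, h⟩ else n

theorem extendPlaces_s_mul {r : ℕ} (i : Fin (r - 1)) (w : Equiv.Perm (Fin r)) :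
    extendPlaces (s i * w) = Equiv.swap (i : ℕ) (i + 1) ∘ extendPlaces w := by
  funext n
  simp only [extendPlaces, Function.comp_apply]
  split_ifs with h
  · rw [Equiv.Perm.mul_apply, s_val, Equiv.swap_apply_def]
  · exact (Equiv.swap_apply_of_ne_of_ne (by omega) (by omega)).symm

variable [LinearOrder I] {q : Aˣ} (hq : η q = 1) {col : I → ℕ} {v : ℕ → A} (hcol : Monotone col)
  {m : ℕ} (hm : ∀ x, col x < m) {r : ℕ}

include hq

theorem T_specialisesTo (i : Fin (r - 1)) :
    SpecialisesTo η (wordRep q col v hcol hm r (T r q _ (i + 1))) (fun _ => 1)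
      (Equiv.swap (i : ℕ) (i + 1)) := by
  rw [wordRep_T q col v hcol hm (by omega)]
  exact swapOp_specialisesTo hq _ _

theorem L_specialisesTo {j : ℕ} (hj : j < r) :
    SpecialisesTo η (wordRep q col v hcol hm r (L r q _ (j + 1)))
      (fun f => η (v (col (f j)))) id := by
  induction j with
  | zero =>
    rw [zero_add, L_one, wordRep_T q col v hcol hm hj]
    exact zeroOp_specialisesTo hq col v _
  | succ j ih =>
    have h1 : η ((q⁻¹ : Aˣ) : A) = 1 := by
      have := congrArg η (Units.inv_mul q)
      rwa [map_mul, hq, mul_one, map_one] at this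
    have hT := T_specialisesTo hq hcol hm (v := v) (r := r) ⟨j, by omega⟩
    have := (hT.mul (ih (by omega))).mul hT
    rw [L_succ _ _ (by omega), map_smul, map_mul, map_mul]
    intro φ f
    rw [LinearMap.smul_apply, Pi.smul_apply, smul_eq_mul, map_mul, this φ f, h1, one_mul]
    have hs : (⇑(Equiv.swap j (j + 1)) ∘ id) ∘ ⇑(Equiv.swap j (j + 1)) = id := by
      funext n
      simp
    rw [hs]
    simp

theorem Lmon_specialisesTo (c : Fin r → ℕ) :
    SpecialisesTo η (wordRep q col v hcol hm r (Lmon q _ c))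
      (fun f => ∏ j : Fin r, η (v (col (f j))) ^ c j) id := by
  have key : ∀ t : Finset (Fin r), SpecialisesTo η
      (wordRep q col v hcol hm r (polyL q _ (∏ j ∈ t, MvPolynomial.X j ^ c j)))
      (fun f => ∏ j ∈ t, η (v (col (f j))) ^ c j) id := by
    intro t
    induction t using Finset.induction_on with
    | empty => simpa using SpecialisesTo.one
    | insert j t hj ih =>
      simp only [Finset.prod_insert hj, map_mul, map_pow, polyL_X]
      exact ((L_specialisesTo hq hcol hm j.2).pow (c j)).mul ih
  exact key _

theorem Tperm_specialisesTo (w : Equiv.Perm (Fin r)) :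
    SpecialisesTo η (wordRep q col v hcol hm r (Tperm r q _ w)) (fun _ => 1)
      (extendPlaces w⁻¹) := by
  induction w using descent_induction with
  | one =>
    have : extendPlaces (1 : Equiv.Perm (Fin r))⁻¹ = id := by
      funext n
      simp [extendPlaces]
    rw [this, Tperm_one, map_one]
    exact SpecialisesTo.one
  | step w i h ih =>
    have := (T_specialisesTo hq hcol hm (v := v) i).mul ih
    rw [Tperm_of_descent _ _ h, map_mul]
    rw [mul_inv_rev, s_inv, extendPlaces_s_mul] at this
    have hs : (⇑(Equiv.swap (i : ℕ) (i + 1)) ∘ ⇑(Equiv.swap (i : ℕ) (i + 1)) ∘ extendPlaces w⁻¹) =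
        extendPlaces w⁻¹ := by
      funext n
      simp
    simpa only [mul_one, hs] using this

end Specialisation

/-! ### The basis `L^c T_w` -/

open MvPolynomial in
/-- A polynomial of degree less than `m` in every variable is determined by its values on an
`r`-dimensional grid of side `m`. -/
theorem eq_zero_of_grid {B : Type*} [CommRing B] [IsDomain B] {m r : ℕ} (hm : 0 < m) (y : Fin m → B)
    (hy : Function.Injective y) (a : (Fin r → Fin m) → B)
    (h : ∀ k : Fin r → Fin m, ∑ c : Fin r → Fin m, a c * ∏ j, y (k j) ^ (c j : ℕ) = 0) :
    a = 0 := by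
  classical
  have hinj : Function.Injective fun c : Fin r → Fin m =>
      Finsupp.equivFunOnFinite.symm fun j => (c j : ℕ) := by
    intro c d hcd
    have := Finsupp.equivFunOnFinite.symm.injective hcd
    funext j
    exact Fin.ext (congrFun this j)
  set P : MvPolynomial (Fin r) B :=
    ∑ c : Fin r → Fin m, monomial (Finsupp.equivFunOnFinite.symm fun j => (c j : ℕ)) (a c) with hP
  have hP0 : P = 0 := by
    refine eq_zero_of_eval_zero_at_prod_finset P (fun _ => Finset.univ.image y) ?_ ?_
    · intro i
      rw [Finset.card_image_of_injective _ hy, Finset.card_univ, Fintype.card_fin]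
      refine (degreeOf_sum_le i _ _).trans_lt ((Finset.sup_lt_iff (by simpa using hm)).mpr ?_)
      intro c _
      refine (Nat.lt_of_le_of_lt ?_ (c i).2)
      refine degreeOf_le_iff.mpr fun d hd => ?_
      have := support_monomial_subset hd
      rw [Finset.mem_singleton] at this
      rw [this]
      simp
    · intro x hx
      choose k hk using fun i => Finset.mem_image.mp (hx i)
      rw [← h k, hP, map_sum]
      refine Finset.sum_congr rfl fun c _ => ?_
      rw [eval_monomial, Finsupp.prod_fintype _ _ (by simp)]
      simp [(hk _).2]
  funext c
  have := congrArg (coeff (Finsupp.equivFunOnFinite.symm fun j => (c j : ℕ))) hP0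
  rw [hP, coeff_sum, Finset.sum_eq_single c, coeff_monomial, if_pos rfl, coeff_zero] at this
  · simpa using this
  · intro d _ hd
    rw [coeff_monomial, if_neg (hinj.ne hd)]
  · simp

/-- If every relation between the `x i` has all its coefficients divisible by `t`, then it is
trivial, because only zero is divisible by all powers of `t`. -/
theorem linearIndependent_of_dvd {A M ι : Type*} [CommRing A] [IsDomain A] [IsNoetherianRing A]
    [AddCommGroup M] [Module A M] [Module.IsTorsionFree A M] [Fintype ι] {x : ι → M} {t : A}
    (ht : ¬ IsUnit t) (ht0 : t ≠ 0)
    (h : ∀ g : ι → A, ∑ i, g i • x i = 0 → ∀ i, t ∣ g i) : LinearIndependent A x := by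
  rw [Fintype.linearIndependent_iff]
  have key : ∀ n, ∀ g : ι → A, ∑ i, g i • x i = 0 → ∀ i, t ^ n ∣ g i := by
    intro n
    induction n with
    | zero => intro g _ i; simp
    | succ n ih =>
      intro g hg i
      choose g' hg' using h g hg
      have : ∑ i, g' i • x i = 0 := by
        have h2 : t • ∑ i, g' i • x i = 0 := by
          rw [← hg, Finset.smul_sum]
          exact Finset.sum_congr rfl fun i _ => by rw [hg' i, smul_smul]
        exact (smul_eq_zero.mp h2).resolve_left ht0
      rw [hg' i, pow_succ']
      exact mul_dvd_mul_left t (ih g' this i)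
  intro g hg i
  have hbot := Ideal.iInf_pow_eq_bot_of_isDomain (Ideal.span {t})
    (by rwa [Ne, Ideal.span_singleton_eq_top])
  rw [← Ideal.mem_bot, ← hbot, Ideal.mem_iInf]
  intro n
  rw [Ideal.span_singleton_pow, Ideal.mem_span_singleton]
  exact key n g hg i

theorem monotone_colour (m : ℕ) : Monotone fun x : Fin m ×ₗ ℕ => ((ofLex x).1 : ℕ) :=
  fun _ _ h => Prod.Lex.monotone_fst _ _ h

/-- Over a Noetherian domain with a non-zero non-unit `t` such that `q = 1` and the parameters are
distinct modulo `t`, the elements `L^c T_w` are linearly independent. -/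
theorem linearIndependent_of_specialisation {A B : Type*} [CommRing A] [IsDomain A]
    [IsNoetherianRing A] [CommRing B] [IsDomain B] (η : A →+* B) {t : A} (ht : ¬ IsUnit t)
    (ht0 : t ≠ 0) (hker : ∀ a, η a = 0 → t ∣ a) {q : Aˣ} (hq : η q = 1) {m r : ℕ} (hm : 0 < m)
    (v : ℕ → A) (hv : Function.Injective fun k : Fin m => η (v k)) :
    LinearIndependent A fun p : (Fin r → Fin m) × Equiv.Perm (Fin r) =>
      Lmon q (fun k : Fin m => v k) (fun j => (p.1 j : ℕ)) * Tperm r q _ p.2 := by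
  classical
  set ρ := wordRep q (fun x : Fin m ×ₗ ℕ => ((ofLex x).1 : ℕ)) v (monotone_colour m)
    (fun x => (ofLex x).1.2) r with hρ
  refine LinearIndependent.of_comp ρ.toLinearMap (linearIndependent_of_dvd ht ht0 fun g hg => ?_)
  suffices h : ∀ w, (fun c : Fin r → Fin m => η (g (c, w))) = 0 from
    fun p => hker _ (congrFun (h p.2) p.1)
  intro w
  refine eq_zero_of_grid hm _ hv _ fun k => ?_
  -- a word with letters of the colours `k`, made distinct by recording the places; testing on the
  -- indicator function of its rearrangement by `w` isolates the terms with `T_w`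
  set f : ℕ → Fin m ×ₗ ℕ := fun n => toLex (if h : n < r then k ⟨n, h⟩ else ⟨0, hm⟩, n) with hf
  have hfinj : Function.Injective f := fun a b hab => congrArg (fun x => (ofLex x).2) hab
  set φ : (ℕ → Fin m ×ₗ ℕ) → A := Pi.single (f ∘ extendPlaces w⁻¹) 1 with hφ
  have h0 := congrArg η (congrFun (LinearMap.congr_fun hg φ) f)
  rw [LinearMap.sum_apply, Finset.sum_apply, map_sum] at h0
  have hterm : ∀ p : (Fin r → Fin m) × Equiv.Perm (Fin r),
      η (((g p • (ρ.toLinearMap ∘ fun p : (Fin r → Fin m) × Equiv.Perm (Fin r) =>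
        Lmon q (fun k : Fin m => v k) (fun j => (p.1 j : ℕ)) * Tperm r q _ p.2) p) φ) f) =
      if p.2 = w then η (g p) * ∏ j, η (v (k j)) ^ (p.1 j : ℕ) else 0 := by
    rintro ⟨c, w'⟩
    have h1 := ((Lmon_specialisesTo hq (monotone_colour m) (v := v) (fun x => (ofLex x).1.2)
      (fun j => (c j : ℕ))).mul (Tperm_specialisesTo hq (monotone_colour m) (v := v)
      (fun x => (ofLex x).1.2) w')) φ f
    rw [← map_mul] at h1
    rw [LinearMap.smul_apply, Pi.smul_apply, smul_eq_mul, map_mul]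
    simp only [Function.comp_apply, AlgHom.toLinearMap_apply]
    rw [h1]
    simp only [mul_one, Function.id_comp]
    have h2 : f ∘ extendPlaces w'⁻¹ = f ∘ extendPlaces w⁻¹ ↔ w' = w := by
      constructor
      · intro h
        rw [← inv_inj]
        ext x
        have := hfinj (congrFun h x)
        simpa [extendPlaces] using this
      · rintro rfl
        rfl
    rw [hφ, Pi.single_apply]
    simp only [h2]
    split_ifs with hw
    · simp [hf]
    · simp
  rw [Finset.sum_congr rfl fun p _ => hterm p, Fintype.sum_prod_type] at h0
  simpa using h0

/-- The ring over which the Ariki–Koike algebra is generic. -/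
abbrev GenericRing (m : ℕ) : Type := LaurentPolynomial (MvPolynomial (Fin m) ℤ)

instance (m : ℕ) : IsNoetherianRing (GenericRing m) :=
  IsLocalization.isNoetherianRing
    (Submonoid.powers (Polynomial.X : Polynomial (MvPolynomial (Fin m) ℤ))) _ inferInstance

/-- The generic value of `q`. -/
noncomputable def genericQ (m : ℕ) : (GenericRing m)ˣ := (LaurentPolynomial.isUnit_T 1).unit

/-- The generic values of the parameters, continued by zero. -/
noncomputable def genericV (m : ℕ) (k : ℕ) : GenericRing m :=
  if h : k < m then LaurentPolynomial.C (MvPolynomial.X ⟨k, h⟩) else 0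

/-- The case of generic parameters, by specialisation at `q = 1`; the kernel is generated
by `q - 1`. -/
theorem linearIndependent_generic {m : ℕ} (hm : 0 < m) (r : ℕ) :
    LinearIndependent (GenericRing m) fun p : (Fin r → Fin m) × Equiv.Perm (Fin r) =>
      Lmon (genericQ m) (fun k : Fin m => genericV m k) (fun j => (p.1 j : ℕ)) *
        Tperm r (genericQ m) _ p.2 := by
  set η : GenericRing m →+* MvPolynomial (Fin m) ℤ :=
    LaurentPolynomial.eval₂ (RingHom.id _) 1 with hη
  have hηT : ∀ n, η (LaurentPolynomial.T n) = 1 := by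
    intro n
    rw [hη, LaurentPolynomial.eval₂_T]
    simp
  have hηp : ∀ p, η (Polynomial.toLaurent p) = p.eval 1 := by
    intro p
    rw [hη, LaurentPolynomial.eval₂_toLaurent]
    rfl
  have hq : η (genericQ m) = 1 := hηT 1
  refine linearIndependent_of_specialisation η
    (t := Polynomial.toLaurent (Polynomial.X - Polynomial.C 1)) ?_ ?_ ?_ hq hm _ ?_
  · intro h
    have := h.map η
    rw [hηp] at this
    simp at this
  · rw [Ne, Polynomial.toLaurent_eq_zero]
    exact Polynomial.X_sub_C_ne_zero 1
  · intro a ha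
    obtain ⟨n, p, hp⟩ := LaurentPolynomial.exists_T_pow a
    have h1 : p.eval 1 = 0 := by rw [← hηp, hp, map_mul, ha, zero_mul]
    have h2 := map_dvd Polynomial.toLaurent (Polynomial.dvd_iff_isRoot.mpr h1)
    rw [hp] at h2
    exact ((LaurentPolynomial.isUnit_T _).dvd_mul_right).mp h2
  · intro k l hkl
    have : ∀ k : Fin m, η (genericV m k) = MvPolynomial.X k := by
      intro k
      rw [genericV, dif_pos k.2, hη, LaurentPolynomial.eval₂_C]
      rfl
    simp only [this] at hkl
    exact MvPolynomial.X_injective hkl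

section BaseChange

open TensorProduct

variable {R : Type*} [CommRing R] {m : ℕ} {r : ℕ} (q : Rˣ) (u : Fin m → R)

/-- The specialisation of the generic parameters to `q` and `u`. -/
noncomputable def genericToRing : GenericRing m →+* R :=
  LaurentPolynomial.eval₂ (MvPolynomial.eval₂Hom (Int.castRingHom R) u) q

theorem genericToRing_q : genericToRing q u (genericQ m) = q := by
  change genericToRing q u (LaurentPolynomial.T 1) = q
  rw [genericToRing, LaurentPolynomial.eval₂_T, zpow_one]

theorem genericToRing_v (k : Fin m) : genericToRing q u (genericV m k) = u k := by
  rw [genericToRing, genericV, dif_pos k.2, LaurentPolynomial.eval₂_C]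
  simp

/-- If the elements `L^c T_w` are linearly independent over `A`, then they remain so after base
change along `θ : A → R`. -/
theorem linearIndependent_baseChange {A : Type*} [CommRing A] (θ : A →+* R) {q₀ : Aˣ}
    {u₀ : Fin m → A} (hq : θ q₀ = q) (hu : ∀ k, θ (u₀ k) = u k) (hm : 0 < m)
    (hA : LinearIndependent A fun p : (Fin r → Fin m) × Equiv.Perm (Fin r) =>
      Lmon q₀ u₀ (fun j => (p.1 j : ℕ)) * Tperm r q₀ u₀ p.2) :
    LinearIndependent R fun p : (Fin r → Fin m) × Equiv.Perm (Fin r) =>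
      Lmon q u (fun j => (p.1 j : ℕ)) * Tperm r q u p.2 := by
  let := θ.toAlgebra
  let ι : ArikiKoike r q₀ u₀ →ₐ[A] R ⊗[A] ArikiKoike r q₀ u₀ :=
    Algebra.TensorProduct.includeRight
  have hι : ∀ x, ι x = (1 : R) ⊗ₜ x := fun _ => rfl
  have hsmul : ∀ (a : A) (x : ArikiKoike r q₀ u₀), ι (a • x) = θ a • ι x := by
    intro a x
    rw [map_smul, hι, TensorProduct.smul_tmul', TensorProduct.smul_tmul', smul_eq_mul,
      Algebra.smul_def]
    rfl
  have halg : ∀ a : A, ι (algebraMap _ _ a) = algebraMap R _ (θ a) := by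
    intro a
    rw [Algebra.algebraMap_eq_smul_one, hsmul, map_one, Algebra.algebraMap_eq_smul_one]
  -- `T_i ↦ 1 ⊗ T_i` defines a homomorphism from the algebra over `R`
  let g : Fin r → R ⊗[A] ArikiKoike r q₀ u₀ := fun i => ι (T r _ _ i)
  have hrel : ∀ ⦃x y⦄, Rel r q u x y → FreeAlgebra.lift R g x = FreeAlgebra.lift R g y := by
    intro x y h
    cases h with
    | braid_zero h =>
      simp only [map_mul, FreeAlgebra.lift_ι_apply, g]
      rw [← map_mul, ← map_mul, ← map_mul, T_zero_braid]
      simp only [map_mul]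
    | braid i hi h =>
      simp only [map_mul, FreeAlgebra.lift_ι_apply, g]
      rw [← map_mul, ← map_mul, T_braid _ _ hi]
      simp only [map_mul]
    | comm i j h =>
      simp only [map_mul, FreeAlgebra.lift_ι_apply, g]
      rw [← map_mul, (T_comm _ _ h).eq, map_mul]
    | quadratic i hi =>
      simp only [map_mul, map_sub, map_add, FreeAlgebra.lift_ι_apply, g, AlgHom.commutes, map_one,
        map_zero]
      rw [← hq, ← halg, ← map_one ι, ← map_sub, ← map_add, ← map_mul, sub_mul,
        mul_add, T_sq _ _ (by omega) i.2, ← Algebra.smul_def, mul_one, smul_add, sub_smul, one_smul,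
        ← map_zero ι]
      congr 1
      abel
    | cyclotomic h =>
      rw [map_zero, map_list_prod, List.map_ofFn, ← map_zero ι,
        ← T_zero_cyclotomic q₀ u₀ h, map_list_prod, List.map_ofFn]
      congr 2
      funext k
      simp only [Function.comp_apply, map_sub, FreeAlgebra.lift_ι_apply, g, AlgHom.commutes]
      rw [← hu, ← halg]
      simp
  let β : ArikiKoike r q u →ₐ[R] R ⊗[A] ArikiKoike r q₀ u₀ :=
    RingQuot.liftAlgHom R ⟨FreeAlgebra.lift R g, hrel⟩
  have hT : ∀ i, β (T r q u i) = ι (T r _ _ i) := by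
    intro i
    by_cases hi : i < r
    · rw [T_of_lt _ _ hi]
      change RingQuot.liftAlgHom R _ (RingQuot.mkAlgHom R _ _) = _
      rw [RingQuot.liftAlgHom_mkAlgHom_apply, FreeAlgebra.lift_ι_apply]
    · rw [T_of_le _ _ (not_lt.mp hi), T_of_le _ _ (not_lt.mp hi), map_zero, map_zero]
  have hinv : θ ((q₀⁻¹ : Aˣ) : A) = ((q⁻¹ : Rˣ) : R) := by
    have := congrArg θ (Units.inv_mul q₀)
    rw [map_mul, hq, map_one] at this
    exact (Units.inv_eq_of_mul_eq_one_left this).symm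
  have hL : ∀ i, β (L r q u (i + 1)) = ι (L r _ _ (i + 1)) := by
    intro i
    induction i with
    | zero => exact hT 0
    | succ i ih =>
      rw [L_succ q u (i := i + 1) (by omega), L_succ q₀ u₀ (i := i + 1) (by omega), map_smul,
        hsmul, hinv, map_mul, map_mul, map_mul, map_mul, hT, ih]
  have hLmon : ∀ c : Fin r → ℕ, β (Lmon q u c) = ι (Lmon _ _ c) := by
    intro c
    rw [Lmon, Lmon]
    induction (Finset.univ : Finset (Fin r)) using Finset.induction_on with
    | empty => simp
    | insert j t hj ih =>
      rw [Finset.prod_insert hj, Finset.prod_insert hj, map_mul, map_mul, map_mul, map_mul, ih,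
        map_pow, map_pow, map_pow, map_pow, polyL_X, polyL_X, hL]
  have hTperm : ∀ w, β (Tperm r q u w) = ι (Tperm r _ _ w) := by
    intro w
    induction w using descent_induction with
    | one => simp
    | step w i h ih =>
      rw [Tperm_of_descent _ _ h, Tperm_of_descent _ _ h, map_mul, map_mul, hT, ih]
  let b : Module.Basis ((Fin r → Fin m) × Equiv.Perm (Fin r)) A (ArikiKoike r q₀ u₀) :=
    Module.Basis.mk hA (span_Lmon_mul_Tperm hm).ge
  refine LinearIndependent.of_comp β.toLinearMap ?_
  have hb := (b.baseChange R).linearIndependent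
  rwa [show ⇑(b.baseChange R) = β.toLinearMap ∘ fun p : (Fin r → Fin m) × Equiv.Perm (Fin r) =>
      Lmon q u (fun j => (p.1 j : ℕ)) * Tperm r q u p.2 by
    funext p
    rw [Module.Basis.baseChange_apply, Module.Basis.mk_apply, ← hι, map_mul, ← hLmon, ← hTperm,
      ← map_mul]
    rfl] at hb

/-- The elements `L^c T_w`, with `0 ≤ c_j < m`, are linearly independent. -/
theorem linearIndependent_Lmon_mul_Tperm (hm : 0 < m) :
    LinearIndependent R fun p : (Fin r → Fin m) × Equiv.Perm (Fin r) =>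
      Lmon q u (fun j => (p.1 j : ℕ)) * Tperm r q u p.2 :=
  linearIndependent_baseChange q u (genericToRing q u) (genericToRing_q q u) (genericToRing_v q u)
    hm (linearIndependent_generic hm r)

end BaseChange

section RightIdeal

variable {R : Type*} [CommRing R] {m : ℕ} {r : ℕ} (q : Rˣ) (u : Fin m → R)

open MvPolynomial (X C)

/-! ### The elements `π_k(x)` as polynomials in the `L_j` -/

/-- The polynomial `X_j - x`, and `1` if there is no variable `X_j`. -/
noncomputable def linPoly (r : ℕ) (j : ℕ) (x : R) : MvPolynomial (Fin r) R :=
  if h : j < r then X ⟨j, h⟩ - C x else 1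

/-- The polynomial `∏_{j < k} (X_j - x)`, whose value at the `L_j` is `π_k(x)`. -/
noncomputable def piPoly (r : ℕ) (k : ℕ) (x : R) : MvPolynomial (Fin r) R :=
  ∏ j ∈ Finset.range k, linPoly r j x

theorem polyL_linPoly {j : ℕ} (h : j < r) (x : R) :
    polyL q u (linPoly r j x) = L r q u (j + 1) - algebraMap R _ x := by
  rw [linPoly, dif_pos h, map_sub, polyL_X, ← MvPolynomial.algebraMap_eq, AlgHom.commutes]

theorem piElem_eq {k : ℕ} (h : k ≤ r) (x : R) : piElem r q u k x = polyL q u (piPoly r k x) := by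
  induction k with
  | zero => simp [piElem, piPoly]
  | succ k ih =>
    rw [piPoly, Finset.prod_range_succ, map_mul, polyL_linPoly q u h, ← piPoly, ← ih (by omega),
      piElem, piElem, List.range_succ, List.map_append, List.prod_append]
    simp

theorem piPoly_dvd {k l : ℕ} (h : k ≤ l) (x : R) : piPoly r k x ∣ piPoly r l x :=
  Finset.prod_dvd_prod_of_subset _ _ _ (Finset.range_mono h)

/-- The polynomials whose value at the `L_j` commutes with `T_i`. -/
noncomputable def commPoly (i : ℕ) : Subalgebra R (MvPolynomial (Fin r) R) :=
  (Subalgebra.centralizer R {T r q u i}).comap (polyL q u)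

variable {q u}

theorem mem_commPoly {i : ℕ} {p : MvPolynomial (Fin r) R} :
    p ∈ commPoly q u i ↔ Commute (T r q u i) (polyL q u p) := by
  simp [commPoly, Subalgebra.mem_centralizer_iff, commute_iff_eq]

theorem linPoly_mem_commPoly {i j : ℕ} (hi : 1 ≤ i) (h1 : j + 1 ≠ i) (h2 : j ≠ i) (x : R) :
    linPoly r j x ∈ commPoly q u i := by
  by_cases h : j < r
  · rw [mem_commPoly, polyL_linPoly q u h]
    exact (T_comm_L q u hi h1 (by omega)).sub_right (Algebra.commutes x _).symm
  · rw [linPoly, dif_neg h]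
    exact one_mem _

/-- `T_i` commutes with `π_k(x)` unless `i = k`. -/
theorem piPoly_mem_commPoly {i k : ℕ} (hi : 1 ≤ i) (hir : i < r) (h : i ≠ k) (x : R) :
    piPoly r k x ∈ commPoly q u i := by
  rcases lt_or_gt_of_ne h with h | h
  · obtain ⟨l, rfl⟩ : ∃ l, k = i + 1 + l := ⟨k - (i + 1), by omega⟩
    induction l with
    | zero =>
      obtain ⟨i, rfl⟩ : ∃ j, i = j + 1 := ⟨i - 1, by omega⟩
      rw [add_zero, piPoly, Finset.prod_range_succ, Finset.prod_range_succ, mul_assoc]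
      refine mul_mem (Subalgebra.prod_mem _ fun j hj => ?_) ?_
      · rw [Finset.mem_range] at hj
        exact linPoly_mem_commPoly hi (by omega) (by omega) x
      · -- the two factors moved by `T_{i+1}` form a polynomial symmetric in them
        rw [mem_commPoly, map_mul, polyL_linPoly q u hir, polyL_linPoly q u (by omega)]
        have h1 := T_mul_L_self q u hi hir
        have h2 := T_mul_L_succ q u hi hir
        have h3 := T_comm_L_mul_L q u hi hir
        have h4 : Commute (T r q u (i + 1)) (L r q u (i + 1) + L r q u (i + 1 + 1)) := by
          rw [commute_iff_eq, mul_add, h1, h2, add_mul, mul_sub, mul_smul_comm, mul_one]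
          abel
        have e : (L r q u (i + 1) - algebraMap R _ x) * (L r q u (i + 1 + 1) - algebraMap R _ x) =
            L r q u (i + 1) * L r q u (i + 1 + 1) -
              algebraMap R _ x * (L r q u (i + 1) + L r q u (i + 1 + 1)) +
              algebraMap R _ x * algebraMap R _ x := by
          rw [sub_mul, mul_sub, mul_sub, ← Algebra.commutes x (L r q u (i + 1)), mul_add]
          abel
        have hx : Commute (T r q u (i + 1)) (algebraMap R _ x) := (Algebra.commutes x _).symm
        rw [e]
        exact (h3.sub_right (hx.mul_right h4)).add_right (hx.mul_right hx)
    | succ l ih =>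
      rw [← add_assoc, piPoly, Finset.prod_range_succ]
      exact mul_mem (ih (by omega) (by omega)) (linPoly_mem_commPoly hi (by omega) (by omega) x)
  · refine Subalgebra.prod_mem _ fun j hj => ?_
    rw [Finset.mem_range] at hj
    exact linPoly_mem_commPoly hi (by omega) (by omega) x

/-! ### The vanishing of `π T_w π̃` -/

/-- If `w` fixes the first point, then `T_w` commutes with `L_1`. -/
theorem Tperm_comm_L_one (hr : 0 < r) {w : Equiv.Perm (Fin r)} (hw : w ⟨0, hr⟩ = ⟨0, hr⟩) :
    Commute (Tperm r q u w) (L r q u 1) := by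
  induction w using descent_induction with
  | one => rw [Tperm_one]; exact Commute.one_left _
  | step w i h ih =>
    have hi : (i : ℕ) ≠ 0 := by
      intro hi
      have : lo i = ⟨0, hr⟩ := Fin.ext hi
      rw [this, hw, Fin.lt_def] at h
      exact absurd h (Nat.not_lt_zero _)
    rw [Tperm_of_descent q u h]
    refine Commute.mul_left ?_ (ih ?_)
    · exact (T_comm q u (by omega : 0 + 2 ≤ (i : ℕ) + 1)).symm
    · rw [Equiv.Perm.mul_apply, s_of_ne (by simp [Fin.ext_iff]; omega) (by simp [Fin.ext_iff]), hw]

theorem polyL_cyclotomic (hr : 0 < r) :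
    polyL q u (∏ l : Fin m, linPoly r 0 (u l)) = 0 := by
  rw [← T_zero_cyclotomic q u hr, ← List.prod_ofFn, map_list_prod, List.map_ofFn]
  congr 2
  funext l
  exact polyL_linPoly q u hr _

/-- Let `c + d > r` and distribute the factors of the cyclotomic polynomial to two polynomials `g`
and `h`. Then `g(L_1) ⋯ g(L_c) T_w h(L_1) ⋯ h(L_d) = 0` for all `w`. Splitting off descents of `w`
among the first `c` points and of `w⁻¹` among the first `d` points reduces the claim to the case
where `w` fixes the first point, and there it is the cyclotomic relation. -/
theorem polyL_mul_Tperm_mul_polyL {c d : ℕ} (hc : c ≤ r) (hd : d ≤ r) (hcd : r < c + d)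
    (S : Finset (Fin m)) (w : Equiv.Perm (Fin r)) :
    polyL q u (∏ l ∈ S, piPoly r c (u l)) * Tperm r q u w *
      polyL q u (∏ l ∈ Sᶜ, piPoly r d (u l)) = 0 := by
  have hr : 0 < r := by omega
  induction hn : inv w using Nat.strong_induction_on generalizing w with
  | _ n ih =>
    by_cases h1 : ∃ i : Fin (r - 1), (i : ℕ) + 1 < c ∧ w (hi i) < w (lo i)
    · obtain ⟨i, his, hi⟩ := h1
      have hT : ∏ l ∈ S, piPoly r c (u l) ∈ commPoly q u (i + 1) :=
        Subalgebra.prod_mem _ fun l _ => piPoly_mem_commPoly (by omega) (by omega) (by omega) _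
      have hlt := inv_mul_s_of_gt hi
      rw [Tperm_of_descent q u hi, ← mul_assoc, ← (mem_commPoly.mp hT).eq, mul_assoc, mul_assoc,
        ← mul_assoc (polyL q u _), ih _ (by omega) _ rfl, mul_zero]
    by_cases h2 : ∃ j : Fin (r - 1), (j : ℕ) + 1 < d ∧ w⁻¹ (hi j) < w⁻¹ (lo j)
    · obtain ⟨j, hjt, hj⟩ := h2
      have hT : ∏ l ∈ Sᶜ, piPoly r d (u l) ∈ commPoly q u (j + 1) :=
        Subalgebra.prod_mem _ fun l _ => piPoly_mem_commPoly (by omega) (by omega) (by omega) _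
      have hj' : (s j * w)⁻¹ (lo j) < (s j * w)⁻¹ (hi j) := by
        simpa [mul_inv_rev, s_inv] using hj
      have e : s j * (s j * w) = w := by rw [← mul_assoc, s_mul_s, one_mul]
      have hlt := inv_s_mul_of_lt hj'
      rw [e] at hlt
      rw [← e, ← Tperm_mul_T q u hj', mul_assoc, mul_assoc, (mem_commPoly.mp hT).eq, ← mul_assoc,
        ← mul_assoc, ih _ (by omega) _ rfl, zero_mul]
    push Not at h1 h2
    -- now `w` increases on the first `c` points, and `w⁻¹` on the first `d` points
    have mono : ∀ x : ℕ, ∀ hx : x < r, x < c → w ⟨0, hr⟩ ≤ w ⟨x, hx⟩ := by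
      intro x
      induction x with
      | zero => exact fun _ _ => le_rfl
      | succ x ihx => exact fun hx hxs => (ihx (by omega) (by omega)).trans (h1 ⟨x, by omega⟩ hxs)
    have mono' : ∀ x : ℕ, ∀ hx : x < r, x < d → w⁻¹ ⟨0, hr⟩ ≤ w⁻¹ ⟨x, hx⟩ := by
      intro x
      induction x with
      | zero => exact fun _ _ => le_rfl
      | succ x ihx => exact fun hx hxs => (ihx (by omega) (by omega)).trans (h2 ⟨x, by omega⟩ hxs)
    -- by counting, some point below `c` is sent below `d`
    obtain ⟨x, hxs, hxt⟩ : ∃ x : Fin r, (x : ℕ) < c ∧ (w x : ℕ) < d := by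
      by_contra! hcon
      have hle : (Finset.univ.filter fun x : Fin r => (x : ℕ) < c).card ≤
          (Finset.univ.filter fun x : Fin r => ¬ (x : ℕ) < d).card :=
        Finset.card_le_card_of_injOn w (fun x hx => by simpa using hcon x (by simpa using hx))
          w.injective.injOn
      have e1 : (Finset.univ.filter fun x : Fin r => (x : ℕ) < c).card = c := by
        rw [Fin.card_filter_val_lt, min_eq_right hc]
      have e2 := Finset.card_filter_add_card_filter_not (s := (Finset.univ : Finset (Fin r)))
        (fun x : Fin r => (x : ℕ) < d)
      rw [Fin.card_filter_val_lt, min_eq_right hd, Finset.card_univ, Fintype.card_fin] at e2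
      omega
    have h0t : (w ⟨0, hr⟩ : ℕ) < d := (Fin.le_def.mp (mono x x.2 hxs)).trans_lt hxt
    have h0 : w⁻¹ ⟨0, hr⟩ = ⟨0, hr⟩ := by
      have := mono' _ (w ⟨0, hr⟩).2 h0t
      exact Fin.ext (Nat.le_zero.mp (by simpa [Fin.le_def] using this))
    have hw : w ⟨0, hr⟩ = ⟨0, hr⟩ := by
      conv_lhs => rw [← h0]
      simp
    have hcomm : Commute (Tperm r q u w) (polyL q u (∏ l ∈ Sᶜ, linPoly r 0 (u l))) := by
      have : ∏ l ∈ Sᶜ, linPoly r 0 (u l) ∈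
          (Subalgebra.centralizer R {Tperm r q u w}).comap (polyL q u) := by
        refine Subalgebra.prod_mem _ fun l _ => ?_
        rw [Subalgebra.mem_comap, polyL_linPoly q u hr, Subalgebra.mem_centralizer_iff]
        rintro _ rfl
        exact ((Tperm_comm_L_one hr hw).sub_right (Algebra.commutes _ _).symm).eq
      exact this _ rfl
    have split : ∀ (k : ℕ), 0 < k → ∀ S' : Finset (Fin m), ∏ l ∈ S', piPoly r k (u l) =
        (∏ l ∈ S', ∏ j ∈ Finset.Ico 1 k, linPoly r j (u l)) * ∏ l ∈ S', linPoly r 0 (u l) := by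
      intro k hk S'
      rw [← Finset.prod_mul_distrib]
      refine Finset.prod_congr rfl fun l _ => ?_
      rw [piPoly, Finset.range_eq_Ico, Finset.prod_eq_prod_Ico_succ_bot hk, mul_comm]
    rw [split c (by omega), split d (by omega), mul_comm (∏ l ∈ Sᶜ, _), map_mul, map_mul]
    calc _ = polyL q u (∏ l ∈ S, ∏ j ∈ Finset.Ico 1 c, linPoly r j (u l)) *
          (polyL q u (∏ l ∈ S, linPoly r 0 (u l)) *
            (Tperm r q u w * polyL q u (∏ l ∈ Sᶜ, linPoly r 0 (u l)))) *
          polyL q u (∏ l ∈ Sᶜ, ∏ j ∈ Finset.Ico 1 d, linPoly r j (u l)) := by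
            simp only [mul_assoc]
      _ = 0 := by
        rw [hcomm.eq, ← mul_assoc (polyL q u (∏ l ∈ S, linPoly r 0 (u l))), ← map_mul,
          Finset.prod_mul_prod_compl, polyL_cyclotomic hr]
        simp

/-! ### The right ideal `v_a H` is spanned by the `v_a T_w` -/

variable (q u)

/-- The polynomial whose value at the `L_j` is `π_a`. The factor for `l = 0` is `1`, as
`a_0 = 0`. -/
noncomputable def chainPoly (a : Chain m r) : MvPolynomial (Fin r) R :=
  ∏ l : Fin m, piPoly r (a.val l.castSucc) (u l)

/-- The polynomial whose value at the `L_j` is `π̃_{a'}`. The factor for `l = m - 1` is `1`, as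
`a_m = r`. -/
noncomputable def dualPoly (a : Chain m r) : MvPolynomial (Fin r) R :=
  ∏ l : Fin m, piPoly r (r - a.val l.succ) (u l)

theorem piSeq_eq (a : Chain m r) (x : Fin (m - 1) → R) : piSeq q u a x =
    polyL q u (∏ i : Fin (m - 1), piPoly r (a.val ⟨i + 1, by omega⟩) (x i)) := by
  rw [piSeq, ← List.prod_ofFn, map_list_prod, List.map_ofFn]
  congr 2
  funext i
  exact piElem_eq q u (a.val_le _) _

theorem piChain_eq (hm : 0 < m) (a : Chain m r) :
    piChain q u a = polyL q u (chainPoly u a) := by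
  obtain ⟨n, rfl⟩ : ∃ n, m = n + 1 := ⟨m - 1, by omega⟩
  rw [piChain, piSeq_eq, chainPoly, Fin.prod_univ_succ, Fin.castSucc_zero, a.zero_eq]
  simp only [piPoly, Finset.range_zero, Finset.prod_empty, one_mul]
  rfl

theorem piTilde_eq (hm : 0 < m) (a : Chain m r) :
    piTilde q u a.dual = polyL q u (dualPoly u a) := by
  obtain ⟨n, rfl⟩ : ∃ n, m = n + 1 := ⟨m - 1, by omega⟩
  rw [piTilde, piSeq_eq, dualPoly, Fin.prod_univ_castSucc, Fin.succ_last, a.last_eq, Nat.sub_self]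
  simp only [piPoly, Finset.range_zero, Finset.prod_empty, mul_one]
  congr 1
  refine Fintype.prod_equiv Fin.revPerm _ _ fun i => ?_
  have h1 : (⟨i + 1, by omega⟩ : Fin (n + 1 + 1)).rev = (Fin.rev i).castSucc.succ := by
    ext
    simp only [Fin.val_rev, Fin.val_succ, Fin.val_castSucc]
    omega
  have h2 : (⟨n + 1 - 2 - i, by omega⟩ : Fin (n + 1)) = (Fin.rev i).castSucc := by
    ext
    simp only [Fin.val_rev, Fin.val_castSucc]
    omega
  simp only [Chain.dual, h1, h2, Fin.revPerm_apply]

theorem v_eq (hm : 0 < m) (a : Chain m r) : v q u a =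
    polyL q u (chainPoly u a) * Tperm r q u a.w * polyL q u (dualPoly u a) := by
  rw [v, piChain_eq q u hm, piTilde_eq q u hm]

variable {q u}

/-- On the first point of the block of `a'` that corresponds to the block `k` of `a`, right
multiplication of `v_a` by `L_j` is multiplication by `u_k`. -/
theorem v_mul_L_of_first (hm : 0 < m) (a : Chain m r) (k : Fin m)
    (hk : a.val k.castSucc < a.val k.succ) :
    v q u a * L r q u (r - a.val k.succ + 1) = u k • v q u a := by
  have hle := a.val_le k.succ
  set y := r - a.val k.succ with hy
  have hyr : y < r := by omega
  -- the new factor increases `a'` at one place, whence the product vanishes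
  have h0 : v q u a * (L r q u (y + 1) - algebraMap R _ (u k)) = 0 := by
    have hleft : ∏ l ∈ Finset.univ.filter (k < ·), piPoly r (a.val k.succ) (u l) ∣
        chainPoly u a := by
      rw [Finset.prod_filter, chainPoly]
      refine Finset.prod_dvd_prod_of_dvd _ _ fun l _ => ?_
      split_ifs with h
      · exact piPoly_dvd (a.val_succ_le h) _
      · exact one_dvd _
    have hright : ∏ l ∈ (Finset.univ.filter (k < ·))ᶜ, piPoly r (y + 1) (u l) ∣
        dualPoly u a * linPoly r y (u k) := by
      have e : linPoly r y (u k) = ∏ l : Fin m, if l = k then linPoly r y (u l) else 1 := by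
        rw [Finset.prod_ite_eq', if_pos (Finset.mem_univ k)]
      rw [Finset.compl_filter, Finset.prod_filter, dualPoly, e, ← Finset.prod_mul_distrib]
      refine Finset.prod_dvd_prod_of_dvd _ _ fun l _ => ?_
      rcases lt_trichotomy l k with h | rfl | h
      · have := a.val_succ_le h
        rw [if_pos (not_lt.mpr h.le)]
        exact (piPoly_dvd (by omega) _).mul_right _
      · rw [if_pos (lt_irrefl _), if_pos rfl, piPoly, Finset.prod_range_succ]
        exact dvd_rfl
      · rw [if_neg (not_not.mpr h)]
        exact one_dvd _
    obtain ⟨p, hp⟩ := hleft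
    obtain ⟨p', hp'⟩ := hright
    rw [v_eq q u hm, ← polyL_linPoly q u hyr, mul_assoc, ← map_mul, hp, hp', mul_comm _ p, map_mul,
      map_mul]
    calc _ = polyL q u p * (polyL q u (∏ l ∈ Finset.univ.filter (k < ·),
          piPoly r (a.val k.succ) (u l)) * Tperm r q u a.w *
          polyL q u (∏ l ∈ (Finset.univ.filter (k < ·))ᶜ, piPoly r (y + 1) (u l))) *
          polyL q u p' := by simp only [mul_assoc]
      _ = 0 := by
        rw [polyL_mul_Tperm_mul_polyL hle (by omega) (by omega), mul_zero, zero_mul]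
  rw [mul_sub, sub_eq_zero] at h0
  rw [h0, Algebra.smul_def, Algebra.commutes]

/-- Inside a block, `v_a` intertwines the generators: `T_i` commutes with `π_a`, `T_j` commutes with
`π̃_{a'}`, and `T_i T_{w_a} = T_{w_a} T_j`, as `w_a` is a translation on the block. -/
theorem v_mul_T (hm : 0 < m) (a : Chain m r) (k : Fin m) (n : ℕ)
    (hn : a.val k.castSucc + n + 1 < a.val k.succ) :
    v q u a * T r q u (r - a.val k.succ + n + 1) =
      T r q u (a.val k.castSucc + n + 1) * v q u a := by
  have hle := a.val_le k.succ
  set i : Fin (r - 1) := ⟨a.val k.castSucc + n, by omega⟩ with hi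
  set j : Fin (r - 1) := ⟨r - a.val k.succ + n, by omega⟩ with hj
  have hleft : chainPoly u a ∈ commPoly q u (a.val k.castSucc + n + 1) := by
    refine Subalgebra.prod_mem _ fun l _ => piPoly_mem_commPoly (by omega) (by omega) ?_ _
    rcases lt_trichotomy l k with h | rfl | h
    · have := a.mono (Fin.castSucc_le_castSucc_iff.mpr h.le)
      omega
    · omega
    · have := a.val_succ_le h
      omega
  have hright : dualPoly u a ∈ commPoly q u (r - a.val k.succ + n + 1) := by
    refine Subalgebra.prod_mem _ fun l _ => piPoly_mem_commPoly (by omega) (by omega) ?_ _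
    rcases lt_trichotomy l k with h | rfl | h
    · have := a.val_succ_le h
      omega
    · omega
    · have := a.mono (Fin.succ_le_succ_iff.mpr h.le)
      omega
  have hlo : a.w (lo i) = lo j := by
    ext
    rw [a.w_apply k _ (by simp [hi]) (by simp only [hi]; omega)]
    simp [hi, hj]
  have hhi : a.w (_root_.ArikiKoike.hi i) = _root_.ArikiKoike.hi j := by
    ext
    rw [a.w_apply k _ (by simp only [hi]; omega) (by simp only [hi]; omega)]
    simp only [hi, hj]
    omega
  have hmid : Tperm r q u a.w * T r q u (r - a.val k.succ + n + 1) =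
      T r q u (a.val k.castSucc + n + 1) * Tperm r q u a.w := by
    have h1 := T_mul_Tperm q u (w := a.w) (i := i) (by rw [hlo, hhi]; exact lo_lt_hi j)
    have h2 := Tperm_mul_T q u (w := a.w) (j := j)
      (by rw [← hlo, ← hhi]; simp)
    have h3 : a.w * s i = s j * a.w := by
      change a.w * Equiv.swap (lo i) (_root_.ArikiKoike.hi i) = _
      rw [Equiv.mul_swap_eq_swap_mul, hlo, hhi]
      rfl
    rw [h3, ← h2] at h1
    exact h1.symm
  rw [v_eq q u hm, mul_assoc, ← (mem_commPoly.mp hright).eq, ← mul_assoc,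
    mul_assoc _ (Tperm _ _ _ _), hmid, ← mul_assoc, ← (mem_commPoly.mp hleft).eq]
  simp only [mul_assoc]

/-- By induction on the place of `y` in its block of `a'`, using `L_{j+1} = q⁻¹ T_j L_j T_j`. -/
theorem v_mul_L_mem (hm : 0 < m) (a : Chain m r) (y : Fin r) :
    ∃ h ∈ finHecke r q u, v q u a * L r q u (y + 1) = v q u a * h := by
  have key : ∀ (k : Fin m) (n : ℕ), a.val k.castSucc + n < a.val k.succ →
      ∃ h ∈ finHecke r q u, v q u a * L r q u (r - a.val k.succ + n + 1) = v q u a * h := by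
    intro k n
    induction n with
    | zero =>
      intro hk
      refine ⟨algebraMap R _ (u k), Subalgebra.algebraMap_mem _ _, ?_⟩
      rw [add_zero, v_mul_L_of_first hm a k hk, Algebra.smul_def, Algebra.commutes]
    | succ n ih =>
      intro hk
      obtain ⟨h, hh, e⟩ := ih (by omega)
      have hT := T_mem_finHecke (r := r) q u (i := r - a.val k.succ + n + 1) (by omega)
      refine ⟨((q⁻¹ : Rˣ) : R) • (T r q u (r - a.val k.succ + n + 1) * h *
        T r q u (r - a.val k.succ + n + 1)),
        Subalgebra.smul_mem _ (mul_mem (mul_mem hT hh) hT) _, ?_⟩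
      rw [← add_assoc, L_succ q u (by omega), mul_smul_comm, mul_smul_comm]
      congr 1
      calc _ = (v q u a * T r q u (r - a.val k.succ + n + 1)) *
            L r q u (r - a.val k.succ + n + 1) * T r q u (r - a.val k.succ + n + 1) := by
              simp only [mul_assoc]
        _ = T r q u (a.val k.castSucc + n + 1) * (v q u a * L r q u (r - a.val k.succ + n + 1)) *
            T r q u (r - a.val k.succ + n + 1) := by
              rw [v_mul_T hm a k n (by omega)]; simp only [mul_assoc]
        _ = (T r q u (a.val k.castSucc + n + 1) * v q u a) * h *
            T r q u (r - a.val k.succ + n + 1) := by rw [e]; simp only [mul_assoc]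
        _ = _ := by rw [← v_mul_T hm a k n (by omega)]; simp only [mul_assoc]
  obtain ⟨x, rfl⟩ := a.w.surjective y
  obtain ⟨h1, h2⟩ := a.block_spec x
  have := key (a.block x) (x - a.val (a.block x).castSucc) (by omega)
  rwa [← a.w_apply _ x h1 h2] at this

/-- The right ideal generated by `v_a` is `v_a` times the subalgebra generated by
`T_1, …, T_{r-1}`: the latter product is stable under right multiplication by `T_0 = L_1`, since
`h L_1`, for `h` in the subalgebra, is a combination of terms `L_j h'`. -/
theorem rightIdeal_v_eq_map (hm : 0 < m) (a : Chain m r) : rightIdeal q u (v q u a) =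
    (finHecke r q u).toSubmodule.map (LinearMap.mulLeft R (v q u a)) := by
  set N := (finHecke r q u).toSubmodule.map (LinearMap.mulLeft R (v q u a)) with hN
  have hmem : ∀ h ∈ finHecke r q u, v q u a * h ∈ N := fun h hh => ⟨h, hh, rfl⟩
  have hright : ∀ x ∈ N, ∀ h ∈ finHecke r q u, x * h ∈ N := by
    rintro _ ⟨x, hx, rfl⟩ h hh
    rw [LinearMap.mulLeft_apply, mul_assoc]
    exact hmem _ (mul_mem hx hh)
  have hdeg : ∀ h ∈ finHecke r q u, 0 < r → h * L r q u 1 ∈ spanL q u {c | ∑ j, c j = 1} := by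
    intro h hh hr
    have hstep : ∀ x ∈ spanL q u {c : Fin r → ℕ | ∑ j, c j = 1},
        h * x ∈ spanL q u {c | ∑ j, c j = 1} := by
      induction hh using Algebra.adjoin_induction with
      | mem y hy =>
        obtain ⟨i, rfl⟩ := hy
        exact fun x hx => mul_mem_spanL (fun c hc => spanL_mono
          (fun d hd => (sum_eq_of_mem_hull hd).trans hc) (T_mul_Lmon_mem i c)) hx
      | algebraMap b =>
        intro x hx
        rw [← Algebra.smul_def]
        exact Submodule.smul_mem _ _ hx
      | add b c _ _ hb hc => intro x hx; rw [add_mul]; exact add_mem (hb x hx) (hc x hx)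
      | mul b c _ _ hb hc => intro x hx; rw [mul_assoc]; exact hb _ (hc x hx)
    refine hstep _ ?_
    rw [← pow_one (L r q u 1), show L r q u 1 ^ 1 = Lmon q u (Pi.single ⟨0, hr⟩ 1) by
      rw [Lmon_single]]
    exact Lmon_mem (by simp)
  have hL : ∀ x ∈ spanL q u {c : Fin r → ℕ | ∑ j, c j = 1}, v q u a * x ∈ N := by
    intro x hx
    have : spanL q u {c : Fin r → ℕ | ∑ j, c j = 1} ≤ N.comap (LinearMap.mulLeft R (v q u a)) := by
      refine spanL_le fun c hc h hh => ?_
      obtain ⟨j, hj⟩ : ∃ j, c = Pi.single j 1 := by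
        obtain ⟨j, -, hj⟩ : ∃ j ∈ Finset.univ, c j ≠ 0 :=
          Finset.exists_ne_zero_of_sum_ne_zero (by rw [Set.mem_ofPred_eq.mp hc]; exact one_ne_zero)
        have hsum := Set.mem_ofPred_eq.mp hc
        rw [← Finset.add_sum_erase _ _ (Finset.mem_univ j)] at hsum
        have hz : ∑ k ∈ Finset.univ.erase j, c k = 0 := by omega
        rw [Finset.sum_eq_zero_iff] at hz
        refine ⟨j, funext fun k => ?_⟩
        by_cases hk : k = j
        · subst hk
          rw [Pi.single_eq_same]
          omega
        · rw [Pi.single_eq_of_ne hk]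
          exact hz k (Finset.mem_erase.mpr ⟨hk, Finset.mem_univ k⟩)
      obtain ⟨h', hh', e⟩ := v_mul_L_mem (q := q) (u := u) hm a j
      rw [Submodule.mem_comap, LinearMap.mulLeft_apply, hj, Lmon_single, pow_one, ← mul_assoc, e]
      exact hright _ (hmem _ hh') _ hh
    exact this hx
  have hall : ∀ b : FreeAlgebra R (Fin r), ∀ x ∈ N, x * mk r q u b ∈ N := by
    intro b
    induction b using FreeAlgebra.induction with
    | grade0 c =>
      intro x hx
      rw [AlgHom.commutes, ← Algebra.commutes, ← Algebra.smul_def]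
      exact Submodule.smul_mem _ _ hx
    | grade1 i =>
      intro x hx
      rw [← T_of_lt q u i.2]
      obtain h0 | h0 := Nat.eq_zero_or_pos (i : ℕ)
      · obtain ⟨h, hh, rfl⟩ := hx
        rw [h0, LinearMap.mulLeft_apply, mul_assoc]
        exact hL _ (hdeg h hh (by omega))
      · exact hright x hx _ (T_mem_finHecke q u h0)
    | add b c hb hc => intro x hx; rw [map_add, mul_add]; exact add_mem (hb x hx) (hc x hx)
    | mul b c hb hc => intro x hx; rw [map_mul, ← mul_assoc]; exact hc _ (hb x hx)
  apply le_antisymm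
  · rintro _ ⟨x, rfl⟩
    obtain ⟨b, rfl⟩ := RingQuot.mkAlgHom_surjective R (Rel r q u) x
    have := hall b (v q u a) (by simpa using hmem 1 (one_mem _))
    exact this
  · rintro _ ⟨x, -, rfl⟩
    exact ⟨x, rfl⟩

theorem rightIdeal_v_eq_span (hm : 0 < m) (a : Chain m r) : rightIdeal q u (v q u a) =
    Submodule.span R (Set.range fun w => v q u a * Tperm r q u w) := by
  rw [rightIdeal_v_eq_map hm, finHecke_toSubmodule, Submodule.map_span, ← Set.range_comp]
  rfl

/-! ### The leading term of `v_a` -/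

/-- The span of the monomials `L^c` with `c ≤ β` and `c ≠ β`. -/
noncomputable def lowerSpan (q : Rˣ) (u : Fin m → R) (β : Fin r → ℕ) :
    Submodule R (ArikiKoike r q u) := Submodule.span R (Lmon q u '' Set.Iio β)

/-- The value of `p` at the `L_j` is `L^β` up to terms of smaller exponent. -/
def HasTop (q : Rˣ) (u : Fin m → R) (p : MvPolynomial (Fin r) R) (β : Fin r → ℕ) : Prop :=
  polyL q u p - Lmon q u β ∈ lowerSpan q u β

theorem HasTop.one : HasTop q u (1 : MvPolynomial (Fin r) R) 0 := by
  simp [HasTop]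

theorem HasTop.mul {p p' : MvPolynomial (Fin r) R} {β β' : Fin r → ℕ} (h : HasTop q u p β)
    (h' : HasTop q u p' β') : HasTop q u (p * p') (β + β') := by
  have aux : ∀ {γ γ' : Fin r → ℕ} {S S' : Set (Fin r → ℕ)},
      (∀ c ∈ S, ∀ d ∈ S', c + d < γ) → ∀ x ∈ Submodule.span R (Lmon q u '' S),
        ∀ y ∈ Submodule.span R (Lmon q u '' S'), x * y ∈ lowerSpan q u γ := by
    intro γ γ' S S' hS x hx y hy
    have := Submodule.mul_mem_mul hx hy
    rw [Submodule.span_mul_span] at this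
    refine Submodule.span_mono ?_ this
    rintro _ ⟨_, ⟨c, hc, rfl⟩, _, ⟨d, hd, rfl⟩, rfl⟩
    exact ⟨c + d, hS c hc d hd, Lmon_add q u c d⟩
  have e : polyL q u (p * p') - Lmon q u (β + β') =
      (polyL q u p - Lmon q u β) * (polyL q u p' - Lmon q u β') +
      (polyL q u p - Lmon q u β) * Lmon q u β' + Lmon q u β * (polyL q u p' - Lmon q u β') := by
    rw [map_mul, Lmon_add, sub_mul, mul_sub, sub_mul, mul_sub]
    abel
  have hself : ∀ γ : Fin r → ℕ, Lmon q u γ ∈ Submodule.span R (Lmon q u '' {γ}) :=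
    fun γ => Submodule.subset_span ⟨γ, rfl, rfl⟩
  rw [HasTop, e]
  refine add_mem (add_mem ?_ ?_) ?_
  · exact aux (γ' := β) (fun c hc d hd => add_lt_add hc hd) _ h _ h'
  · refine aux (γ' := β) (fun c hc d hd => ?_) _ h _ (hself β')
    rw [Set.mem_singleton_iff.mp hd]
    exact add_lt_add_left hc _
  · refine aux (γ' := β) (fun c hc d hd => ?_) _ (hself β) _ h'
    rw [Set.mem_singleton_iff.mp hc]
    exact add_lt_add_right hd _

theorem HasTop.prod {ι : Type*} (t : Finset ι) {p : ι → MvPolynomial (Fin r) R}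
    {β : ι → Fin r → ℕ} (h : ∀ i ∈ t, HasTop q u (p i) (β i)) :
    HasTop q u (∏ i ∈ t, p i) (∑ i ∈ t, β i) := by
  classical
  induction t using Finset.induction_on with
  | empty => simpa using HasTop.one
  | insert i t hi ih =>
    rw [Finset.prod_insert hi, Finset.sum_insert hi]
    exact (h i (Finset.mem_insert_self i t)).mul
      (ih fun j hj => h j (Finset.mem_insert_of_mem hj))

theorem hasTop_piPoly {k : ℕ} (hk : k ≤ r) (x : R) :
    HasTop q u (piPoly r k x) fun j => if (j : ℕ) < k then 1 else 0 := by
  have := HasTop.prod (q := q) (u := u) (Finset.range k) (p := fun j => linPoly r j x)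
    (β := fun j i => if (i : ℕ) = j then 1 else 0) fun j hj => by
      have hjr : j < r := (Finset.mem_range.mp hj).trans_le hk
      have e : (fun i : Fin r => if (i : ℕ) = j then 1 else 0) = Pi.single ⟨j, hjr⟩ 1 := by
        funext i
        simp [Pi.single_apply, Fin.ext_iff]
      rw [HasTop, e, polyL_linPoly q u hjr, Lmon_single, pow_one, sub_sub_cancel_left,
        Algebra.algebraMap_eq_smul_one, ← Lmon_zero]
      refine neg_mem (Submodule.smul_mem _ _ (Submodule.subset_span ⟨0, ?_, rfl⟩))
      exact Pi.lt_def.mpr ⟨fun _ => Nat.zero_le _, ⟨j, hjr⟩, by simp⟩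
  convert this using 1
  · rfl
  · funext i
    simp [Finset.sum_apply]

/-- The exponent of the leading monomial of `π_a`. -/
def topExp (a : Chain m r) (x : Fin r) : ℕ :=
  ∑ l : Fin m, if (x : ℕ) < a.val l.castSucc then 1 else 0

/-- The exponent of the leading monomial of `π̃_{a'}`. -/
def dualExp (a : Chain m r) (x : Fin r) : ℕ :=
  ∑ l : Fin m, if (x : ℕ) < r - a.val l.succ then 1 else 0

theorem hasTop_chainPoly (a : Chain m r) : HasTop q u (chainPoly u a) (topExp a) := by
  convert HasTop.prod (q := q) (u := u) Finset.univ fun (l : Fin m) _ =>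
    hasTop_piPoly (a.val_le l.castSucc) (u l) using 1
  · rfl
  · funext x
    simp [topExp]

theorem hasTop_dualPoly (a : Chain m r) : HasTop q u (dualPoly u a) (dualExp a) := by
  convert HasTop.prod (q := q) (u := u) Finset.univ fun (l : Fin m) _ =>
    hasTop_piPoly (Nat.sub_le r (a.val l.succ)) (u l) using 1
  · rfl
  · funext x
    simp [dualExp]

theorem antitone_topExp (a : Chain m r) : Antitone (topExp a) := by
  intro x y hxy
  refine Finset.sum_le_sum fun l _ => ?_
  rw [Fin.le_def] at hxy
  split_ifs <;> omega

theorem antitone_dualExp (a : Chain m r) : Antitone (dualExp a) := by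
  intro x y hxy
  refine Finset.sum_le_sum fun l _ => ?_
  rw [Fin.le_def] at hxy
  split_ifs <;> omega

/-- The leading exponents of the two factors of `v_a` add up to `m - 1` at every place. -/
theorem topExp_add_dualExp (a : Chain m r) (x : Fin r) :
    topExp a x + dualExp a (a.w x) + 1 = m := by
  obtain ⟨h1, h2⟩ := a.block_spec x
  set k := a.block x
  have hw := a.w_apply k x h1 h2
  have hle := a.val_le k.succ
  have : ∑ l : Fin m, ((if (x : ℕ) < a.val l.castSucc then 1 else 0) +
      (if (a.w x : ℕ) < r - a.val l.succ then 1 else 0) + if l = k then 1 else 0) =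
      ∑ l : Fin m, 1 := by
    refine Finset.sum_congr rfl fun l _ => ?_
    rcases lt_trichotomy l k with h | rfl | h
    · have e1 := a.val_succ_le h
      have e2 := a.mono (Fin.castSucc_le_castSucc_iff.mpr h.le)
      rw [if_neg (by omega), if_pos (by omega), if_neg h.ne]
    · rw [if_neg (by omega), if_neg (by omega), if_pos rfl]
    · have e1 := a.val_succ_le h
      have e2 := a.mono (Fin.succ_le_succ_iff.mpr h.le)
      rw [if_pos (by omega), if_neg (by omega), if_neg h.ne']
  rw [Finset.sum_add_distrib, Finset.sum_add_distrib] at this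
  simpa [topExp, dualExp] using this

/-- The sum of the squares `(γ_j + 1)^2`. It is invariant under permutations and decreases when two
entries are moved towards each other. -/
def sqSum (γ : Fin r → ℕ) : ℕ := ∑ j, (γ j + 1) ^ 2

theorem sqSum_comp (γ : Fin r → ℕ) (w : Equiv.Perm (Fin r)) : sqSum (γ ∘ w) = sqSum γ :=
  Equiv.sum_comp w fun j => (γ j + 1) ^ 2

theorem sqSum_le_of_mem_hull {i : Fin (r - 1)} {c d : Fin r → ℕ} (h : d ∈ hull i c) :
    sqSum d ≤ sqSum c := by
  obtain ⟨h1, h2, h3, h4⟩ := h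
  rw [sqSum, sqSum, sum_eq_lo_hi i, sum_eq_lo_hi i fun j => (c j + 1) ^ 2]
  refine add_le_add ?_ (Finset.sum_le_sum fun j hj => ?_)
  · generalize d (lo i) = a' at *
    generalize d (hi i) = b' at *
    generalize c (lo i) = a at *
    generalize c (hi i) = b at *
    rcases le_total a b with hab | hab
    · rw [max_eq_right hab] at h3 h4
      zify at *
      nlinarith [mul_nonneg (sub_nonneg.mpr h3) (sub_nonneg.mpr h4)]
    · rw [max_eq_left hab] at h3 h4
      zify at *
      nlinarith [mul_nonneg (sub_nonneg.mpr h3) (sub_nonneg.mpr h4)]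
  · simp only [Finset.mem_filter, Finset.mem_univ, true_and] at hj
    rw [h1 j hj.1 hj.2]

theorem sqSum_lt_of_mem_strictHull {i : Fin (r - 1)} {c d : Fin r → ℕ} (h : d ∈ strictHull i c) :
    sqSum d < sqSum c := by
  obtain ⟨h1, h2, h3, h4⟩ := h
  rw [sqSum, sqSum, sum_eq_lo_hi i, sum_eq_lo_hi i fun j => (c j + 1) ^ 2]
  refine add_lt_add_of_lt_of_le ?_ (Finset.sum_le_sum fun j hj => ?_)
  · generalize d (lo i) = a' at *
    generalize d (hi i) = b' at *
    generalize c (lo i) = a at *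
    generalize c (hi i) = b at *
    rcases le_total a b with hab | hab
    · rw [max_eq_right hab] at h3 h4
      zify at *
      nlinarith [mul_pos (sub_pos.mpr h3) (sub_pos.mpr h4)]
    · rw [max_eq_left hab] at h3 h4
      zify at *
      nlinarith [mul_pos (sub_pos.mpr h3) (sub_pos.mpr h4)]
  · simp only [Finset.mem_filter, Finset.mem_univ, true_and] at hj
    rw [h1 j hj.1 hj.2]

theorem finHecke_mul_mem_sqSum (n : ℕ) {h : ArikiKoike r q u} (hh : h ∈ finHecke r q u) :
    ∀ x ∈ spanL q u {c | sqSum c < n}, h * x ∈ spanL q u {c | sqSum c < n} := by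
  induction hh using Algebra.adjoin_induction with
  | mem y hy =>
    obtain ⟨i, rfl⟩ := hy
    exact fun x hx => mul_mem_spanL (fun c hc => spanL_mono
      (fun d hd => (sqSum_le_of_mem_hull hd).trans_lt hc) (T_mul_Lmon_mem i c)) hx
  | algebraMap b =>
    intro x hx
    rw [← Algebra.smul_def]
    exact Submodule.smul_mem _ _ hx
  | add b c _ _ hb hc => intro x hx; rw [add_mul]; exact add_mem (hb x hx) (hc x hx)
  | mul b c _ _ hb hc => intro x hx; rw [mul_assoc]; exact hb _ (hc x hx)

/-- For decreasing `β`, the product `T_w L^β` is `L^{β ∘ w}` times a unit, up to terms whose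
exponents have a smaller sum of squares. -/
theorem Tperm_mul_Lmon {β : Fin r → ℕ} (hβ : Antitone β) (w : Equiv.Perm (Fin r)) :
    ∃ h : finHecke r q u, IsUnit h ∧
      Tperm r q u w * Lmon q u β - Lmon q u (β ∘ w) * h ∈ spanL q u {γ | sqSum γ < sqSum β} := by
  induction w using descent_induction with
  | one => exact ⟨1, isUnit_one, by simp⟩
  | step w i hi ih =>
    obtain ⟨h, hh, hmem⟩ := ih
    have hle : (β ∘ (w * s i)) (_root_.ArikiKoike.hi i) ≤ (β ∘ (w * s i)) (lo i) := by
      simpa using hβ hi.le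
    obtain ⟨h', hh', hmem'⟩ := T_mul_Lmon_of_le (q := q) (u := u) i hle
    refine ⟨h' * h, hh'.mul hh, ?_⟩
    have e : (β ∘ (w * s i)) ∘ s i = β ∘ w := by
      funext x
      simp
    rw [e] at hmem'
    have key : Tperm r q u w * Lmon q u β - Lmon q u (β ∘ w) * (h' * h : finHecke r q u) =
        T r q u (i + 1) * (Tperm r q u (w * s i) * Lmon q u β - Lmon q u (β ∘ (w * s i)) * h) +
        (T r q u (i + 1) * Lmon q u (β ∘ (w * s i)) - Lmon q u (β ∘ w) * h') * h := by
      rw [Tperm_of_descent q u hi, mul_sub, sub_mul, MulMemClass.coe_mul]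
      simp only [mul_assoc]
      abel
    rw [key]
    refine add_mem (finHecke_mul_mem_sqSum _ (T_mem_finHecke q u (by omega)) _ hmem)
      (mul_finHecke_mem (spanL_mono (fun γ hγ => ?_) hmem') h.2)
    have := sqSum_lt_of_mem_strictHull hγ
    rwa [sqSum_comp] at this

theorem sqSum_lt_of_lt {β γ : Fin r → ℕ} (h : γ < β) : sqSum γ < sqSum β := by
  obtain ⟨h1, j, hj⟩ := Pi.lt_def.mp h
  exact Finset.sum_lt_sum (fun k _ => Nat.pow_le_pow_left (Nat.succ_le_succ (h1 k)) 2)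
    ⟨j, Finset.mem_univ j, Nat.pow_lt_pow_left (Nat.succ_lt_succ hj) two_ne_zero⟩

/-- The weight of an exponent with respect to `ω`. -/
def weight (ω c : Fin r → ℕ) : ℕ := ∑ j, ω j * c j

theorem weight_add (ω c d : Fin r → ℕ) : weight ω (c + d) = weight ω c + weight ω d := by
  simp [weight, mul_add, Finset.sum_add_distrib]

theorem weight_mono (ω : Fin r → ℕ) {c d : Fin r → ℕ} (h : c ≤ d) : weight ω c ≤ weight ω d :=
  Finset.sum_le_sum fun j _ => Nat.mul_le_mul_left _ (h j)

theorem weight_lt {ω : Fin r → ℕ} (hω : ∀ j, 0 < ω j) {c d : Fin r → ℕ} (h : c < d) :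
    weight ω c < weight ω d := by
  obtain ⟨h1, j, hj⟩ := Pi.lt_def.mp h
  exact Finset.sum_lt_sum (fun k _ => Nat.mul_le_mul_left _ (h1 k))
    ⟨j, Finset.mem_univ j, Nat.mul_lt_mul_of_pos_left hj (hω j)⟩

/-- With respect to the weight `β + 1`, exponents with a smaller sum of squares than `β` weigh less
than `β`, since `2xy ≤ x^2 + y^2`. -/
theorem weight_lt_of_sqSum_lt {β γ : Fin r → ℕ} (h : sqSum γ < sqSum β) :
    weight (fun j => β j + 1) γ < weight (fun j => β j + 1) β := by
  have h1 : 2 * ∑ j, (β j + 1) * (γ j + 1) ≤ sqSum β + sqSum γ := by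
    rw [sqSum, sqSum, ← Finset.sum_add_distrib, Finset.mul_sum]
    refine Finset.sum_le_sum fun j _ => ?_
    rw [← mul_assoc]
    exact two_mul_le_add_sq _ _
  have h2 : sqSum β = weight (fun j => β j + 1) β + ∑ j, (β j + 1) := by
    rw [sqSum, weight, ← Finset.sum_add_distrib]
    exact Finset.sum_congr rfl fun j _ => by ring
  have h3 : ∑ j, (β j + 1) * (γ j + 1) = weight (fun j => β j + 1) γ + ∑ j, (β j + 1) := by
    rw [weight, ← Finset.sum_add_distrib]
    exact Finset.sum_congr rfl fun j _ => by ring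
  omega

/-- For an increasing weight `ω`, the exponents of small weight are stable under reduction. -/
theorem weight_reduct {ω : Fin r → ℕ} (hω : Monotone ω) (n : ℕ) (c : Fin r → ℕ) (j : Fin r)
    (hc : weight ω (c + Pi.single j m) < n) (d : Fin r → ℕ) (hd : d ∈ reductSet m j) :
    weight ω (c + d) < n := by
  have h1 : weight ω d ≤ ω j * m := by
    have : weight ω d ≤ ∑ k, ω j * d k := by
      refine Finset.sum_le_sum fun k _ => ?_
      rcases le_or_gt k j with h | h
      · exact Nat.mul_le_mul_right _ (hω h)
      · simp [hd.1 k h]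
    rw [← Finset.mul_sum] at this
    exact this.trans (Nat.mul_le_mul_left _ hd.2.2)
  have h2 : weight ω (Pi.single j m) = ω j * m := by
    rw [weight, Finset.sum_eq_single j]
    · simp
    · intro k _ hk
      simp [hk]
    · simp
  rw [weight_add] at hc ⊢
  omega

/-- The weight that singles out the leading term of `v_a`. -/
noncomputable def chainWeight (a : Chain m r) (j : Fin r) : ℕ := dualExp a (a.w j) + 1

theorem chainWeight_mono (a : Chain m r) : Monotone (chainWeight a) := by
  intro x y hxy
  have h1 := topExp_add_dualExp a x
  have h2 := topExp_add_dualExp a y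
  have h3 := antitone_topExp a hxy
  rw [chainWeight, chainWeight]
  omega

/-- The leading term of `v_a` is `(L_1 ⋯ L_r)^{m-1}` times a unit of the finite Hecke algebra; the
other terms have smaller weight. -/
theorem v_leading (hm : 0 < m) (a : Chain m r) : ∃ h : finHecke r q u, IsUnit h ∧
    v q u a - Lmon q u (fun _ : Fin r => m - 1) * (h : ArikiKoike r q u) ∈
      spanL q u {c | weight (chainWeight a) c < weight (chainWeight a) fun _ : Fin r => m - 1} := by
  set α := topExp a
  set β := dualExp a
  set ω := chainWeight a with hω
  have hpos : ∀ j, 0 < ω j := fun j => Nat.succ_pos _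
  have htop : (fun _ => m - 1 : Fin r → ℕ) = α + β ∘ a.w := by
    funext x
    have : α x + β (a.w x) + 1 = m := topExp_add_dualExp a x
    simp only [Pi.add_apply, Function.comp_apply]
    omega
  obtain ⟨h, hh, hmem⟩ := Tperm_mul_Lmon (q := q) (u := u) (antitone_dualExp a) a.w
  -- the part of `T_w π̃` other than the leading term
  have h1 : Tperm r q u a.w * polyL q u (dualPoly u a) - Lmon q u (β ∘ a.w) * h ∈
      spanL q u {γ | sqSum γ < sqSum β} := by
    have e : Tperm r q u a.w * polyL q u (dualPoly u a) - Lmon q u (β ∘ a.w) * h =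
        Tperm r q u a.w * (polyL q u (dualPoly u a) - Lmon q u β) +
          (Tperm r q u a.w * Lmon q u β - Lmon q u (β ∘ a.w) * h) := by
      rw [mul_sub]
      abel
    rw [e]
    refine add_mem (finHecke_mul_mem_sqSum _ (Tperm_mem_finHecke q u _) _ ?_) hmem
    refine (Submodule.span_le.mpr ?_ : lowerSpan q u β ≤ _) (hasTop_dualPoly a)
    rintro _ ⟨c, hc, rfl⟩
    exact Lmon_mem (sqSum_lt_of_lt hc)
  have h2 : Tperm r q u a.w * polyL q u (dualPoly u a) - Lmon q u (β ∘ a.w) * h ∈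
      spanL q u {γ | weight ω γ < weight ω (β ∘ a.w)} := by
    refine spanL_mono (fun γ hγ => ?_) h1
    refine weight_lt_of_sqSum_lt (β := β ∘ a.w) ?_
    rwa [sqSum_comp]
  refine ⟨h, hh, ?_⟩
  have e : v q u a - Lmon q u (fun _ : Fin r => m - 1) * (h : ArikiKoike r q u) =
      (polyL q u (chainPoly u a) - Lmon q u α) * (Lmon q u (β ∘ a.w) * h) +
      ((polyL q u (chainPoly u a) - Lmon q u α) + Lmon q u α) *
        (Tperm r q u a.w * polyL q u (dualPoly u a) - Lmon q u (β ∘ a.w) * h) := by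
    rw [v_eq q u hm, htop, Lmon_add, sub_add_cancel, mul_sub, sub_mul]
    simp only [mul_assoc]
    abel
  rw [e, htop]
  have hlow : ∀ (S : Set (Fin r → ℕ)) (x : ArikiKoike r q u), x ∈ spanL q u S →
      ∀ y ∈ lowerSpan q u α, ∀ S' : Set (Fin r → ℕ), (∀ c, c < α → ∀ d ∈ S, c + d ∈ S') →
        y * x ∈ spanL q u S' := by
    intro S x hx y hy S' hS
    induction hy using Submodule.span_induction with
    | mem y hy =>
      obtain ⟨c, hc, rfl⟩ := hy
      exact mul_mem_spanL (fun d hd => by rw [← Lmon_add]; exact Lmon_mem (hS c hc d hd)) hx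
    | zero => simp
    | add y z _ _ hy hz => rw [add_mul]; exact add_mem hy hz
    | smul b y _ hy => rw [smul_mul_assoc]; exact Submodule.smul_mem _ _ hy
  refine add_mem ?_ ?_
  · refine hlow {β ∘ a.w} _ (Lmon_mul_mem (Set.mem_singleton _) h.2) _ (hasTop_chainPoly a) _
      fun c hc d hd => ?_
    rw [Set.mem_singleton_iff.mp hd, Set.mem_ofPred_eq, weight_add, weight_add]
    exact Nat.add_lt_add_right (weight_lt hpos hc) _
  · rw [add_mul]
    refine add_mem (hlow _ _ h2 _ (hasTop_chainPoly a) _ fun c hc d hd => ?_)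
      (mul_mem_spanL (fun d hd => ?_) h2)
    · rw [Set.mem_ofPred_eq, weight_add, weight_add]
      exact Nat.add_lt_add_of_le_of_lt (weight_mono ω hc.le) hd
    · rw [← Lmon_add]
      refine Lmon_mem ?_
      rw [Set.mem_ofPred_eq, weight_add, weight_add]
      exact Nat.add_lt_add_left hd _

/-! ### Linear independence of the `v_a T_w` -/

theorem exists_eq_sum_Tperm {x : ArikiKoike r q u} (hx : x ∈ finHecke r q u) :
    ∃ y : Equiv.Perm (Fin r) → R, x = ∑ w, y w • Tperm r q u w := by
  rw [← Subalgebra.mem_toSubmodule, finHecke_toSubmodule, Submodule.mem_span_range_iff_exists_fun]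
    at hx
  obtain ⟨y, hy⟩ := hx
  exact ⟨y, hy.symm⟩

theorem sum_eq_zero_of_Lmon_mul {c : Fin r → Fin m} (hm : 0 < m) {y : Equiv.Perm (Fin r) → R}
    (h : Lmon q u (fun j => (c j : ℕ)) * ∑ w, y w • Tperm r q u w = 0) : y = 0 := by
  have hli := (linearIndependent_Lmon_mul_Tperm (r := r) q u hm).comp (fun w => (c, w))
    (Prod.mk_right_injective c)
  rw [Fintype.linearIndependent_iff] at hli
  funext w
  refine hli y ?_ w
  rw [Finset.mul_sum] at h
  simpa [mul_smul_comm] using h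

/-- An element `L^c h` with `c_j < m` and `h` in the finite Hecke algebra that is a combination of
terms of smaller weight is zero. -/
theorem eq_zero_of_mem_spanL (hm : 0 < m) {ω : Fin r → ℕ} (hω : Monotone ω) {c : Fin r → Fin m}
    {h : ArikiKoike r q u} (hh : h ∈ finHecke r q u)
    (hmem : Lmon q u (fun j => (c j : ℕ)) * h ∈
      spanL q u {d | weight ω d < weight ω fun j => (c j : ℕ)}) : h = 0 := by
  obtain ⟨y, rfl⟩ := exists_eq_sum_Tperm hh
  have h1 := spanL_le_reduced hm (fun e j he d hd => weight_reduct hω _ e j he d hd) hmem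
  set F := fun p : (Fin r → Fin m) × Equiv.Perm (Fin r) =>
    Lmon q u (fun j => (p.1 j : ℕ)) * Tperm r q u p.2 with hF
  have hdis := (linearIndependent_Lmon_mul_Tperm (r := r) q u hm).disjoint_span_image
    (s := {p | p.1 = c}) (t := {p | weight ω (fun j => (p.1 j : ℕ)) < weight ω fun j => (c j : ℕ)})
    (Set.disjoint_left.mpr fun p hp hp' => by
      rw [Set.mem_ofPred_eq] at hp hp'
      rw [hp] at hp'
      exact lt_irrefl _ hp')
  have h2 : Lmon q u (fun j => (c j : ℕ)) * ∑ w, y w • Tperm r q u w = 0 := by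
    refine Submodule.disjoint_def.mp hdis _ ?_ ?_
    · rw [Finset.mul_sum]
      refine Submodule.sum_mem _ fun w _ => ?_
      rw [mul_smul_comm]
      exact Submodule.smul_mem _ _ (Submodule.subset_span ⟨(c, w), rfl, rfl⟩)
    · refine (spanL_le ?_ : spanL q u _ ≤ _) h1
      rintro d ⟨hd, hdm⟩ h hh
      obtain ⟨z, rfl⟩ := exists_eq_sum_Tperm hh
      rw [Finset.mul_sum]
      refine Submodule.sum_mem _ fun w _ => ?_
      rw [mul_smul_comm]
      exact Submodule.smul_mem _ _ (Submodule.subset_span ⟨(fun j => ⟨d j, hdm j⟩, w), hd, rfl⟩)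
  rw [sum_eq_zero_of_Lmon_mul hm h2]
  simp

theorem linearIndependent_v_mul_Tperm (hm : 0 < m) (a : Chain m r) :
    LinearIndependent R fun w => v q u a * Tperm r q u w := by
  rw [Fintype.linearIndependent_iff]
  intro g hg
  set x := ∑ w, g w • Tperm r q u w with hx
  have hxm : x ∈ finHecke r q u :=
    Subalgebra.sum_mem _ fun w _ => Subalgebra.smul_mem _ (Tperm_mem_finHecke q u w) _
  have hvx : v q u a * x = 0 := by
    rw [hx, Finset.mul_sum, ← hg]
    simp only [mul_smul_comm]
  obtain ⟨h, ⟨h', rfl⟩, hmem⟩ := v_leading (q := q) (u := u) hm a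
  have h1 := mul_finHecke_mem hmem hxm
  rw [sub_mul, hvx, zero_sub, mul_assoc, Submodule.neg_mem_iff] at h1
  have h2 : ((h' : finHecke r q u) : ArikiKoike r q u) * x = 0 :=
    eq_zero_of_mem_spanL hm (chainWeight_mono a) (c := fun _ => ⟨m - 1, by omega⟩)
      (mul_mem (h' : finHecke r q u).2 hxm) h1
  have h3 : x = 0 := by
    have h4 : (h' : finHecke r q u) * ⟨x, hxm⟩ = 0 := Subtype.ext h2
    have h5 := (Units.mul_right_eq_zero h').mp h4
    exact congrArg Subtype.val h5
  have h6 : g = 0 := sum_eq_zero_of_Lmon_mul (q := q) (u := u) (c := fun _ => ⟨0, hm⟩) hm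
    (by rw [← hx, h3, mul_zero])
  exact congrFun h6

end RightIdeal

end ArikiKoike

theorem mainTheorem6 {R : Type*} [CommRing R] (m r : ℕ) (hm : 0 < m) (q : Rˣ) (u : Fin m → R)
    (a : ArikiKoike.Chain m r) :
    Module.Free R (ArikiKoike.rightIdeal q u (ArikiKoike.v q u a)) ∧
    ∃ b : Module.Basis (Equiv.Perm (Fin r)) R (ArikiKoike.rightIdeal q u (ArikiKoike.v q u a)),
      ∀ w : Equiv.Perm (Fin r),
        (b w : ArikiKoike r q u) = ArikiKoike.v q u a * ArikiKoike.Tperm r q u w := by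
  let b := (Module.Basis.span (ArikiKoike.linearIndependent_v_mul_Tperm (q := q) (u := u) hm a)).map
    (LinearEquiv.ofEq _ _ (ArikiKoike.rightIdeal_v_eq_span hm a).symm)
  refine ⟨Module.Free.of_basis b, b, fun w => ?_⟩
  simp only [b, Module.Basis.map_apply, LinearEquiv.coe_ofEq_apply, Module.Basis.span_apply]
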